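/- Let $S$ be a compact connected surface, possibly with boundary (for instance the surface $S_{g,n}$ obtained by removing $n$ disjoint open disks from a closed oriented surface of genus $g$), with a finite polygonal cellular decomposition. That is, a finite simple graph $(V,E)$ is embedded in $S$ such that every vertex has degree at least three, every component of $\partial S$ contains a vertex and is a union of edges, and the complement of the graph has finitely many components, called faces, each of which has closure homeomorphic to a closed disk and is bounded by a simple closed curve consisting of edges. Let $F$ be the set of faces and $N(P)\ge 3$ the number of vertices of $P\in F$. For $W\subset V$ let $F_W$ be the set of faces having at least one vertex in $W$, and let $N(P,W)$ be the number of vertices of $P$ that lie in $W$. A generalized circle in the hyperbolic plane $\mathbb H$ is a circle of radius $r$ (geodesic curvature $k=\coth r>1$), a horocycle ($k=1$), or a hypercycle, i.e. one of the two components of the set of points at distance $r>0$ from a geodesic, its axis ($k=\tanh r<1$). The generalized disk that it bounds is the side towards which it bends. A generalized circle packing of a polygon $P$ with vertices $v_1,\dots,v_m$ in cyclic order consists of generalized circles $C_1,\dots,C_m$ in $\mathbb H$ such that the closed generalized disks of adjacent vertices are externally tangent, those of non-adjacent vertices are disjoint, and some hyperbolic circle $C_P$ is perpendicular to all the $C_i$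 at the points of tangency. Its generalized polygon $\tilde P$ is the region containing the centre of $C_P$ and bounded by the geodesics perpendicular to $C_i$ and $C_{i+1}$ at their point of tangency and by the axes of the hypercycles among the $C_i$. A generalized hyperbolic circle packing of $S$ with geodesic curvatures $k\in\mathbb R_{+}^{V}$ consists of a generalized circle packing of every face $P$ in which the generalized circle $C_{v,P}$ of each vertex $v$ of $P$ has geodesic curvature $k_v$. Gluing the polygons $\tilde P$ isometrically along the edges that come from the same edge of $E$, so that the points of tangency and the disks of each vertex match, gives a surface $\tilde S$ with a generalized circle packing metric. The arcs $C_{v,P}\cap\tilde P$ form the generalized circle $C_v$ of the vertex $v$ on $\tilde S$, whose total geodesic curvature is the sum over the faces $P$ with vertex $v$ of the integral of the geodesic curvature along the arc $C_{v,P}\cap\tilde P$. Let $L\in\mathbb R_{+}^{V}$, that is, $L_v>0$ for all $v\in V$. Then there exists a generalized hyperbolic circle packing of $S$ with total geodesic curvature $L_v$ at every vertex $v\in V$ if and only if $$\sum_{w\in W}L_w<\sum_{P\in F_W}\pi\min\{N(P,W),\,N(P)-2\}\qquad\text{for every nonempty } W\subset V.$$ Moreover, the packing is unique if it exists: any two generalized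 hyperbolic circle packings of $S$ with total geodesic curvatures $L$ have the same geodesic curvatures $k$, and there is an isometry between their glued surfaces that maps the generalized circle of each vertex to the generalized circle of that vertex and the piece of each face to the piece of that face. -/

import Mathlib

open MeasureTheory UpperHalfPlane
open scoped MatrixGroups Manifold

/-! ### Finite polygonal cellular decompositions of a surface -/

/-- A finite simple graph embedded in a surface `S` (a topological two-manifold, possibly with
boundary): vertices are distinct points, edges are simple arcs joining their end points, and
two arcs meet at most in vertices.  Every boundary component of `S` contains a vertex and is a
union of edges. -/
structure EmbeddedGraph (S : Type*) [TopologicalSpace S]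
    [ChartedSpace (EuclideanHalfSpace 2) S] where
  V : Type
  [fintypeV : Fintype V]
  graph : SimpleGraph V
  vertex : V → S
  vertex_injective : Function.Injective vertex
  arc : graph.edgeSet → Set S
  exists_param : ∀ (v w : V) (h : graph.Adj v w), ∃ γ : unitInterval → S,
    Continuous γ ∧ Function.Injective γ ∧ γ 0 = vertex v ∧ γ 1 = vertex w ∧
      Set.range γ = arc ⟨s(v, w), h⟩
  mem_of_vertex_mem_arc : ∀ (e : graph.edgeSet) (v : V), vertex v ∈ arc e → v ∈ e.1
  arc_inter_subset : ∀ e e' : graph.edgeSet, e ≠ e' → arc e ∩ arc e' ⊆ Set.range vertex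
  boundary_has_vertex : ∀ x ∈ (𝓡∂ 2).boundary S,
    ∃ v, vertex v ∈ connectedComponentIn ((𝓡∂ 2).boundary S) x
  boundary_union_arcs : ∀ x ∈ (𝓡∂ 2).boundary S, ∃ A : Set graph.edgeSet,
    connectedComponentIn ((𝓡∂ 2).boundary S) x = ⋃ e ∈ A, arc e

attribute [instance] EmbeddedGraph.fintypeV

/-- The union of all vertices and edges, as a subset of the surface. -/
def EmbeddedGraph.skeleton {S : Type*} [TopologicalSpace S]
    [ChartedSpace (EuclideanHalfSpace 2) S] (G : EmbeddedGraph S) : Set S :=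
  Set.range G.vertex ∪ ⋃ e, G.arc e

/-- A finite polygonal cellular decomposition of `S`: an embedded finite simple graph all of
whose vertices have degree at least three, such that the faces (the connected components of the
complement of the skeleton) are finite in number, each has closure homeomorphic to a closed
disk, and each is bounded by a simple closed curve of edges.  The corners of the face `P`, in
cyclic order along that curve, are `corner P 0, …, corner P (sides P - 1)`. -/
structure PolygonalDecomposition (S : Type*) [TopologicalSpace S]
    [ChartedSpace (EuclideanHalfSpace 2) S] extends EmbeddedGraph S where
  three_le_degree : ∀ v : V, 3 ≤ (graph.neighborSet v).ncard
  F : Type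
  [fintypeF : Fintype F]
  face : F → Set S
  face_injective : Function.Injective face
  range_face : Set.range face =
    {A | ∃ x ∈ toEmbeddedGraph.skeletonᶜ, A = connectedComponentIn toEmbeddedGraph.skeletonᶜ x}
  closure_face_homeo : ∀ P, Nonempty
    (closure (face P) ≃ₜ Metric.closedBall (0 : EuclideanSpace ℝ (Fin 2)) 1)
  sides : F → ℕ
  three_le_sides : ∀ P, 3 ≤ sides P
  corner : ∀ P, Fin (sides P) → V
  corner_injective : ∀ P, Function.Injective (corner P)
  corner_adj : ∀ P i, graph.Adj (corner P i) (corner P (finRotate (sides P) i))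
  frontier_face : ∀ P, frontier (face P) =
    ⋃ i, arc ⟨s(corner P i, corner P (finRotate (sides P) i)), corner_adj P i⟩

attribute [instance] PolygonalDecomposition.fintypeF

namespace PolygonalDecomposition

variable {S : Type*} [TopologicalSpace S] [ChartedSpace (EuclideanHalfSpace 2) S]

/-- The edge of the face `P` between its consecutive corners `i` and `i + 1`. -/
def side (T : PolygonalDecomposition S) (P : T.F) (i : Fin (T.sides P)) : Sym2 T.V :=
  s(T.corner P i, T.corner P (finRotate (T.sides P) i))

open scoped Classical in
/-- `F_W`: the faces having at least one vertex in `W`. -/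
noncomputable def facesMeeting (T : PolygonalDecomposition S) (W : Finset T.V) : Finset T.F :=
  {P | ∃ v ∈ W, v ∈ Set.range (T.corner P)}

open scoped Classical in
/-- `N(P, W)`: the number of elements of `W` that are vertices of the face `P`. -/
noncomputable def numIn (T : PolygonalDecomposition S) (P : T.F) (W : Finset T.V) : ℕ :=
  ({v ∈ W | v ∈ Set.range (T.corner P)} : Finset T.V).card

end PolygonalDecomposition

/-! ### Generalized circles in the hyperbolic plane

The hyperbolic plane is the upper half-plane `ℍ` with its hyperbolic distance; `SL(2, ℝ)` acts
on it by orientation preserving isometries. -/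

/-- The geodesic carried by `g` onto the imaginary axis.  Every geodesic is of this form. -/
def geodesicLine (g : SL(2, ℝ)) : Set ℍ := {z | (g • z).re = 0}

/-- One of the two closed half-planes bounded by `geodesicLine g`. -/
def halfPlane (g : SL(2, ℝ)) : Set ℍ := {z | 0 ≤ (g • z).re}

/-- Generalized circles: circles with centre `w` and radius `r`; horocycles, i.e. the isometric
images of the horizontal line at height one; hypercycles, i.e. for a geodesic and `r > 0` the
component, on a chosen side of the geodesic, of the set of points at distance `r` from it.
(Replacing `g` by its product with the half turn about `i` exchanges the two sides.) -/
inductive GenCircle : Type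
  | circle (w : ℍ) (r : ℝ) (hr : 0 < r) : GenCircle
  | horocycle (g : SL(2, ℝ)) : GenCircle
  | hypercycle (g : SL(2, ℝ)) (r : ℝ) (hr : 0 < r) : GenCircle

namespace GenCircle

/-- The generalized circle as a curve in `ℍ`. -/
def carrier : GenCircle → Set ℍ
  | circle w r _ => Metric.sphere w r
  | horocycle g => {z | (g • z).im = 1}
  | hypercycle g r _ => {z | z ∈ halfPlane g ∧ Metric.infDist z (geodesicLine g) = r}

/-- The closed generalized disk bounded by a generalized circle: the (geodesically convex) side
towards which the curve bends.  For a hypercycle it is the side that contains the axis. -/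
def disk : GenCircle → Set ℍ
  | circle w r _ => Metric.closedBall w r
  | horocycle g => {z | 1 ≤ (g • z).im}
  | hypercycle g r _ => {z | z ∈ halfPlane g → Metric.infDist z (geodesicLine g) ≤ r}

/-- The absolute value of the (constant) geodesic curvature: `coth r` for a circle, `1` for a
horocycle, `tanh r` for a hypercycle. -/
noncomputable def curvature : GenCircle → ℝ
  | circle _ r _ => (Real.tanh r)⁻¹
  | horocycle _ => 1
  | hypercycle _ r _ => Real.tanh r

/-- For a hypercycle, the closed half-plane bounded by its axis in which the hypercycle lies;
no condition for circles and horocycles. -/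
def axisSide : GenCircle → Set ℍ
  | circle _ _ _ => Set.univ
  | horocycle _ => Set.univ
  | hypercycle g _ _ => halfPlane g

end GenCircle

/-- The curves `A` and `B` pass through `p` and are perpendicular there.  The upper half-plane
model is conformal, so that angles may be measured with Euclidean tangent vectors. -/
def PerpAt (A B : Set ℍ) (p : ℍ) : Prop :=
  p ∈ A ∧ p ∈ B ∧
    ∀ u ∈ tangentConeAt ℝ ((fun z : ℍ => (z : ℂ)) '' A) (p : ℂ),
    ∀ v ∈ tangentConeAt ℝ ((fun z : ℍ => (z : ℂ)) '' B) (p : ℂ), inner ℝ u v = 0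

/-! ### Generalized circle packings on a polygon -/

/-- A generalized circle packing of an abstract polygon with `n` vertices in cyclic order: the
disks of adjacent vertices are tangent (they have exactly one common point, the point
`tangency i` for the edge between the vertices `i` and `i + 1`), those of non-adjacent vertices
are disjoint, and there is a hyperbolic circle (the dual circle) perpendicular to all the
generalized circles at the tangency points. -/
structure PolygonPacking (n : ℕ) where
  circle : Fin n → GenCircle
  tangency : Fin n → ℍ
  dualCenter : ℍ
  dualRadius : ℝ
  dualRadius_pos : 0 < dualRadius
  tangent : ∀ i, (circle i).disk ∩ (circle (finRotate n i)).disk = {tangency i}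
  disjoint : ∀ i j, i ≠ j → j ≠ finRotate n i → i ≠ finRotate n j →
    Disjoint (circle i).disk (circle j).disk
  dual_perp : ∀ i,
    PerpAt (Metric.sphere dualCenter dualRadius) (circle i).carrier (tangency i) ∧
    PerpAt (Metric.sphere dualCenter dualRadius) (circle (finRotate n i)).carrier (tangency i)

namespace PolygonPacking

variable {n : ℕ}

/-- `geodesicLine g` is the geodesic perpendicular to the circles `i` and `i + 1` at their point
of tangency (the line of centres, on which the edge joining the two generalized vertices lies),
and `halfPlane g` is the half-plane on the side of the centre of the dual circle. -/
def IsEdgeLine (Q : PolygonPacking n) (i : Fin n) (g : SL(2, ℝ)) : Prop :=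
  PerpAt (geodesicLine g) (Q.circle i).carrier (Q.tangency i) ∧
    PerpAt (geodesicLine g) (Q.circle (finRotate n i)).carrier (Q.tangency i) ∧
    Q.dualCenter ∈ halfPlane g

/-- The generalized polygon: the region containing the centre of the dual circle and bounded by
the geodesic edges and, at the vertices with a hypercycle, by the axes of the hypercycles.  Its
generalized vertices are the centres of the circles, the ideal centres of the horocycles and
segments of the axes of the hypercycles. -/
def polygon (Q : PolygonPacking n) : Set ℍ :=
  {z | (∀ i g, Q.IsEdgeLine i g → z ∈ halfPlane g) ∧ ∀ i, z ∈ (Q.circle i).axisSide}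

/-- The edge of the generalized polygon between the generalized vertices `i` and `i + 1`. -/
def edge (Q : PolygonPacking n) (i : Fin n) : Set ℍ :=
  {z | z ∈ Q.polygon ∧ ∃ g, Q.IsEdgeLine i g ∧ z ∈ geodesicLine g}

/-- The total geodesic curvature of the part of the `i`-th generalized circle inside the
generalized polygon: the integral of the geodesic curvature with respect to hyperbolic arc
length (one-dimensional Hausdorff measure of the hyperbolic metric). -/
noncomputable def arcCurvature (Q : PolygonPacking n) (i : Fin n) : ℝ :=
  ∫ _z in (Q.circle i).carrier ∩ Q.polygon, (Q.circle i).curvature ∂(μH[1] : Measure ℍ)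

end PolygonPacking

/-! ### Generalized circle packing metrics on a surface -/

/-- The data of a generalized hyperbolic circle packing with geodesic curvatures `k` on a
decomposed surface: for each face, a generalized circle packing of that polygon whose circle at
each corner has the geodesic curvature prescribed by `k`. -/
structure CirclePackingMetric {S : Type*} [TopologicalSpace S]
    [ChartedSpace (EuclideanHalfSpace 2) S] (T : PolygonalDecomposition S) where
  k : T.V → ℝ
  k_pos : ∀ v, 0 < k v
  packing : ∀ P : T.F, PolygonPacking (T.sides P)
  curvature_eq : ∀ P i, ((packing P).circle i).curvature = k (T.corner P i)

namespace CirclePackingMetric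

variable {S : Type*} [TopologicalSpace S] [ChartedSpace (EuclideanHalfSpace 2) S]
  {T : PolygonalDecomposition S}

/-- A point of the disjoint union of the generalized polygons of all faces. -/
abbrev Point (M : CirclePackingMetric T) : Type := Σ P : T.F, (M.packing P).polygon

/-- Two points are glued if they lie on edges of generalized polygons that come from the same
edge of the decomposition, at the same distance from the tangency point and on the same side
of it (that is, in the disk of the same end point of the edge). -/
def Glue (M : CirclePackingMetric T) (x y : M.Point) : Prop :=
  ∃ (i : Fin (T.sides x.1)) (j : Fin (T.sides y.1)),
    T.side x.1 i = T.side y.1 j ∧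
    (x.2 : ℍ) ∈ (M.packing x.1).edge i ∧ (y.2 : ℍ) ∈ (M.packing y.1).edge j ∧
    dist (x.2 : ℍ) ((M.packing x.1).tangency i) = dist (y.2 : ℍ) ((M.packing y.1).tangency j) ∧
    ∀ i' j', T.corner x.1 i' = T.corner y.1 j' → T.corner x.1 i' ∈ T.side x.1 i →
      ((x.2 : ℍ) ∈ ((M.packing x.1).circle i').disk ↔
        (y.2 : ℍ) ∈ ((M.packing y.1).circle j').disk)

/-- The surface obtained by gluing the generalized polygons along their edges (the quotient by
the equivalence relation generated by `Glue`). -/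
def Surface (M : CirclePackingMetric T) : Type := Quot M.Glue

/-- The point of the glued surface represented by a point of a generalized polygon. -/
def toSurface (M : CirclePackingMetric T) (x : M.Point) : M.Surface := Quot.mk _ x

/-- `M.Chain a b ℓ`: one can go from `a` to `b` in the glued surface by finitely many geodesic
segments, each inside one (convex) generalized polygon, of total length `ℓ`. -/
inductive Chain (M : CirclePackingMetric T) : M.Surface → M.Surface → ℝ → Prop
  | nil (a : M.Surface) : Chain M a a 0
  | cons (P : T.F) (x y : (M.packing P).polygon) (b : M.Surface) (ℓ : ℝ) :
      Chain M (M.toSurface ⟨P, y⟩) b ℓ →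
      Chain M (M.toSurface ⟨P, x⟩) b (dist (x : ℍ) (y : ℍ) + ℓ)

/-- The generalized circle packing metric on the glued surface. -/
noncomputable def surfaceDist (M : CirclePackingMetric T) (a b : M.Surface) : ENNReal :=
  ⨅ (ℓ : ℝ) (_ : M.Chain a b ℓ), ENNReal.ofReal ℓ

/-- The piece of the glued surface that comes from the face `P`. -/
def tile (M : CirclePackingMetric T) (P : T.F) : Set M.Surface :=
  Set.range fun x : (M.packing P).polygon => M.toSurface ⟨P, x⟩

/-- The generalized circle of the vertex `v` on the glued surface. -/
def surfaceCircle (M : CirclePackingMetric T) (v : T.V) : Set M.Surface :=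
  {a | ∃ (P : T.F) (i : Fin (T.sides P)) (x : (M.packing P).polygon),
    T.corner P i = v ∧ (x : ℍ) ∈ ((M.packing P).circle i).carrier ∧ a = M.toSurface ⟨P, x⟩}

open scoped Classical in
/-- The total geodesic curvature at the vertex `v`: that of its generalized circle on the glued
surface, which is composed of one arc for each face with vertex `v`. -/
noncomputable def totalCurvature (M : CirclePackingMetric T) (v : T.V) : ℝ :=
  ∑ P : T.F, ∑ i : Fin (T.sides P) with T.corner P i = v, (M.packing P).arcCurvature i

/-- Two generalized circle packings are the same if the circles have the same geodesic curvatures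
and there is an isometry between the glued surfaces which maps the circle of each vertex to the
circle of that vertex and the piece of each face to the piece of that face. -/
def Same (M M' : CirclePackingMetric T) : Prop :=
  M.k = M'.k ∧ ∃ Φ : M.Surface ≃ M'.Surface,
    (∀ a b, M'.surfaceDist (Φ a) (Φ b) = M.surfaceDist a b) ∧
    (∀ v, Φ '' M.surfaceCircle v = M'.surfaceCircle v) ∧
    ∀ P, Φ '' M.tile P = M'.tile P

end CirclePackingMetric

/-!
Only the combinatorics of the decomposition matters: the packing of a face can be chosen
independently of all others once the geodesic curvatures `k` are given, so that the theorem is a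
statement about the map from `k` to the total geodesic curvatures.

*One face.* In hyperboloid coordinates about the centre of the dual circle (`HypFrame`), a
generalized circle of curvature `k` is a level set `α * time - ⟪β, pos⟫ = k` of a linear form with
`‖β‖² - α² = 1 - k²`.  Perpendicularity to the dual circle of radius `arsinh s` forces
`α = k * √(1 + s²)` and `β = p * (k * s ± I)` for the direction `p` of the tangency point, and external
tangency forces the signs to alternate (`PolygonPacking.exists_standardPosition`).  Hence the arc at
a vertex is seen from the dual centre under the angle `2 * halfAngle (k * s)`, with
`halfAngle x = π / 2 - arctan x`, and these angles add up to `2 * π`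
(`PolygonPacking.StandardPosition.sum_halfAngle`).  This equation determines `s`, hence the packing
up to isometry (`PolygonPacking.exists_congruence`), and conversely a solution `s` gives a packing
(`exists_polygonPacking`).  The part of a generalized circle in the polygon is its part inside the
dual circle (`PolygonPacking.StandardPosition.carrier_inter_polygon`), whose total geodesic
curvature is `arcTurn k (k * s)`, where `arcTurn k X = ∫ 2 / ((1 + x²) √(1 + x² / k²))` over
`[0, X]`.

*All faces.* The function `arcTurn` increases in both variables and lies below `2 * arctan X`, which
it approaches uniformly as `k` tends to infinity, while `s` decreases in `k` and is homogeneous of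
degree `-1`.  Summing `2 * arctan (k * s)` over some of the corners of a face gives the necessity of
the condition (`PolygonalDecomposition.sum_arcTurn_lt`).  Uniqueness of `k` is a maximum principle
at a vertex with the largest quotient of curvatures
(`PolygonalDecomposition.le_of_vertexCurvature_eq`).
Existence is Perron's method (`PolygonalDecomposition.exists_vertexCurvature_eq`): the positive `k`
whose total geodesic curvatures are at most `L` are closed under maxima, and their supremum is a
solution if it is finite.  If it were infinite exactly on `W`, the total geodesic curvatures
over `W` would come arbitrarily close to the bound in the condition
(`PolygonalDecomposition.le_sum_arcTurn`), contrary to the strict inequality.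
-/

/-! ### Generalized circles as level sets of cycle forms -/

/-- The function `z ↦ (a |z|² + b Re z + c) / Im z` on the upper half-plane.  In the hyperboloid
model it is the restriction of a linear form; its discriminant `b² - 4ac` is the Lorentz norm of
that form. -/
noncomputable def cycleForm (a b c : ℝ) (z : ℍ) : ℝ :=
  (a * (z.re ^ 2 + z.im ^ 2) + b * z.re + c) / z.im

lemma cycleForm_mul_im (a b c : ℝ) (z : ℍ) :
    cycleForm a b c z * z.im = a * (z.re ^ 2 + z.im ^ 2) + b * z.re + c := by
  rw [cycleForm, div_mul_cancel₀ _ z.im_pos.ne']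

lemma cycleForm_smul (t a b c : ℝ) (z : ℍ) :
    cycleForm (t * a) (t * b) (t * c) z = t * cycleForm a b c z := by
  unfold cycleForm; ring

lemma sl_smul_denom_pos (g : SL(2, ℝ)) (z : ℍ) :
    0 < (g 1 0 * z.re + g 1 1) ^ 2 + (g 1 0 * z.im) ^ 2 := by
  have hdet := Matrix.SpecialLinearGroup.det_coe g
  rw [Matrix.det_fin_two] at hdet
  by_cases h : g 1 0 = 0
  · have h1 : g 1 1 ≠ 0 := by
      intro h1; rw [h, h1] at hdet; simp at hdet
    simp only [h, zero_mul, zero_add]; positivity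
  · have h2 : 0 < (g 1 0 * z.im) ^ 2 := sq_pos_of_ne_zero (mul_ne_zero h z.im_pos.ne')
    positivity

lemma sl_smul_im (g : SL(2, ℝ)) (z : ℍ) :
    (g • z).im = z.im / ((g 1 0 * z.re + g 1 1) ^ 2 + (g 1 0 * z.im) ^ 2) := by
  have hdet := Matrix.SpecialLinearGroup.det_coe g
  rw [Matrix.det_fin_two] at hdet
  have hN := (sl_smul_denom_pos g z).ne'
  rw [← UpperHalfPlane.coe_im, UpperHalfPlane.coe_specialLinearGroup_apply]
  simp only [Complex.div_im, Complex.normSq_apply, Complex.add_im, Complex.mul_im,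
    Complex.add_re, Complex.mul_re, Complex.ofReal_re, Complex.ofReal_im, coe_re, coe_im,
    Algebra.algebraMap_self, RingHom.id_apply]
  have e : (g 1 0 * z.re - 0 * z.im + g 1 1) * (g 1 0 * z.re - 0 * z.im + g 1 1) +
    (g 1 0 * z.im + 0 * z.re + 0) * (g 1 0 * z.im + 0 * z.re + 0) =
      (g 1 0 * z.re + g 1 1) ^ 2 + (g 1 0 * z.im) ^ 2 := by ring
  rw [e, ← sub_div]
  congr 1
  linear_combination z.im * hdet

lemma sl_smul_re (g : SL(2, ℝ)) (z : ℍ) :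
    (g • z).re = ((g 0 0 * z.re + g 0 1) * (g 1 0 * z.re + g 1 1) + g 0 0 * g 1 0 * z.im ^ 2) /
      ((g 1 0 * z.re + g 1 1) ^ 2 + (g 1 0 * z.im) ^ 2) := by
  rw [← UpperHalfPlane.coe_re, UpperHalfPlane.coe_specialLinearGroup_apply]
  simp only [Complex.div_re, Complex.normSq_apply, Complex.add_im, Complex.mul_im,
    Complex.add_re, Complex.mul_re, Complex.ofReal_re, Complex.ofReal_im, coe_re, coe_im,
    Algebra.algebraMap_self, RingHom.id_apply]
  have e : (g 1 0 * z.re - 0 * z.im + g 1 1) * (g 1 0 * z.re - 0 * z.im + g 1 1) +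
    (g 1 0 * z.im + 0 * z.re + 0) * (g 1 0 * z.im + 0 * z.re + 0) =
      (g 1 0 * z.re + g 1 1) ^ 2 + (g 1 0 * z.im) ^ 2 := by ring
  rw [e, ← add_div]
  congr 1
  ring

lemma sl_smul_re_div_im (g : SL(2, ℝ)) (z : ℍ) :
    (g • z).re / (g • z).im =
      cycleForm (g 0 0 * g 1 0) (g 0 0 * g 1 1 + g 0 1 * g 1 0) (g 0 1 * g 1 1) z := by
  have hN := (sl_smul_denom_pos g z).ne'
  have hy := z.im_pos.ne'
  rw [sl_smul_im, sl_smul_re, cycleForm, div_div_div_cancel_right₀ hN]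
  congr 1; ring

lemma inv_sl_smul_im (g : SL(2, ℝ)) (z : ℍ) :
    ((g • z).im)⁻¹ = cycleForm (g 1 0 ^ 2) (2 * g 1 0 * g 1 1) (g 1 1 ^ 2) z := by
  rw [sl_smul_im, cycleForm, inv_div]
  congr 1; ring

lemma sl_disc (g : SL(2, ℝ)) :
    (g 0 0 * g 1 1 + g 0 1 * g 1 0) ^ 2 - 4 * (g 0 0 * g 1 0) * (g 0 1 * g 1 1) = 1 := by
  have hdet := Matrix.SpecialLinearGroup.det_coe g
  rw [Matrix.det_fin_two] at hdet
  linear_combination (g 0 0 * g 1 1 - g 0 1 * g 1 0 + 1) * hdet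

lemma halfPlane_eq (g : SL(2, ℝ)) : halfPlane g =
    {z | 0 ≤ cycleForm (g 0 0 * g 1 0) (g 0 0 * g 1 1 + g 0 1 * g 1 0) (g 0 1 * g 1 1) z} := by
  ext z
  simp only [halfPlane, Set.mem_ofPred_eq, ← sl_smul_re_div_im]
  rw [le_div_iff₀ (g • z).im_pos, zero_mul]

lemma geodesicLine_eq (g : SL(2, ℝ)) : geodesicLine g =
    {z | cycleForm (g 0 0 * g 1 0) (g 0 0 * g 1 1 + g 0 1 * g 1 0) (g 0 1 * g 1 1) z = 0} := by
  ext z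
  simp only [geodesicLine, Set.mem_ofPred_eq, ← sl_smul_re_div_im]
  simp [(g • z).im_pos.ne']

/-- Every indefinite binary quadratic form of discriminant one is a product of two linear forms
of determinant one, so every form of discriminant one cuts out a geodesic. -/
lemma exists_sl_of_disc_eq_one (a b c : ℝ) (h : b ^ 2 - 4 * a * c = 1) :
    ∃ g : SL(2, ℝ), g 0 0 * g 1 0 = a ∧ g 0 0 * g 1 1 + g 0 1 * g 1 0 = b ∧ g 0 1 * g 1 1 = c := by
  by_cases ha : a = 0
  · have hb : (b - 1) * (b + 1) = 0 := by rw [ha] at h; linear_combination h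
    rcases mul_eq_zero.1 hb with hb | hb
    · refine ⟨⟨!![1, c; 0, 1], by simp⟩, ?_, ?_, ?_⟩ <;> simp <;> linarith
    · refine ⟨⟨!![0, 1; -1, c], by simp⟩, ?_, ?_, ?_⟩ <;> simp <;> linarith
  · refine ⟨⟨!![1, (b - 1) / (2 * a); a, (b + 1) / 2], ?_⟩, ?_, ?_, ?_⟩
    · rw [Matrix.det_fin_two_of]; field_simp; ring
    · simp
    · simp; field_simp; ring
    · simp; field_simp; linear_combination h

lemma exists_sl_of_disc_eq_zero (a b c : ℝ) (h : b ^ 2 - 4 * a * c = 0) (hac : 0 < a + c) :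
    ∃ g : SL(2, ℝ), g 1 0 ^ 2 = a ∧ 2 * g 1 0 * g 1 1 = b ∧ g 1 1 ^ 2 = c := by
  have hac' : 0 ≤ a * c := by nlinarith [sq_nonneg b]
  by_cases ha : a = 0
  · have hb : b = 0 := by rw [ha] at h; simpa using h
    have hc : 0 < c := by simpa [ha] using hac
    have hs := (Real.sqrt_pos.2 hc).ne'
    refine ⟨⟨!![(√c)⁻¹, 0; 0, √c], ?_⟩, ?_, ?_, ?_⟩
    · rw [Matrix.det_fin_two_of]; field_simp; ring
    · simp [ha]
    · simp [hb]
    · simp [Real.sq_sqrt hc.le]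
  · have ha : 0 < a := by
      by_contra h'
      have : a < 0 := lt_of_le_of_ne (not_lt.1 h') ha
      nlinarith
    have hs := (Real.sqrt_pos.2 ha).ne'
    refine ⟨⟨!![0, -(√a)⁻¹; √a, b / (2 * √a)], ?_⟩, ?_, ?_, ?_⟩
    · rw [Matrix.det_fin_two_of]; field_simp; ring
    · simp [Real.sq_sqrt ha.le]
    · simp; field_simp
    · simp; rw [div_pow, mul_pow, Real.sq_sqrt ha.le]; field_simp; linear_combination h

lemma coe_dist_sq (z w : ℍ) : dist (z : ℂ) w ^ 2 = (z.re - w.re) ^ 2 + (z.im - w.im) ^ 2 := by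
  rw [Complex.dist_eq, ← Complex.normSq_eq_norm_sq, Complex.normSq_apply]
  simp; ring

lemma cosh_dist_eq_cycleForm (z w : ℍ) : Real.cosh (dist z w) =
    cycleForm (1 / (2 * w.im)) (-w.re / w.im) ((w.re ^ 2 + w.im ^ 2) / (2 * w.im)) z := by
  have := z.im_pos.ne'
  have := w.im_pos.ne'
  rw [UpperHalfPlane.cosh_dist, coe_dist_sq, cycleForm]
  field_simp; ring

/-- The distance from a geodesic, computed on the imaginary axis. -/
lemma sinh_infDist_geodesicLine (g : SL(2, ℝ)) (z : ℍ) :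
    Real.sinh (Metric.infDist z (geodesicLine g)) = |(g • z).re / (g • z).im| := by
  set Z := g • z with hZ
  have hy := Z.im_pos
  have hne : (geodesicLine g).Nonempty := by
    refine ⟨g⁻¹ • UpperHalfPlane.I, ?_⟩
    simp [geodesicLine]
  have key : Metric.infDist z (geodesicLine g) = Real.arsinh |Z.re / Z.im| := by
    apply le_antisymm
    · have hη : 0 < √(Z.re ^ 2 + Z.im ^ 2) := by positivity
      have hη2 : √(Z.re ^ 2 + Z.im ^ 2) ^ 2 = Z.re ^ 2 + Z.im ^ 2 := Real.sq_sqrt (by positivity)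
      set η := √(Z.re ^ 2 + Z.im ^ 2)
      let W : ℍ := ⟨⟨0, η⟩, hη⟩
      have hW : g⁻¹ • W ∈ geodesicLine g := by
        simp only [geodesicLine, Set.mem_ofPred_eq, smul_inv_smul]
        rfl
      refine (Metric.infDist_le_dist_of_mem hW).trans (le_of_eq ?_)
      have hd : dist z (g⁻¹ • W) = dist Z W := by
        rw [← dist_smul g z, smul_inv_smul]
      rw [hd]
      have hWre : W.re = 0 := rfl
      have hWim : W.im = η := rfl
      have h1 : Real.cosh (dist Z W) = η / Z.im := by
        rw [UpperHalfPlane.cosh_dist, coe_dist_sq, hWre, hWim]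
        field_simp
        linear_combination (-1 : ℝ) * hη2
      have h2 : Real.sinh (dist Z W) = |Z.re / Z.im| := by
        rw [← abs_of_nonneg (Real.sinh_nonneg_iff.2 (dist_nonneg (x := Z) (y := W))),
          ← sq_eq_sq_iff_abs_eq_abs]
        rw [Real.sinh_sq, h1]
        field_simp
        linear_combination hη2
      rw [← h2, Real.arsinh_sinh]
    · rw [Metric.le_infDist hne]
      intro w hw
      rw [← dist_smul g z w, ← Real.sinh_le_sinh, Real.sinh_arsinh]
      have hw0 : (g • w).re = 0 := hw
      have hη := (g • w).im_pos
      rw [← hZ]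
      apply abs_le_of_sq_le_sq _ (Real.sinh_nonneg_iff.2 dist_nonneg)
      rw [Real.sinh_sq, UpperHalfPlane.cosh_dist, coe_dist_sq, hw0]
      have e : (1 + ((Z.re - 0) ^ 2 + (Z.im - (g • w).im) ^ 2) / (2 * Z.im * (g • w).im)) =
          (Z.re ^ 2 + Z.im ^ 2 + (g • w).im ^ 2) / (2 * Z.im * (g • w).im) := by
        field_simp; ring
      rw [e, div_pow, div_pow, le_sub_iff_add_le, ← sub_nonneg]
      have e2 : (Z.re ^ 2 + Z.im ^ 2 + (g • w).im ^ 2) ^ 2 / (2 * Z.im * (g • w).im) ^ 2 -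
          (Z.re ^ 2 / Z.im ^ 2 + 1) =
          ((Z.re ^ 2 + Z.im ^ 2 - (g • w).im ^ 2) / (2 * Z.im * (g • w).im)) ^ 2 := by
        field_simp; ring
      rw [e2]; positivity
  rw [key, Real.sinh_arsinh]

/-- The cycle with coefficients `a`, `b`, `c` and geodesic curvature `k` describes the generalized
circle `C`.  For `k ≥ 1` the condition on `axisSide` says that the form is nonnegative, which
singles out the correct one of the two opposite forms. -/
structure IsCycle (C : GenCircle) (a b c : ℝ) : Prop where
  disc : b ^ 2 - 4 * a * c = 1 - C.curvature ^ 2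
  carrier : C.carrier = {z | cycleForm a b c z = C.curvature}
  disk : C.disk = {z | cycleForm a b c z ≤ C.curvature}
  axisSide : C.axisSide = {z | 0 ≤ cycleForm a b c z}

lemma tanh_pos {r : ℝ} (hr : 0 < r) : 0 < Real.tanh r := by
  rw [Real.tanh_eq_sinh_div_cosh]
  exact div_pos (Real.sinh_pos_iff.2 hr) (Real.cosh_pos r)

lemma GenCircle.curvature_pos (C : GenCircle) : 0 < C.curvature := by
  cases C with
  | circle w r hr => exact inv_pos.2 (tanh_pos hr)
  | horocycle g => exact one_pos
  | hypercycle g r hr => exact tanh_pos hr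

lemma isCycle_circle (w : ℍ) (r : ℝ) (hr : 0 < r) :
    IsCycle (.circle w r hr) ((Real.sinh r)⁻¹ * (1 / (2 * w.im)))
      ((Real.sinh r)⁻¹ * (-w.re / w.im))
      ((Real.sinh r)⁻¹ * ((w.re ^ 2 + w.im ^ 2) / (2 * w.im))) := by
  have hs := Real.sinh_pos_iff.2 hr
  have hw := w.im_pos.ne'
  have hk : GenCircle.curvature (.circle w r hr) = Real.cosh r / Real.sinh r := by
    rw [GenCircle.curvature, Real.tanh_eq_sinh_div_cosh, inv_div]
  refine ⟨?_, ?_, ?_, ?_⟩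
  · rw [hk, div_pow, Real.cosh_sq]
    field_simp; ring
  · ext z
    simp only [GenCircle.carrier, Metric.mem_sphere, Set.mem_ofPred_eq, cycleForm_smul,
      ← cosh_dist_eq_cycleForm, hk]
    rw [inv_mul_eq_div, div_left_inj' hs.ne']
    constructor
    · rintro rfl; rfl
    · exact fun h => Real.cosh_injOn (Set.mem_Ici.2 dist_nonneg) (Set.mem_Ici.2 hr.le) h
  · ext z
    simp only [GenCircle.disk, Metric.mem_closedBall, Set.mem_ofPred_eq, cycleForm_smul,
      ← cosh_dist_eq_cycleForm, hk]
    rw [inv_mul_eq_div, div_le_div_iff_of_pos_right hs, Real.cosh_le_cosh,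
      abs_of_nonneg dist_nonneg, abs_of_pos hr]
  · ext z
    simp only [GenCircle.axisSide, Set.mem_univ, Set.mem_ofPred_eq, cycleForm_smul,
      ← cosh_dist_eq_cycleForm, true_iff]
    have := Real.cosh_pos (dist z w)
    positivity

lemma isCycle_horocycle (g : SL(2, ℝ)) :
    IsCycle (.horocycle g) (g 1 0 ^ 2) (2 * g 1 0 * g 1 1) (g 1 1 ^ 2) := by
  refine ⟨?_, ?_, ?_, ?_⟩
  · simp only [GenCircle.curvature]; ring
  · ext z
    simp only [GenCircle.carrier, GenCircle.curvature, Set.mem_ofPred_eq, ← inv_sl_smul_im]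
    exact inv_eq_one.symm
  · ext z
    simp only [GenCircle.disk, GenCircle.curvature, Set.mem_ofPred_eq, ← inv_sl_smul_im]
    exact (inv_le_one₀ (g • z).im_pos).symm
  · ext z
    simp only [GenCircle.axisSide, Set.mem_univ, Set.mem_ofPred_eq, ← inv_sl_smul_im, true_iff]
    exact (inv_pos.2 (g • z).im_pos).le

lemma isCycle_hypercycle (g : SL(2, ℝ)) (r : ℝ) (hr : 0 < r) :
    IsCycle (.hypercycle g r hr) ((Real.cosh r)⁻¹ * (g 0 0 * g 1 0))
      ((Real.cosh r)⁻¹ * (g 0 0 * g 1 1 + g 0 1 * g 1 0))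
      ((Real.cosh r)⁻¹ * (g 0 1 * g 1 1)) := by
  have hc := Real.cosh_pos r
  have hk : GenCircle.curvature (.hypercycle g r hr) = Real.sinh r / Real.cosh r := by
    rw [GenCircle.curvature, Real.tanh_eq_sinh_div_cosh]
  have hH : ∀ z, z ∈ halfPlane g ↔ 0 ≤ (g • z).re / (g • z).im := by
    intro z
    rw [halfPlane_eq, sl_smul_re_div_im]; rfl
  refine ⟨?_, ?_, ?_, ?_⟩
  · have hd := sl_disc g
    have hc2 := Real.cosh_sq r
    rw [hk]
    field_simp
    linear_combination hd - hc2
  · ext z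
    simp only [GenCircle.carrier, Set.mem_ofPred_eq, cycleForm_smul, ← sl_smul_re_div_im, hk, hH]
    rw [inv_mul_eq_div, div_left_inj' hc.ne', ← Real.sinh_inj, sinh_infDist_geodesicLine]
    constructor
    · rintro ⟨h0, h⟩; rwa [abs_of_nonneg h0] at h
    · intro h
      have h0 : 0 ≤ (g • z).re / (g • z).im := h ▸ (Real.sinh_pos_iff.2 hr).le
      exact ⟨h0, by rwa [abs_of_nonneg h0]⟩
  · ext z
    simp only [GenCircle.disk, Set.mem_ofPred_eq, cycleForm_smul, ← sl_smul_re_div_im, hk, hH]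
    rw [inv_mul_eq_div, div_le_div_iff_of_pos_right hc,
      ← Real.sinh_le_sinh (x := Metric.infDist z (geodesicLine g)), sinh_infDist_geodesicLine]
    constructor
    · intro h
      rcases le_or_gt 0 ((g • z).re / (g • z).im) with h0 | h0
      · have := h h0; rwa [abs_of_nonneg h0] at this
      · exact h0.le.trans (Real.sinh_pos_iff.2 hr).le
    · intro h h0; rwa [abs_of_nonneg h0]
  · ext z
    simp only [GenCircle.axisSide, Set.mem_ofPred_eq, cycleForm_smul, ← sl_smul_re_div_im, hH]
    rw [inv_mul_eq_div, le_div_iff₀ hc, zero_mul]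

lemma GenCircle.exists_isCycle (C : GenCircle) : ∃ a b c, IsCycle C a b c := by
  cases C with
  | circle w r hr => exact ⟨_, _, _, isCycle_circle w r hr⟩
  | horocycle g => exact ⟨_, _, _, isCycle_horocycle g⟩
  | hypercycle g r hr => exact ⟨_, _, _, isCycle_hypercycle g r hr⟩

/-- Conversely, every normalized cycle comes from a generalized circle. -/
lemma exists_genCircle (a b c k : ℝ) (hk : 0 < k) (h : b ^ 2 - 4 * a * c = 1 - k ^ 2)
    (hpos : 1 ≤ k → 0 < a + c) : ∃ C : GenCircle, C.curvature = k ∧ IsCycle C a b c := by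
  rcases lt_trichotomy k 1 with h1 | h1 | h1
  · have hD : 0 < 1 - k ^ 2 := by nlinarith
    have hs2 : √(1 - k ^ 2) ^ 2 = 1 - k ^ 2 := Real.sq_sqrt hD.le
    have hs := Real.sqrt_pos.2 hD
    set t := √(1 - k ^ 2)
    obtain ⟨g, e1, e2, e3⟩ := exists_sl_of_disc_eq_one (t⁻¹ * a) (t⁻¹ * b) (t⁻¹ * c) (by
      field_simp; linear_combination h - hs2)
    set r := Real.arsinh (k / t) with hr
    have hr0 : 0 < r := Real.arsinh_pos_iff.2 (by positivity)
    have hsr : Real.sinh r = k / t := Real.sinh_arsinh _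
    have hcr : Real.cosh r = t⁻¹ := by
      have : Real.cosh r ^ 2 = t⁻¹ ^ 2 := by
        rw [Real.cosh_sq, hsr]; field_simp; linear_combination hs2
      exact (sq_eq_sq₀ (Real.cosh_pos r).le (inv_pos.2 hs).le).1 this
    refine ⟨.hypercycle g r hr0, ?_, ?_⟩
    · rw [GenCircle.curvature, Real.tanh_eq_sinh_div_cosh, hsr, hcr]; field_simp
    · have := isCycle_hypercycle g r hr0
      rw [e1, e2, e3, hcr, inv_inv, mul_inv_cancel_left₀ hs.ne', mul_inv_cancel_left₀ hs.ne',
        mul_inv_cancel_left₀ hs.ne'] at this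
      exact this
  · subst h1
    obtain ⟨g, e1, e2, e3⟩ := exists_sl_of_disc_eq_zero a b c (by linarith) (hpos le_rfl)
    refine ⟨.horocycle g, rfl, ?_⟩
    have := isCycle_horocycle g
    rwa [e1, e2, e3] at this
  · have hD : 0 < k ^ 2 - 1 := by nlinarith
    have hs2 : √(k ^ 2 - 1) ^ 2 = k ^ 2 - 1 := Real.sq_sqrt hD.le
    have hs := Real.sqrt_pos.2 hD
    set t := √(k ^ 2 - 1)
    have hac : 0 < a * c := by nlinarith [sq_nonneg b]
    have ha : 0 < a := by
      rcases pos_and_pos_or_neg_and_neg_of_mul_pos hac with h' | h'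
      · exact h'.1
      · have := hpos h1.le; linarith [h'.1, h'.2]
    have him : 0 < t / (2 * a) := by positivity
    let w : ℍ := ⟨⟨-b / (2 * a), t / (2 * a)⟩, him⟩
    have hre' : w.re = -b / (2 * a) := rfl
    have him' : w.im = t / (2 * a) := rfl
    set r := Real.arsinh t⁻¹ with hr
    have hr0 : 0 < r := Real.arsinh_pos_iff.2 (by positivity)
    have hsr : Real.sinh r = t⁻¹ := Real.sinh_arsinh _
    have hcr : Real.cosh r = k / t := by
      have : Real.cosh r ^ 2 = (k / t) ^ 2 := by
        rw [Real.cosh_sq, hsr]; field_simp; linear_combination hs2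
      exact (sq_eq_sq₀ (Real.cosh_pos r).le (by positivity)).1 this
    refine ⟨.circle w r hr0, ?_, ?_⟩
    · rw [GenCircle.curvature, Real.tanh_eq_sinh_div_cosh, hsr, hcr]; field_simp
    · have := isCycle_circle w r hr0
      rw [hsr, hre', him', inv_inv] at this
      convert this using 1
      · field_simp
      · field_simp
      · field_simp; linear_combination -hs2 - h

/-! ### Perpendicularity of cycles -/

lemma inner_complex (u v : ℂ) : inner ℝ u v = u.re * v.re + u.im * v.im := by
  rw [Complex.inner]; simp; ring

lemma norm_sq_complex (u : ℂ) : ‖u‖ ^ 2 = u.re ^ 2 + u.im ^ 2 := by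
  rw [← Complex.normSq_eq_norm_sq, Complex.normSq_apply]; ring

/-- The Euclidean gradient at `p` of `z ↦ a |z|² + b Re z + c - k Im z`. -/
noncomputable def cycleGrad (a b k : ℝ) (p : ℍ) : ℂ := ⟨2 * a * p.re + b, 2 * a * p.im - k⟩

/-- With the normalization `b² - 4ac = 1 - k²` the gradient is a Euclidean unit vector at all
points of the curve. -/
lemma cycleGrad_normSq {a b c k : ℝ} (h : b ^ 2 - 4 * a * c = 1 - k ^ 2) {p : ℍ}
    (hp : cycleForm a b c p = k) : (cycleGrad a b k p).re ^ 2 + (cycleGrad a b k p).im ^ 2 = 1 := by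
  have := cycleForm_mul_im a b c p
  rw [hp] at this
  simp only [cycleGrad]
  linear_combination h - 4 * a * this

lemma cycleGrad_inner {a b c k a' b' c' k' : ℝ} {p : ℍ} (hp : cycleForm a b c p = k)
    (hp' : cycleForm a' b' c' p = k') :
    (cycleGrad a b k p).re * (cycleGrad a' b' k' p).re +
      (cycleGrad a b k p).im * (cycleGrad a' b' k' p).im =
      b * b' + k * k' - 2 * a * c' - 2 * a' * c := by
  have h1 := cycleForm_mul_im a b c p
  have h2 := cycleForm_mul_im a' b' c' p
  rw [hp] at h1
  rw [hp'] at h2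
  simp only [cycleGrad]
  linear_combination -2 * a' * h1 - 2 * a * h2

lemma tangentCone_cycle_subset {a b c k : ℝ} {p : ℍ} (hp : cycleForm a b c p = k) {u : ℂ}
    (hu : u ∈ tangentConeAt ℝ ((fun z : ℍ => (z : ℂ)) '' {z | cycleForm a b c z = k}) (p : ℂ)) :
    u.re * (cycleGrad a b k p).re + u.im * (cycleGrad a b k p).im = 0 := by
  set s := (fun z : ℍ => (z : ℂ)) '' {z | cycleForm a b c z = k}
  let f : ℂ → ℝ := fun w => a * (w.re ^ 2 + w.im ^ 2) + b * w.re + c - k * w.im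
  have hre : HasFDerivAt (fun w : ℂ => w.re) Complex.reCLM (p : ℂ) := Complex.reCLM.hasFDerivAt
  have him : HasFDerivAt (fun w : ℂ => w.im) Complex.imCLM (p : ℂ) := Complex.imCLM.hasFDerivAt
  have hf := (((((hre.pow 2).add (him.pow 2)).const_mul a).add (hre.const_mul b)).add_const c).sub
    (him.const_mul k)
  have hm := hf.hasFDerivWithinAt (s := s) |>.mapsTo_tangent_cone hu
  have hsub : (f '' s) ⊆ {0} := by
    rintro _ ⟨_, ⟨z, hz, rfl⟩, rfl⟩
    have := cycleForm_mul_im a b c z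
    have hz' : cycleForm a b c z = k := hz
    rw [hz'] at this
    simp only [f, coe_re, coe_im, Set.mem_singleton_iff]
    linear_combination -this
  have h0 := tangentConeAt_subset_zero (fun h => by
    obtain ⟨y, ⟨_, hy⟩, hne⟩ := accPt_iff_nhds.1 h Set.univ Filter.univ_mem
    exact hne ((hsub hy).trans (hsub ⟨_, ⟨p, hp, rfl⟩, rfl⟩).symm)) hm
  simp only [Set.mem_zero] at h0
  simp only [cycleGrad]
  simp at h0
  linear_combination h0

lemma tangent_mem_tangentCone_cycle {a b c k : ℝ} (h : b ^ 2 - 4 * a * c = 1 - k ^ 2) {p : ℍ}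
    (hp : cycleForm a b c p = k) :
    (⟨-(cycleGrad a b k p).im, (cycleGrad a b k p).re⟩ : ℂ) ∈
      tangentConeAt ℝ ((fun z : ℍ => (z : ℂ)) '' {z | cycleForm a b c z = k}) (p : ℂ) := by
  have hn := cycleGrad_normSq h hp
  have hpk := cycleForm_mul_im a b c p
  rw [hp] at hpk
  have hnre : (cycleGrad a b k p).re = 2 * a * p.re + b := rfl
  have hnim : (cycleGrad a b k p).im = 2 * a * p.im - k := rfl
  set n := cycleGrad a b k p
  -- rational parametrization of the curve near `p`
  let q : ℝ → ℝ := fun t => (1 + a ^ 2 * t ^ 2)⁻¹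
  let e : ℝ → ℂ := fun t => q t • (⟨-n.im - a * t * n.re, n.re - a * t * n.im⟩ : ℂ)
  have hq : ∀ t, q t * (1 + a ^ 2 * t ^ 2) = 1 := fun t =>
    inv_mul_cancel₀ (by positivity)
  have hqc : Continuous q := by
    apply Continuous.inv₀ (by fun_prop)
    intro t; positivity
  have he : Continuous e := by
    have e1 : e = fun t => q t • ((-n.im - a * t * n.re : ℝ) +
        (n.re - a * t * n.im : ℝ) * Complex.I) := by
      funext t
      simp only [e]
      congr 1
      apply Complex.ext <;> simp
    rw [e1]
    fun_prop
  have he0 : e 0 = ⟨-n.im, n.re⟩ := by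
    simp [e, q]
  have hte : Continuous fun t : ℝ => t • e t := continuous_id.smul he
  refine mem_tangentConeAt_of_seq (nhdsWithin (0 : ℝ) {0}ᶜ) (fun t => t⁻¹) (fun t => t • e t)
    ?_ ?_ ?_
  · have := hte.tendsto 0
    rw [zero_smul] at this
    exact this.mono_left nhdsWithin_le_nhds
  · have h1 : Filter.Tendsto (fun t : ℝ => ((p : ℂ) + t • e t).im) (nhds 0) (nhds p.im) := by
      have : Continuous fun t : ℝ => ((p : ℂ) + t • e t).im :=
        Complex.continuous_im.comp (continuous_const.add hte)
      have := this.tendsto 0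
      simpa using this
    have h2 := (h1.eventually (lt_mem_nhds p.im_pos)).filter_mono
      (nhdsWithin_le_nhds (s := {0}ᶜ))
    filter_upwards [h2] with t ht
    refine ⟨⟨(p : ℂ) + t • e t, ht⟩, ?_, rfl⟩
    simp only [Set.mem_ofPred_eq]
    rw [cycleForm, div_eq_iff (UpperHalfPlane.im_pos _).ne']
    have hre : (UpperHalfPlane.mk ((p : ℂ) + t • e t) ht).re =
        p.re + t * (q t * (-n.im - a * t * n.re)) := by
      simp [e]
    have him : (UpperHalfPlane.mk ((p : ℂ) + t • e t) ht).im =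
        p.im + t * (q t * (n.re - a * t * n.im)) := by
      simp [e]
    rw [hre, him]
    have hQ := hq t
    set Q := q t
    rw [hnre, hnim] at hn ⊢
    linear_combination -hpk + (a * t ^ 2 * Q ^ 2 * (1 + a ^ 2 * t ^ 2) - a * t ^ 2 * Q) * hn +
      a * t ^ 2 * Q * hQ
  · have : Filter.Tendsto e (nhdsWithin (0 : ℝ) {0}ᶜ) (nhds (e 0)) :=
      (he.tendsto 0).mono_left nhdsWithin_le_nhds
    rw [he0] at this
    refine this.congr' ?_
    filter_upwards [self_mem_nhdsWithin] with t ht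
    have ht' : t ≠ 0 := ht
    exact (inv_smul_smul₀ ht' (e t)).symm

/-- Two normalized cycles are perpendicular at a common point if and only if they are orthogonal
for the Lorentz form. -/
lemma perpAt_cycle_iff {a b c k a' b' c' k' : ℝ} (h : b ^ 2 - 4 * a * c = 1 - k ^ 2)
    (h' : b' ^ 2 - 4 * a' * c' = 1 - k' ^ 2) (p : ℍ) :
    PerpAt {z | cycleForm a b c z = k} {z | cycleForm a' b' c' z = k'} p ↔
      cycleForm a b c p = k ∧ cycleForm a' b' c' p = k' ∧
        b * b' + k * k' - 2 * a * c' - 2 * a' * c = 0 := by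
  constructor
  · rintro ⟨h1, h2, h3⟩
    refine ⟨h1, h2, ?_⟩
    have := h3 _ (tangent_mem_tangentCone_cycle h h1) _ (tangent_mem_tangentCone_cycle h' h2)
    rw [inner_complex] at this
    rw [← cycleGrad_inner h1 h2]
    simp only at this
    linear_combination this
  · rintro ⟨h1, h2, h3⟩
    refine ⟨h1, h2, ?_⟩
    intro u hu v hv
    have e1 := tangentCone_cycle_subset h1 hu
    have e2 := tangentCone_cycle_subset h2 hv
    have n1 := cycleGrad_normSq h h1
    have n2 := cycleGrad_normSq h' h2
    rw [← cycleGrad_inner h1 h2] at h3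
    rw [inner_complex]
    generalize cycleGrad a b k p = n at *
    generalize cycleGrad a' b' k' p = m at *
    -- both vectors are multiples of the quarter turns of the two gradients
    obtain ⟨r, hu1, hu2⟩ : ∃ r, u.re = -r * n.im ∧ u.im = r * n.re :=
      ⟨u.im * n.re - u.re * n.im, by linear_combination -u.re * n1 + n.re * e1,
        by linear_combination -u.im * n1 + n.im * e1⟩
    obtain ⟨t, hv1, hv2⟩ : ∃ t, v.re = -t * m.im ∧ v.im = t * m.re :=
      ⟨v.im * m.re - v.re * m.im, by linear_combination -v.re * n2 + m.re * e2,
        by linear_combination -v.im * n2 + m.im * e2⟩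
    rw [hu1, hu2, hv1, hv2]
    linear_combination r * t * h3

/-! ### Hyperboloid coordinates -/

/-- The spatial part of the hyperboloid coordinates of `z` when `w` is taken as the apex. -/
noncomputable def hypCoord (w z : ℍ) : ℂ :=
  ⟨((z.re - w.re) ^ 2 + z.im ^ 2 - w.im ^ 2) / (2 * w.im * z.im), (z.re - w.re) / z.im⟩

lemma cosh_dist_eq (z w : ℍ) : Real.cosh (dist z w) =
    ((z.re - w.re) ^ 2 + z.im ^ 2 + w.im ^ 2) / (2 * w.im * z.im) := by
  have := z.im_pos.ne'
  have := w.im_pos.ne'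
  rw [UpperHalfPlane.cosh_dist, coe_dist_sq]
  field_simp; ring

lemma cosh_dist_sq_eq (w z : ℍ) : Real.cosh (dist z w) ^ 2 = 1 + ‖hypCoord w z‖ ^ 2 := by
  have := z.im_pos.ne'
  have := w.im_pos.ne'
  rw [cosh_dist_eq, norm_sq_complex, hypCoord]
  field_simp; ring

lemma sqrt_one_add_hypCoord (w z : ℍ) : √(1 + ‖hypCoord w z‖ ^ 2) = Real.cosh (dist z w) := by
  rw [← cosh_dist_sq_eq, Real.sqrt_sq (Real.cosh_pos _).le]

lemma sqrt_one_add_sub_re_pos (ξ : ℂ) : 0 < √(1 + ‖ξ‖ ^ 2) - ξ.re := by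
  have h1 : ξ.re ≤ ‖ξ‖ := Complex.re_le_norm ξ
  have h2 : ‖ξ‖ < √(1 + ‖ξ‖ ^ 2) := Real.lt_sqrt_of_sq_lt (by linarith)
  linarith

/-- The hyperboloid coordinates with apex `w` identify the hyperbolic plane with `ℂ`. -/
noncomputable def hypCoordEquiv (w : ℍ) : ℍ ≃ ℂ where
  toFun := hypCoord w
  invFun ξ := ⟨⟨w.re + w.im * ξ.im / (√(1 + ‖ξ‖ ^ 2) - ξ.re), w.im / (√(1 + ‖ξ‖ ^ 2) - ξ.re)⟩,
    div_pos w.im_pos (sqrt_one_add_sub_re_pos ξ)⟩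
  left_inv z := by
    have hz := z.im_pos.ne'
    have hw := w.im_pos.ne'
    have e : √(1 + ‖hypCoord w z‖ ^ 2) - (hypCoord w z).re = w.im / z.im := by
      rw [sqrt_one_add_hypCoord, cosh_dist_eq, hypCoord]
      field_simp; ring
    apply UpperHalfPlane.ext_re_im
    · change w.re + w.im * (hypCoord w z).im / (√(1 + ‖hypCoord w z‖ ^ 2) - (hypCoord w z).re) =
        z.re
      rw [e, hypCoord]
      field_simp; ring
    · change w.im / (√(1 + ‖hypCoord w z‖ ^ 2) - (hypCoord w z).re) = z.im
      rw [e]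
      field_simp
  right_inv ξ := by
    have hw := w.im_pos.ne'
    have hD := (sqrt_one_add_sub_re_pos ξ).ne'
    have hs : √(1 + ‖ξ‖ ^ 2) ^ 2 = 1 + ξ.re ^ 2 + ξ.im ^ 2 := by
      rw [Real.sq_sqrt (by positivity), norm_sq_complex]; ring
    rw [hypCoord]
    simp only [UpperHalfPlane.mk_re, UpperHalfPlane.mk_im]
    set D := √(1 + ‖ξ‖ ^ 2) - ξ.re with hDdef
    have hs' : (D + ξ.re) ^ 2 = 1 + ξ.re ^ 2 + ξ.im ^ 2 := by rw [← hs, hDdef]; ring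
    apply Complex.ext
    · simp only
      field_simp
      linear_combination (-w.im ^ 2) * hs'
    · simp only
      field_simp; ring

/-- An orthonormal frame of the hyperbolic plane: an apex, and an isometry of `ℂ` by which the
spatial hyperboloid coordinates are turned (and possibly reflected). -/
structure HypFrame where
  center : ℍ
  iso : ℂ ≃ₗᵢ[ℝ] ℂ

namespace HypFrame

variable (F : HypFrame)

/-- The spatial hyperboloid coordinates with respect to a frame. -/
noncomputable def pos : ℍ ≃ ℂ := (hypCoordEquiv F.center).trans F.iso.toEquiv

/-- The time coordinate in the hyperboloid model with respect to a frame. -/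
noncomputable def time (z : ℍ) : ℝ := Real.cosh (dist z F.center)

lemma pos_apply (z : ℍ) : F.pos z = F.iso (hypCoord F.center z) := rfl

lemma time_sq (z : ℍ) : F.time z ^ 2 = 1 + ‖F.pos z‖ ^ 2 := by
  rw [pos_apply, LinearIsometryEquiv.norm_map, time, cosh_dist_sq_eq]

lemma time_pos (z : ℍ) : 0 < F.time z := Real.cosh_pos _

lemma time_eq_sqrt (z : ℍ) : F.time z = √(1 + ‖F.pos z‖ ^ 2) := by
  rw [← time_sq, Real.sqrt_sq (F.time_pos z).le]

lemma norm_pos_lt_time (z : ℍ) : ‖F.pos z‖ < F.time z := by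
  rw [time_eq_sqrt]
  exact Real.lt_sqrt_of_sq_lt (by linarith)

lemma time_center : F.time F.center = 1 := by simp [time]

lemma pos_center : F.pos F.center = 0 := by
  have h := F.time_sq F.center
  rw [time_center] at h
  have : ‖F.pos F.center‖ ^ 2 = 0 := by linarith
  simpa using this

lemma cosh_dist (z w : ℍ) :
    Real.cosh (dist z w) = F.time z * F.time w - inner ℝ (F.pos z) (F.pos w) := by
  have := z.im_pos.ne'
  have := w.im_pos.ne'
  have := F.center.im_pos.ne'
  rw [pos_apply, pos_apply, LinearIsometryEquiv.inner_map_map, inner_complex, time, time,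
    cosh_dist_eq, cosh_dist_eq, cosh_dist_eq, hypCoord, hypCoord]
  field_simp; ring

/-- The linear form with coefficients `α` (time) and `β` (space) on the hyperboloid. -/
noncomputable def form (α : ℝ) (β : ℂ) (z : ℍ) : ℝ := α * F.time z - inner ℝ β (F.pos z)

/-- The quadratic coefficient of the cycle form given by a linear form on the hyperboloid. -/
noncomputable def coeffA (α : ℝ) (β : ℂ) : ℝ := (α - (F.iso.symm β).re) / 2 / F.center.im

/-- The linear coefficient of the cycle form given by a linear form on the hyperboloid. -/
noncomputable def coeffB (α : ℝ) (β : ℂ) : ℝ :=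
  -(F.iso.symm β).im - 2 * ((α - (F.iso.symm β).re) / 2) * F.center.re / F.center.im

/-- The constant coefficient of the cycle form given by a linear form on the hyperboloid. -/
noncomputable def coeffC (α : ℝ) (β : ℂ) : ℝ :=
  F.center.im * ((α + (F.iso.symm β).re) / 2) +
    (α - (F.iso.symm β).re) / 2 * F.center.re ^ 2 / F.center.im + (F.iso.symm β).im * F.center.re

lemma form_eq_cycleForm (α : ℝ) (β : ℂ) (z : ℍ) :
    F.form α β z = cycleForm (F.coeffA α β) (F.coeffB α β) (F.coeffC α β) z := by
  have := z.im_pos.ne'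
  have := F.center.im_pos.ne'
  obtain ⟨γ, rfl⟩ := F.iso.surjective β
  rw [form, pos_apply, LinearIsometryEquiv.inner_map_map, inner_complex, time, cosh_dist_eq,
    hypCoord, cycleForm, coeffA, coeffB, coeffC, LinearIsometryEquiv.symm_apply_apply]
  field_simp; ring

lemma coeff_product (α α' : ℝ) (β β' : ℂ) :
    F.coeffB α β * F.coeffB α' β' - 2 * F.coeffA α β * F.coeffC α' β'
      - 2 * F.coeffA α' β' * F.coeffC α β = inner ℝ β β' - α * α' := by
  have := F.center.im_pos.ne'
  obtain ⟨γ, rfl⟩ := F.iso.surjective β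
  obtain ⟨γ', rfl⟩ := F.iso.surjective β'
  rw [LinearIsometryEquiv.inner_map_map, inner_complex]
  simp only [coeffA, coeffB, coeffC, LinearIsometryEquiv.symm_apply_apply]
  field_simp; ring

lemma coeff_disc (α : ℝ) (β : ℂ) :
    F.coeffB α β ^ 2 - 4 * F.coeffA α β * F.coeffC α β = ‖β‖ ^ 2 - α ^ 2 := by
  have := F.coeff_product α α β β
  rw [real_inner_self_eq_norm_sq] at this
  linear_combination this

lemma exists_coeff (a b c : ℝ) :
    ∃ α β, F.coeffA α β = a ∧ F.coeffB α β = b ∧ F.coeffC α β = c := by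
  have := F.center.im_pos.ne'
  set u := F.center.re
  set v := F.center.im
  refine ⟨a * v + (a * u ^ 2 + b * u + c) / v,
    F.iso ⟨(a * u ^ 2 + b * u + c) / v - a * v, -(2 * a * u + b)⟩, ?_, ?_, ?_⟩
  · rw [coeffA, LinearIsometryEquiv.symm_apply_apply]; field_simp; ring
  · rw [coeffB, LinearIsometryEquiv.symm_apply_apply]; field_simp; ring
  · rw [coeffC, LinearIsometryEquiv.symm_apply_apply]; field_simp; ring

lemma perpAt_form_iff {α α' k k' : ℝ} {β β' : ℂ} (h : ‖β‖ ^ 2 - α ^ 2 = 1 - k ^ 2)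
    (h' : ‖β'‖ ^ 2 - α' ^ 2 = 1 - k' ^ 2) (p : ℍ) :
    PerpAt {z | F.form α β z = k} {z | F.form α' β' z = k'} p ↔
      F.form α β p = k ∧ F.form α' β' p = k' ∧ k * k' - α * α' + inner ℝ β β' = 0 := by
  simp only [form_eq_cycleForm]
  rw [perpAt_cycle_iff (by rw [coeff_disc, h]) (by rw [coeff_disc, h'])]
  have := F.coeff_product α α' β β'
  have e : F.coeffB α β * F.coeffB α' β' + k * k' - 2 * F.coeffA α β * F.coeffC α' β'
      - 2 * F.coeffA α' β' * F.coeffC α β = k * k' - α * α' + inner ℝ β β' := by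
    linear_combination this
  rw [e]

/-- The linear form with coefficients `α` and `β` describes the generalized circle `C`. -/
structure Describes (C : GenCircle) (α : ℝ) (β : ℂ) : Prop where
  disc : ‖β‖ ^ 2 - α ^ 2 = 1 - C.curvature ^ 2
  carrier : C.carrier = {z | F.form α β z = C.curvature}
  disk : C.disk = {z | F.form α β z ≤ C.curvature}
  axisSide : C.axisSide = {z | 0 ≤ F.form α β z}

lemma exists_describes (C : GenCircle) : ∃ α β, F.Describes C α β := by
  obtain ⟨a, b, c, h⟩ := C.exists_isCycle
  obtain ⟨α, β, rfl, rfl, rfl⟩ := F.exists_coeff a b c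
  refine ⟨α, β, ?_, ?_, ?_, ?_⟩
  · rw [← coeff_disc, h.disc]
  · simp only [form_eq_cycleForm]; exact h.carrier
  · simp only [form_eq_cycleForm]; exact h.disk
  · simp only [form_eq_cycleForm]; exact h.axisSide

lemma exists_genCircle {α k : ℝ} {β : ℂ} (hk : 0 < k) (h : ‖β‖ ^ 2 - α ^ 2 = 1 - k ^ 2)
    (hα : 0 < α) : ∃ C : GenCircle, C.curvature = k ∧ F.Describes C α β := by
  obtain ⟨C, hC, hd⟩ := _root_.exists_genCircle (F.coeffA α β) (F.coeffB α β) (F.coeffC α β) k hk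
    (by rw [coeff_disc, h]) (by
      intro h1
      have hβ : ‖β‖ ≤ α := abs_le_of_sq_le_sq' (by nlinarith) hα.le |>.2
      have e : F.coeffA α β + F.coeffC α β = F.form α β UpperHalfPlane.I := by
        rw [form_eq_cycleForm, cycleForm]; simp
      rw [e, form]
      have h2 := real_inner_le_norm β (F.pos UpperHalfPlane.I)
      have h3 := F.norm_pos_lt_time UpperHalfPlane.I
      have h4 := norm_nonneg (F.pos UpperHalfPlane.I)
      nlinarith)
  refine ⟨C, hC, ?_, ?_, ?_, ?_⟩
  · rw [← coeff_disc, hd.disc]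
  · simp only [form_eq_cycleForm]; exact hd.carrier
  · simp only [form_eq_cycleForm]; exact hd.disk
  · simp only [form_eq_cycleForm]; exact hd.axisSide

lemma exists_form_geodesicLine (g : SL(2, ℝ)) : ∃ α β, ‖β‖ ^ 2 - α ^ 2 = 1 ∧
    geodesicLine g = {z | F.form α β z = 0} ∧ halfPlane g = {z | 0 ≤ F.form α β z} := by
  obtain ⟨α, β, h1, h2, h3⟩ := F.exists_coeff (g 0 0 * g 1 0) (g 0 0 * g 1 1 + g 0 1 * g 1 0)
    (g 0 1 * g 1 1)
  refine ⟨α, β, ?_, ?_, ?_⟩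
  · rw [← coeff_disc, h1, h2, h3, sl_disc]
  · simp only [form_eq_cycleForm, h1, h2, h3]; exact geodesicLine_eq g
  · simp only [form_eq_cycleForm, h1, h2, h3]; exact halfPlane_eq g

lemma exists_geodesicLine {α : ℝ} {β : ℂ} (h : ‖β‖ ^ 2 - α ^ 2 = 1) : ∃ g : SL(2, ℝ),
    geodesicLine g = {z | F.form α β z = 0} ∧ halfPlane g = {z | 0 ≤ F.form α β z} := by
  obtain ⟨g, h1, h2, h3⟩ := exists_sl_of_disc_eq_one (F.coeffA α β) (F.coeffB α β) (F.coeffC α β)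
    (by rw [coeff_disc, h])
  refine ⟨g, ?_, ?_⟩
  · simp only [form_eq_cycleForm, ← h1, ← h2, ← h3]; exact geodesicLine_eq g
  · simp only [form_eq_cycleForm, ← h1, ← h2, ← h3]; exact halfPlane_eq g

lemma sphere_eq {r : ℝ} (hr : 0 < r) : Metric.sphere F.center r =
    {z | F.form (Real.sinh r)⁻¹ 0 z = Real.cosh r / Real.sinh r} := by
  have hs := Real.sinh_pos_iff.2 hr
  ext z
  simp only [Metric.mem_sphere, Set.mem_ofPred_eq, form, inner_zero_left, sub_zero]
  rw [inv_mul_eq_div, div_left_inj' hs.ne', time]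
  constructor
  · rintro rfl; rfl
  · exact fun h => Real.cosh_injOn (Set.mem_Ici.2 dist_nonneg) (Set.mem_Ici.2 hr.le) h

lemma sphere_disc {r : ℝ} (hr : 0 < r) :
    ‖(0 : ℂ)‖ ^ 2 - (Real.sinh r)⁻¹ ^ 2 = 1 - (Real.cosh r / Real.sinh r) ^ 2 := by
  have hs := (Real.sinh_pos_iff.2 hr).ne'
  have := Real.cosh_sq r
  rw [norm_zero]
  field_simp
  linear_combination this

/-- The isometry of the hyperbolic plane that carries one frame to another. -/
noncomputable def map (F F' : HypFrame) : ℍ ≃ ℍ := F.pos.trans F'.pos.symm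

lemma pos_map (F F' : HypFrame) (z : ℍ) : F'.pos (F.map F' z) = F.pos z := by
  simp [map]

lemma time_map (F F' : HypFrame) (z : ℍ) : F'.time (F.map F' z) = F.time z := by
  rw [time_eq_sqrt, pos_map, ← time_eq_sqrt]

lemma form_map (F F' : HypFrame) (α : ℝ) (β : ℂ) (z : ℍ) :
    F'.form α β (F.map F' z) = F.form α β z := by
  rw [form, time_map, pos_map, form]

lemma dist_map (F F' : HypFrame) (z w : ℍ) : dist (F.map F' z) (F.map F' w) = dist z w := by
  apply Real.cosh_injOn (Set.mem_Ici.2 dist_nonneg) (Set.mem_Ici.2 dist_nonneg)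
  rw [F'.cosh_dist, time_map, time_map, pos_map, pos_map, ← F.cosh_dist]

end HypFrame

/-! ### Standard position of a polygon packing -/

namespace HypFrame

/-- Compose a frame with an isometry of the spatial coordinate plane. -/
noncomputable def turn (F : HypFrame) (τ : ℂ ≃ₗᵢ[ℝ] ℂ) : HypFrame := ⟨F.center, F.iso.trans τ⟩

lemma pos_turn (F : HypFrame) (τ : ℂ ≃ₗᵢ[ℝ] ℂ) (z : ℍ) : (F.turn τ).pos z = τ (F.pos z) := rfl

lemma form_turn (F : HypFrame) (τ : ℂ ≃ₗᵢ[ℝ] ℂ) (α : ℝ) (β : ℂ) (z : ℍ) :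
    (F.turn τ).form α (τ β) z = F.form α β z := by
  rw [form, form, pos_turn, LinearIsometryEquiv.inner_map_map]; rfl

lemma Describes.turn {F : HypFrame} {C : GenCircle} {α : ℝ} {β : ℂ} (h : F.Describes C α β)
    (τ : ℂ ≃ₗᵢ[ℝ] ℂ) : (F.turn τ).Describes C α (τ β) := by
  refine ⟨?_, ?_, ?_, ?_⟩
  · rw [LinearIsometryEquiv.norm_map]; exact h.disc
  · simp only [form_turn]; exact h.carrier
  · simp only [form_turn]; exact h.disk
  · simp only [form_turn]; exact h.axisSide

/-- A cycle perpendicular to the circle of radius `r` about the apex at the point in the direction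
`p` has `α = k cosh r`, and there are two such cycles of curvature `k`, one for each side of the
ray through `p`. -/
lemma Describes.of_perpAt {F : HypFrame} {C : GenCircle} {α : ℝ} {β : ℂ} (h : F.Describes C α β)
    {r : ℝ} (hr : 0 < r) {t : ℍ} (hp : PerpAt (Metric.sphere F.center r) C.carrier t) :
    ∃ p : ℂ, ‖p‖ = 1 ∧ F.pos t = Real.sinh r * p ∧ α = C.curvature * Real.cosh r ∧
      ∃ ε : ℝ, ε ^ 2 = 1 ∧ β = p * (C.curvature * Real.sinh r + ε * Complex.I) := by
  have hs := Real.sinh_pos_iff.2 hr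
  have hch := Real.cosh_pos r
  have hcs := Real.cosh_sq r
  rw [F.sphere_eq hr, h.carrier, F.perpAt_form_iff (HypFrame.sphere_disc hr) h.disc] at hp
  obtain ⟨h1, h2, h3⟩ := hp
  set k := C.curvature
  rw [form, inner_zero_left, sub_zero, inv_mul_eq_div, div_left_inj' hs.ne'] at h1
  rw [inner_zero_left, add_zero] at h3
  have hα : α = k * Real.cosh r := by
    field_simp at h3
    linear_combination -h3
  have htime := F.time_sq t
  rw [h1, Real.cosh_sq] at htime
  have hnorm : ‖F.pos t‖ = Real.sinh r :=
    (sq_eq_sq₀ (norm_nonneg _) hs.le).1 (by linarith)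
  obtain ⟨p, hpdef⟩ : ∃ p : ℂ, F.pos t = Real.sinh r * p :=
    ⟨F.pos t / Real.sinh r, by
      rw [mul_div_cancel₀]; exact_mod_cast hs.ne'⟩
  have hpn : ‖p‖ = 1 := by
    rw [hpdef, norm_mul, Complex.norm_real, Real.norm_of_nonneg hs.le] at hnorm
    exact mul_left_cancel₀ hs.ne' (by rw [hnorm, mul_one])
  refine ⟨p, hpn, hpdef, hα, ?_⟩
  have hpn2 : p.re ^ 2 + p.im ^ 2 = 1 := by rw [← norm_sq_complex, hpn]; norm_num
  rw [form, h1, hpdef, inner_complex] at h2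
  simp only [Complex.mul_re, Complex.ofReal_re, Complex.ofReal_im, Complex.mul_im] at h2
  have hin : β.re * p.re + β.im * p.im = k * Real.sinh r := by
    apply mul_left_cancel₀ hs.ne'
    rw [hα] at h2
    linear_combination k * hcs - h2
  have hd := h.disc
  rw [norm_sq_complex, hα] at hd
  refine ⟨β.im * p.re - β.re * p.im, ?_, ?_⟩
  · have : (β.im * p.re - β.re * p.im) ^ 2 =
        (β.re ^ 2 + β.im ^ 2) * (p.re ^ 2 + p.im ^ 2) - (β.re * p.re + β.im * p.im) ^ 2 := by ring
    rw [this, hin, hpn2]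
    linear_combination hd + k ^ 2 * hcs
  · apply Complex.ext
    · simp [-Complex.ofReal_sinh]
      linear_combination -β.re * hpn2 + p.re * hin
    · simp [-Complex.ofReal_sinh]
      linear_combination -β.im * hpn2 + p.im * hin

/-- In the disk of a cycle perpendicular to the dual circle, every point has a direction that lies
in the sector cut out by the dual circle; at the boundary of the sector, it is a point of
the dual circle. -/
lemma sector_of_form_le {F : HypFrame} {k s : ℝ} (hk : 0 < k) {β : ℂ} {z : ℍ}
    (h : F.form (k * √(1 + s ^ 2)) β z ≤ k) :
    k * (s * ‖F.pos z‖) ≤ inner ℝ β (F.pos z) ∧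
      (inner ℝ β (F.pos z) ≤ k * (s * ‖F.pos z‖) → ‖F.pos z‖ = s) := by
  have hC2 : √(1 + s ^ 2) ^ 2 = 1 + s ^ 2 := Real.sq_sqrt (by positivity)
  have hC := Real.sqrt_pos.2 (show 0 < 1 + s ^ 2 by positivity)
  set C := √(1 + s ^ 2)
  have hT := F.time_pos z
  have hT2 := F.time_sq z
  rw [form] at h
  have key : 1 + s * ‖F.pos z‖ ≤ C * F.time z := by
    have h0 : 0 ≤ C * F.time z := by positivity
    apply le_of_sq_le_sq _ h0
    rw [mul_pow, hC2, hT2]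
    nlinarith [sq_nonneg (s - ‖F.pos z‖)]
  constructor
  · nlinarith
  · intro h2
    have h3 : C * F.time z = 1 + s * ‖F.pos z‖ := by nlinarith
    have h4 : (C * F.time z) ^ 2 = (1 + s * ‖F.pos z‖) ^ 2 := by rw [h3]
    rw [mul_pow, hC2, hT2] at h4
    nlinarith [sq_nonneg (s - ‖F.pos z‖)]

lemma form_dual_point {F : HypFrame} {k s : ℝ} {β e : ℂ} (he : ‖e‖ = 1) {z : ℍ}
    (hz : F.pos z = s * e) : F.form (k * √(1 + s ^ 2)) β z = k * (1 + s ^ 2) - s * inner ℝ β e := by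
  have : F.time z = √(1 + s ^ 2) := by
    rw [time_eq_sqrt, hz, norm_mul, he, mul_one, Complex.norm_real, Real.norm_eq_abs, sq_abs]
  rw [form, this, mul_assoc, Real.mul_self_sqrt (by positivity), hz, inner_complex, inner_complex]
  simp; ring

end HypFrame

/-- Two cycles that touch the ray through `p` at the same point of the dual circle, and whose disks
have no other common point, lie on different sides of the ray. -/
lemma HypFrame.opposite_sides {F : HypFrame} {C C' : GenCircle} {s ε ε' : ℝ} {p : ℂ} (hs : 0 < s)
    (hp : ‖p‖ = 1) (hε : ε ^ 2 = 1) (hε' : ε' ^ 2 = 1)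
    (h : F.Describes C (C.curvature * √(1 + s ^ 2)) (p * (C.curvature * s + ε * Complex.I)))
    (h' : F.Describes C' (C'.curvature * √(1 + s ^ 2)) (p * (C'.curvature * s + ε' * Complex.I)))
    {t : ℍ} (ht : F.pos t = s * p) (hd : C.disk ∩ C'.disk = {t}) : ε' = -ε := by
  by_contra hne
  have heq : ε' = ε := by
    have : (ε' + ε) * (ε' - ε) = 0 := by linear_combination hε' - hε
    rcases mul_eq_zero.1 this with h1 | h1
    · exact absurd (by linarith) hne
    · linarith
  subst heq
  have hk := C.curvature_pos
  have hk' := C'.curvature_pos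
  set k := C.curvature
  set k' := C'.curvature
  -- a direction close to `p`, on the common side
  obtain ⟨τ, hτ, hτk, hτk'⟩ : ∃ τ : ℝ, 0 < τ ∧ k * s * τ ≤ 1 ∧ k' * s * τ ≤ 1 := by
    refine ⟨((k + k') * s)⁻¹, by positivity, ?_, ?_⟩
    · rw [← div_eq_mul_inv, div_le_one (by positivity)]; nlinarith
    · rw [← div_eq_mul_inv, div_le_one (by positivity)]; nlinarith
  have hp2 : p.re ^ 2 + p.im ^ 2 = 1 := by rw [← norm_sq_complex, hp]; norm_num
  let f : ℂ := ⟨(1 - τ ^ 2) / (1 + τ ^ 2), 2 * ε' * τ / (1 + τ ^ 2)⟩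
  have hf : ‖f‖ = 1 := by
    have : ‖f‖ ^ 2 = 1 := by
      rw [norm_sq_complex]
      simp only [f]
      field_simp
      linear_combination 4 * τ ^ 2 * hε
    exact (pow_eq_one_iff_of_nonneg (norm_nonneg _) two_ne_zero).1 this
  have he : ‖p * f‖ = 1 := by rw [norm_mul, hp, hf, one_mul]
  let z : ℍ := F.pos.symm (s * (p * f))
  have hz : F.pos z = s * (p * f) := by simp [z]
  have hin : ∀ c : ℝ, inner ℝ (p * (c * s + ε' * Complex.I)) (p * f) =
      (c * s * (1 - τ ^ 2) + 2 * τ) / (1 + τ ^ 2) := by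
    intro c
    rw [inner_complex]
    simp [f]
    field_simp
    linear_combination (c * s * (1 - τ ^ 2) + 2 * τ * ε' ^ 2) * hp2 + 2 * τ * hε
  have hmem : ∀ c : ℝ, 0 < c → c * s * τ ≤ 1 →
      F.form (c * √(1 + s ^ 2)) (p * (c * s + ε' * Complex.I)) z ≤ c := by
    intro c hc hcτ
    rw [form_dual_point he hz, hin]
    have : c * s ≤ (c * s * (1 - τ ^ 2) + 2 * τ) / (1 + τ ^ 2) := by
      rw [le_div_iff₀ (by positivity)]
      nlinarith
    nlinarith
  have hzmem : z ∈ C.disk ∩ C'.disk := by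
    rw [h.disk, h'.disk]
    exact ⟨hmem k hk hτk, hmem k' hk' hτk'⟩
  rw [hd] at hzmem
  have hzt : z = t := hzmem
  rw [hzt, ht] at hz
  have hp0 : p ≠ 0 := by rintro rfl; simp at hp
  have hs0 : (s : ℂ) ≠ 0 := by exact_mod_cast hs.ne'
  have hf1 : f = 1 := by
    have := mul_left_cancel₀ hs0 hz
    exact (mul_left_cancel₀ hp0 (by rw [mul_one]; exact this.symm))
  have := congrArg Complex.re hf1
  simp only [f, Complex.one_re] at this
  rw [div_eq_one_iff_eq (by positivity)] at this
  nlinarith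

/-- The packing `Q` is in standard position with respect to the frame `F`: the apex is the centre of
the dual circle, whose radius is `arsinh s`, the tangency points lie in the directions `p i`,
which are met in counterclockwise order, and the generalized circle `i` of curvature `k i` fills the
sector between the directions `p (i - 1)` and `p i`. -/
structure PolygonPacking.StandardPosition {n : ℕ} (Q : PolygonPacking n) (F : HypFrame)
    (k : Fin n → ℝ) (s : ℝ) (p : Fin n → ℂ) : Prop where
  center_eq : F.center = Q.dualCenter
  sinh_radius : Real.sinh Q.dualRadius = s
  norm_dir : ∀ i, ‖p i‖ = 1
  curvature_eq : ∀ i, (Q.circle i).curvature = k i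
  step : ∀ i, p (finRotate n i) * (k (finRotate n i) * s - Complex.I) =
    p i * (k (finRotate n i) * s + Complex.I)
  describes : ∀ i, F.Describes (Q.circle i) (k i * √(1 + s ^ 2)) (p i * (k i * s - Complex.I))
  tangency : ∀ i, F.pos (Q.tangency i) = s * p i

lemma fin_val_add_one {m : ℕ} (i : Fin (m + 3)) :
    ((i + 1 : Fin (m + 3)) : ℕ) = if (i : ℕ) = m + 2 then 0 else (i : ℕ) + 1 := by
  rw [Fin.val_add_one]
  simp [Fin.ext_iff]

/-- In a cyclic sequence of at least three cycles, consecutive ones touching externally and others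
disjoint, consecutive tangency points are different. -/
lemma PolygonPacking.tangency_ne {m : ℕ} (Q : PolygonPacking (m + 3)) {e : Fin (m + 3) → ℝ}
    (he : ∀ i, e i ^ 2 = 1)
    (hflip : ∀ i, Q.tangency i = Q.tangency (i + 1) → e (i + 1) = -e i) (i : Fin (m + 3)) :
    Q.tangency i ≠ Q.tangency (i + 1) := by
  intro h
  have htan := Q.tangent
  have hdis := Q.disjoint
  simp only [finRotate_apply] at htan hdis
  have hD : ∀ j, Q.tangency j ∈ (Q.circle j).disk ∧ Q.tangency j ∈ (Q.circle (j + 1)).disk := by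
    intro j
    have : Q.tangency j ∈ (Q.circle j).disk ∩ (Q.circle (j + 1)).disk := by rw [htan]; rfl
    exact this
  have h1 := (hD i).1
  have h2 := (hD (i + 1)).2
  rw [← h] at h2
  rcases Nat.eq_zero_or_pos m with hm | hm
  · subst hm
    have h3 : i + 1 + 1 + 1 = i := by
      fin_cases i <;> rfl
    have h4 : Q.tangency (i + 1 + 1) = Q.tangency i := by
      have := htan (i + 1 + 1)
      rw [h3] at this
      have h5 : Q.tangency i ∈ (Q.circle (i + 1 + 1)).disk ∩ (Q.circle i).disk := ⟨h2, h1⟩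
      rw [this] at h5
      exact h5.symm
    have e1 := hflip i h
    have e2 := hflip (i + 1) (by rw [h4, h])
    have e3 := hflip (i + 1 + 1) (by rw [h3, h4])
    rw [h3, e2, e1] at e3
    have := he i
    nlinarith
  · refine Set.disjoint_left.1 (hdis i (i + 1 + 1) ?_ ?_ ?_) h1 h2
    all_goals
      intro h
      rw [Fin.ext_iff] at h
      simp only [fin_val_add_one] at h
      split_ifs at h <;> omega

theorem PolygonPacking.exists_standardPosition {m : ℕ} (Q : PolygonPacking (m + 3)) :
    ∃ F p, Q.StandardPosition F (fun i => (Q.circle i).curvature) (Real.sinh Q.dualRadius) p ∧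
      p 0 = 1 := by
  have hR := Q.dualRadius_pos
  have hs := Real.sinh_pos_iff.2 hR
  have hch : √(1 + Real.sinh Q.dualRadius ^ 2) = Real.cosh Q.dualRadius := by
    rw [add_comm, ← Real.cosh_sq, Real.sqrt_sq (Real.cosh_pos _).le]
  have htan := Q.tangent
  have hperp := Q.dual_perp
  simp only [finRotate_apply] at htan hperp
  set s := Real.sinh Q.dualRadius with hsdef
  let F₀ : HypFrame := ⟨Q.dualCenter, LinearIsometryEquiv.refl ℝ ℂ⟩
  choose α β hαβ using fun i => F₀.exists_describes (Q.circle i)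
  choose p hp hpos hα e he hβ using fun i => (hαβ i).of_perpAt hR (hperp i).1
  choose p' hp' hpos' hα' e' he' hβ' using fun i => (hαβ (i + 1)).of_perpAt hR (hperp i).2
  have hs0 : (s : ℂ) ≠ 0 := by exact_mod_cast hs.ne'
  have hpp : ∀ i, p' i = p i := fun i => mul_left_cancel₀ hs0 ((hpos' i).symm.trans (hpos i))
  have hp0 : ∀ i, p i ≠ 0 := fun i h => by simpa [h] using hp i
  simp only [← hsdef] at hpos hβ hβ'
  have hd : ∀ i, F₀.Describes (Q.circle i) ((Q.circle i).curvature * √(1 + s ^ 2))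
      (p i * ((Q.circle i).curvature * s + e i * Complex.I)) := by
    intro i
    rw [hch, ← hα, ← hβ]
    exact hαβ i
  have hd' : ∀ i, F₀.Describes (Q.circle (i + 1)) ((Q.circle (i + 1)).curvature * √(1 + s ^ 2))
      (p i * ((Q.circle (i + 1)).curvature * s + e' i * Complex.I)) := by
    intro i
    rw [hch, ← hα, ← hpp, ← hβ']
    exact hαβ (i + 1)
  have hopp : ∀ i, e' i = -e i := fun i =>
    HypFrame.opposite_sides hs (hp i) (he i) (he' i) (hd i) (hd' i) (hpos i) (htan i)
  have hββ : ∀ i, p (i + 1) * ((Q.circle (i + 1)).curvature * s + e (i + 1) * Complex.I) =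
      p i * ((Q.circle (i + 1)).curvature * s - e i * Complex.I) := by
    intro i
    rw [← hβ (i + 1), hβ' i, hpp, hopp]
    push_cast; ring
  have hne : ∀ i, Q.tangency i ≠ Q.tangency (i + 1) := by
    refine Q.tangency_ne he ?_
    intro i h
    have hpi : p (i + 1) = p i := mul_left_cancel₀ hs0 (by rw [← hpos, ← hpos, h])
    have := hββ i
    rw [hpi] at this
    have := congrArg Complex.im (mul_left_cancel₀ (hp0 i) this)
    simpa using this
  have hconst : ∀ i, e (i + 1) = e i := by
    intro i
    by_contra hcon
    have h1 : e (i + 1) = -e i := by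
      have : (e (i + 1) + e i) * (e (i + 1) - e i) = 0 := by
        linear_combination he (i + 1) - he i
      rcases mul_eq_zero.1 this with h1 | h1
      · linarith
      · exact absurd (by linarith) hcon
    have h2 := hββ i
    rw [h1] at h2
    have h3 : ((Q.circle (i + 1)).curvature * s - e i * Complex.I : ℂ) ≠ 0 := by
      intro h
      have := congrArg Complex.re h
      simp at this
      have hk := (Q.circle (i + 1)).curvature_pos
      rcases this with h' | h'
      · exact hk.ne' h'
      · exact hs.ne' h'
    apply hne i
    apply F₀.pos.injective
    rw [hpos, hpos]
    congr 1
    apply mul_right_cancel₀ h3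
    rw [← h2]
    push_cast; ring
  have hall : ∀ i, e i = e 0 := by
    intro i
    induction i using Fin.induction with
    | zero => rfl
    | succ i ih => rw [← ih, ← hconst i.castSucc, Fin.coeSucc_eq_succ]
  simp only [hall] at hd hββ
  -- turn `p 0` to `1`, and reflect if the packing is clockwise
  have key : ∀ τ : ℂ ≃ₗᵢ[ℝ] ℂ, τ (p 0) = 1 →
      (∀ (q : ℂ) (c : ℝ), τ (q * (c + e 0 * Complex.I)) = τ q * (c - Complex.I)) →
      (∀ (q : ℂ) (c : ℝ), τ (q * (c - e 0 * Complex.I)) = τ q * (c + Complex.I)) →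
      (∀ (q : ℂ) (c : ℝ), τ (c * q) = c * τ q) →
      ∃ F p, Q.StandardPosition F (fun i => (Q.circle i).curvature) s p ∧ p 0 = 1 := by
    intro τ h0 h1 h2 h3
    refine ⟨F₀.turn τ, fun i => τ (p i), ⟨rfl, rfl, ?_, fun i => rfl, ?_, ?_, ?_⟩, h0⟩
    · intro i; rw [LinearIsometryEquiv.norm_map, hp]
    · intro i
      rw [finRotate_apply]
      have := congrArg τ (hββ i)
      have c1 := h1 (p (i + 1)) ((Q.circle (i + 1)).curvature * s)
      have c2 := h2 (p i) ((Q.circle (i + 1)).curvature * s)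
      push_cast at c1 c2
      rw [c1, c2] at this
      exact this
    · intro i
      have := (hd i).turn τ
      have c1 := h1 (p i) ((Q.circle i).curvature * s)
      push_cast at c1
      rwa [c1] at this
    · intro i
      rw [HypFrame.pos_turn, hpos, h3]
  have hpc : (starRingEnd ℂ) (p 0) * p 0 = 1 := by
    rw [Complex.conj_mul', hp]; simp
  have hrot : ∃ ρ : ℂ ≃ₗᵢ[ℝ] ℂ, ∀ q, ρ q = (starRingEnd ℂ) (p 0) * q := by
    refine ⟨rotation ⟨(starRingEnd ℂ) (p 0), ?_⟩, fun q => rfl⟩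
    simp [Submonoid.unitSphere, hp]
  obtain ⟨ρ, hρ⟩ := hrot
  have he0 : (e 0 - 1) * (e 0 + 1) = 0 := by linear_combination he 0
  rcases mul_eq_zero.1 he0 with h | h
  · have h1 : e 0 = 1 := by linarith
    refine key (ρ.trans Complex.conjLIE) ?_ ?_ ?_ ?_
    · simp [hρ, hpc]
    · intro q c; simp [hρ, h1]; ring
    · intro q c; simp [hρ, h1]; ring
    · intro q c; simp [hρ]; ring
  · have h1 : e 0 = -1 := by linarith
    refine key ρ ?_ ?_ ?_ ?_
    · simp [hρ, hpc]
    · intro q c; simp [hρ, h1]; ring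
    · intro q c; simp [hρ, h1]; ring
    · intro q c; simp [hρ]; ring

/-! ### The length of a curve as a Hausdorff measure -/

section CurveLength

variable {X : Type*} [MetricSpace X] [MeasurableSpace X] [BorelSpace X]

lemma hausdorffMeasure_image_Ioc_le {γ : ℝ → X} {s t K : ℝ} (hst : s ≤ t)
    (h : ∀ x ∈ Set.Ioc s t, ∀ y ∈ Set.Ioc s t, dist (γ x) (γ y) ≤ K * |x - y|) :
    μH[1] (γ '' Set.Ioc s t) ≤ ENNReal.ofReal (K * (t - s)) := by
  rcases hst.eq_or_lt with rfl | hlt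
  · simp
  rcases lt_or_ge K 0 with hK | hK
  · have hm := Set.right_mem_Ioc.2 hlt
    have hm' : (s + t) / 2 ∈ Set.Ioc s t := ⟨by linarith, by linarith⟩
    have h1 := h _ hm _ hm'
    have h2 : 0 < |t - (s + t) / 2| := abs_pos.2 (by linarith)
    nlinarith [dist_nonneg (x := γ t) (y := γ ((s + t) / 2))]
  · have hL : LipschitzOnWith K.toNNReal γ (Set.Ioc s t) := by
      apply LipschitzOnWith.of_dist_le_mul
      intro x hx y hy
      rw [Real.coe_toNNReal K hK, Real.dist_eq]
      exact h x hx y hy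
    have := hL.hausdorffMeasure_image_le (d := 1) zero_le_one
    rw [hausdorffMeasure_real, Real.volume_Ioc, ENNReal.rpow_one] at this
    rwa [ENNReal.ofReal_mul hK]

lemma le_hausdorffMeasure_image_Ioc {γ : ℝ → X} {s t K : ℝ} (hK : 0 < K)
    (h : ∀ x ∈ Set.Ioc s t, ∀ y ∈ Set.Ioc s t, K * |x - y| ≤ dist (γ x) (γ y)) :
    ENNReal.ofReal (K * (t - s)) ≤ μH[1] (γ '' Set.Ioc s t) := by
  have hinj : Set.InjOn γ (Set.Ioc s t) := by
    intro x hx y hy hxy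
    have h1 := h x hx y hy
    rw [hxy, dist_self] at h1
    have h2 : |x - y| ≤ 0 := by
      by_contra h3
      have := mul_pos hK (not_le.1 h3)
      linarith
    exact sub_eq_zero.1 (abs_nonpos_iff.1 h2)
  set g := Function.invFunOn γ (Set.Ioc s t)
  have hg : ∀ x ∈ Set.Ioc s t, g (γ x) = x := fun x hx => hinj.leftInvOn_invFunOn hx
  have hL : LipschitzOnWith K⁻¹.toNNReal g (γ '' Set.Ioc s t) := by
    apply LipschitzOnWith.of_dist_le_mul
    rintro _ ⟨x, hx, rfl⟩ _ ⟨y, hy, rfl⟩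
    rw [Real.coe_toNNReal _ (inv_pos.2 hK).le, hg x hx, hg y hy, Real.dist_eq, inv_mul_eq_div,
      le_div_iff₀ hK, mul_comm]
    exact h x hx y hy
  have himg : g '' (γ '' Set.Ioc s t) = Set.Ioc s t := by
    rw [Set.image_image]
    exact (Set.image_congr hg).trans (Set.image_id _)
  have := hL.hausdorffMeasure_image_le (d := 1) zero_le_one
  rw [himg, hausdorffMeasure_real, Real.volume_Ioc, ENNReal.rpow_one] at this
  rw [ENNReal.ofReal_mul hK.le]
  calc ENNReal.ofReal K * ENNReal.ofReal (t - s)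
      ≤ ENNReal.ofReal K * (ENNReal.ofReal K⁻¹ * μH[1] (γ '' Set.Ioc s t)) := by gcongr; exact this
    _ = μH[1] (γ '' Set.Ioc s t) := by
        rw [← mul_assoc, ← ENNReal.ofReal_mul hK.le, mul_inv_cancel₀ hK.ne', ENNReal.ofReal_one,
          one_mul]

/-- A curve whose chords are squeezed between two multiples `lo` and `hi` of the parameter
difference, both tending to the speed `v` on the diagonal, has length `∫ v`. -/
theorem hausdorffMeasure_curve {γ : ℝ → X} {v : ℝ → ℝ} {lo hi : ℝ × ℝ → ℝ} {a b M : ℝ} (hab : a ≤ b)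
    (hv : ContinuousOn v (Set.Icc a b)) (hpos : ∀ t ∈ Set.Icc a b, 0 < v t)
    (hinj : Set.InjOn γ (Set.Icc a b))
    (hlo : ∀ s ∈ Set.Icc a b, ∀ t ∈ Set.Icc a b, lo (s, t) * |s - t| ≤ dist (γ s) (γ t))
    (hhi : ∀ s ∈ Set.Icc a b, ∀ t ∈ Set.Icc a b, dist (γ s) (γ t) ≤ hi (s, t) * |s - t|)
    (hM : ∀ s ∈ Set.Icc a b, ∀ t ∈ Set.Icc a b, hi (s, t) ≤ M)
    (clo : ∀ t ∈ Set.Icc a b, Filter.Tendsto lo (nhds (t, t)) (nhds (v t)))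
    (chi : ∀ t ∈ Set.Icc a b, Filter.Tendsto hi (nhds (t, t)) (nhds (v t))) :
    (μH[1] : Measure X).real (γ '' Set.Icc a b) = ∫ t in a..b, v t := by
  have hM' : ∀ s ∈ Set.Icc a b, ∀ t ∈ Set.Icc a b, dist (γ s) (γ t) ≤ M * |s - t| :=
    fun s hs t ht => (hhi s hs t ht).trans
      (mul_le_mul_of_nonneg_right (hM s hs t ht) (abs_nonneg _))
  have hsub : ∀ {s t}, s ∈ Set.Icc a b → t ∈ Set.Icc a b → Set.Ioc s t ⊆ Set.Icc a b :=
    fun hs ht x hx => ⟨hs.1.trans hx.1.le, hx.2.trans ht.2⟩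
  have hfin : ∀ s ∈ Set.Icc a b, ∀ t ∈ Set.Icc a b, s ≤ t →
      μH[1] (γ '' Set.Ioc s t) ≤ ENNReal.ofReal (M * (t - s)) := fun s hs t ht hst =>
    hausdorffMeasure_image_Ioc_le hst fun x hx y hy => hM' x (hsub hs ht hx) y (hsub hs ht hy)
  set m : ℝ → ℝ := fun t => (μH[1] : Measure X).real (γ '' Set.Ioc a t) with hm
  have ha : a ∈ Set.Icc a b := Set.left_mem_Icc.2 hab
  have hb : b ∈ Set.Icc a b := Set.right_mem_Icc.2 hab
  have hMnn : 0 ≤ M ∨ a = b := by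
    rcases hab.eq_or_lt with h | h
    · exact Or.inr h
    · left
      have := hM' a ha b hb
      have h2 : 0 < |a - b| := abs_pos.2 (by linarith)
      by_contra hneg
      have := mul_neg_of_neg_of_pos (not_le.1 hneg) h2
      linarith [dist_nonneg (x := γ a) (y := γ b)]
  have hcont : ContinuousOn γ (Set.Icc a b) := by
    have : LipschitzOnWith M.toNNReal γ (Set.Icc a b) := by
      apply LipschitzOnWith.of_dist_le_mul
      intro x hx y hy
      rw [Real.dist_eq]
      exact (hM' x hx y hy).trans
        (mul_le_mul_of_nonneg_right (Real.le_coe_toNNReal M) (abs_nonneg _))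
    exact this.continuousOn
  have hmeas : ∀ s ∈ Set.Icc a b, ∀ t ∈ Set.Icc a b, MeasurableSet (γ '' Set.Ioc s t) := by
    intro s hs t ht
    have e : γ '' Set.Ioc s t = γ '' Set.Icc s t \ γ '' {s} ∨ t < s := by
      rcases lt_or_ge t s with h | h
      · exact Or.inr h
      · left
        rw [← (hinj.mono (Set.Icc_subset_Icc hs.1 ht.2)).image_sdiff_subset
          (Set.singleton_subset_iff.2 (Set.left_mem_Icc.2 h)), Set.Icc_sdiff_left]
    rcases e with e | e
    · rw [e]
      refine MeasurableSet.diff ?_ ?_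
      · exact (isCompact_Icc.image_of_continuousOn
          (hcont.mono (Set.Icc_subset_Icc hs.1 ht.2))).isClosed.measurableSet
      · simp
    · rw [Set.Ioc_eq_empty (by linarith)]; simp
  have hadd : ∀ s ∈ Set.Icc a b, ∀ t ∈ Set.Icc a b, s ≤ t →
      m t = m s + (μH[1] : Measure X).real (γ '' Set.Ioc s t) := by
    intro s hs t ht hst
    simp only [hm]
    rw [← Set.Ioc_union_Ioc_eq_Ioc hs.1 hst, Set.image_union,
      measureReal_union ?_ (hmeas s hs t ht)
        ((hfin a ha s hs hs.1).trans_lt ENNReal.ofReal_lt_top).ne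
        ((hfin s hs t ht hst).trans_lt ENNReal.ofReal_lt_top).ne]
    · rw [Set.disjoint_left]
      rintro _ ⟨x, hx, rfl⟩ ⟨y, hy, hxy⟩
      have := hinj (hsub hs ht hy) (hsub ha hs hx) hxy
      exact absurd (hx.2.trans_lt hy.1) (by rw [this]; exact lt_irrefl _)
  have hIcc : (μH[1] : Measure X).real (γ '' Set.Icc a b) = m b := by
    have hun : γ '' Set.Icc a b = γ '' Set.Ioc a b ∪ {γ a} := by
      rw [← Set.image_singleton, ← Set.image_union, Set.Ioc_union_left hab]
    simp only [hm]
    have : NullSingletonClass (μH[1] : Measure X) :=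
      Measure.nullSingletonClass_hausdorff X one_pos
    rw [hun, measureReal_def, measureReal_def]
    congr 1
    refine le_antisymm ((measure_union_le _ _).trans_eq ?_) (measure_mono Set.subset_union_left)
    rw [measure_singleton, add_zero]
  have hma : m a = 0 := by simp [hm]
  rw [hIcc, ← sub_zero (m b), ← hma]
  symm
  have huI : Set.uIcc a b = Set.Icc a b := Set.uIcc_of_le hab
  apply intervalIntegral.integral_eq_sub_of_hasDeriv_right
  · rw [huI]
    rcases hMnn with hM0 | hab'
    · have : LipschitzOnWith M.toNNReal m (Set.Icc a b) := by
        apply LipschitzOnWith.of_dist_le_mul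
        have key : ∀ x ∈ Set.Icc a b, ∀ y ∈ Set.Icc a b, x ≤ y →
            dist (m x) (m y) ≤ M * dist x y := by
          intro x hx y hy hxy
          rw [hadd x hx y hy hxy, dist_comm, Real.dist_eq, add_sub_cancel_left, dist_comm,
            Real.dist_eq, abs_of_nonneg measureReal_nonneg, abs_of_nonneg (sub_nonneg.2 hxy)]
          exact ENNReal.toReal_le_of_le_ofReal (mul_nonneg hM0 (sub_nonneg.2 hxy))
            (hfin x hx y hy hxy)
        intro x hx y hy
        rw [Real.coe_toNNReal M hM0]
        rcases le_total x y with h | h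
        · exact key x hx y hy h
        · rw [dist_comm, dist_comm x]; exact key y hy x hx h
      exact this.continuousOn
    · rw [hab', Set.Icc_self]; exact continuousOn_singleton _ _
  · rw [min_eq_left hab, max_eq_right hab]
    intro t₀ ht₀
    have ht₀' : t₀ ∈ Set.Icc a b := ⟨ht₀.1.le, ht₀.2.le⟩
    rw [hasDerivWithinAt_iff_tendsto_slope' (by simp)]
    rw [Metric.tendsto_nhds]
    intro ε hε
    have hv0 := hpos t₀ ht₀'
    set η := min (ε / 2) (v t₀ / 2) with hη
    have hη0 : 0 < η := lt_min (by linarith) (by linarith)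
    have hη1 : η ≤ ε / 2 := min_le_left _ _
    have hη2 : η ≤ v t₀ / 2 := min_le_right _ _
    have h1 := (clo t₀ ht₀').eventually (lt_mem_nhds (show v t₀ - η < v t₀ by linarith))
    have h2 := (chi t₀ ht₀').eventually (gt_mem_nhds (show v t₀ < v t₀ + η by linarith))
    obtain ⟨δ, hδ, hball⟩ := Metric.eventually_nhds_iff.1 (h1.and h2)
    have hsmall : Set.Ioo t₀ (min (t₀ + δ) b) ∈ nhdsWithin t₀ (Set.Ioi t₀) :=
      Ioo_mem_nhdsGT (lt_min (by linarith) ht₀.2)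
    filter_upwards [hsmall] with t ht
    have htb : t < b := ht.2.trans_le (min_le_right _ _)
    have htδ : t < t₀ + δ := ht.2.trans_le (min_le_left _ _)
    have ht' : t ∈ Set.Icc a b := ⟨ht₀.1.le.trans ht.1.le, htb.le⟩
    have hst : 0 < t - t₀ := sub_pos.2 ht.1
    have hnear : ∀ x ∈ Set.Ioc t₀ t, ∀ y ∈ Set.Ioc t₀ t,
        v t₀ - η < lo (x, y) ∧ hi (x, y) < v t₀ + η := by
      intro x hx y hy
      apply hball
      rw [Prod.dist_eq, max_lt_iff, Real.dist_eq, Real.dist_eq, abs_lt, abs_lt]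
      refine ⟨⟨?_, ?_⟩, ?_, ?_⟩ <;> simp only <;> linarith [hx.1, hx.2, hy.1, hy.2]
    have hup := hausdorffMeasure_image_Ioc_le (γ := γ) (K := v t₀ + η) ht.1.le
      (fun x hx y hy => (hhi x (hsub ht₀' ht' hx) y (hsub ht₀' ht' hy)).trans
        (mul_le_mul_of_nonneg_right (hnear x hx y hy).2.le (abs_nonneg _)))
    have hdn := le_hausdorffMeasure_image_Ioc (γ := γ) (K := v t₀ - η) (by linarith)
      (fun x hx y hy => (mul_le_mul_of_nonneg_right (hnear x hx y hy).1.le (abs_nonneg _)).trans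
        (hlo x (hsub ht₀' ht' hx) y (hsub ht₀' ht' hy)))
    have hup' : (μH[1] : Measure X).real (γ '' Set.Ioc t₀ t) ≤ (v t₀ + η) * (t - t₀) :=
      ENNReal.toReal_le_of_le_ofReal (mul_nonneg (by linarith) hst.le) hup
    have hdn' : (v t₀ - η) * (t - t₀) ≤ (μH[1] : Measure X).real (γ '' Set.Ioc t₀ t) :=
      (ENNReal.ofReal_le_iff_le_toReal (hup.trans_lt ENNReal.ofReal_lt_top).ne).1 hdn
    rw [slope_def_field, hadd t₀ ht₀' t ht' ht.1.le, add_sub_cancel_left, Real.dist_eq, abs_lt]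
    have e1 := (div_le_iff₀ hst).2 hup'
    have e2 := (le_div_iff₀ hst).2 hdn'
    constructor <;> linarith
  · rw [← huI] at hv
    exact hv.intervalIntegrable

end CurveLength

/-! ### The arc of a generalized circle inside the dual circle -/

lemma one_sub_curvature_mul_sq {k s u : ℝ} (hk : 0 < k) (hs : 0 < s)
    (hu : |u| ≤ s / (√(1 + s ^ 2) + √(1 + k ^ 2 * s ^ 2))) :
    0 < 1 + (k ^ 2 - 1) * u ^ 2 ∧ 0 < 1 - (k ^ 2 - 1) * u ^ 2 := by
  have hC2 : √(1 + s ^ 2) ^ 2 = 1 + s ^ 2 := Real.sq_sqrt (by positivity)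
  have hD2 : √(1 + k ^ 2 * s ^ 2) ^ 2 = 1 + k ^ 2 * s ^ 2 := Real.sq_sqrt (by positivity)
  have hC : 0 < √(1 + s ^ 2) := Real.sqrt_pos.2 (by positivity)
  have hD : 0 < √(1 + k ^ 2 * s ^ 2) := Real.sqrt_pos.2 (by positivity)
  set C := √(1 + s ^ 2)
  set D := √(1 + k ^ 2 * s ^ 2)
  have h1 : u ^ 2 ≤ (s / (C + D)) ^ 2 := by
    rw [← sq_abs]; gcongr
  rw [div_pow, le_div_iff₀ (by positivity)] at h1
  have h3 : 0 < (C + D) ^ 2 := by positivity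
  have h4 : 0 < C * D := by positivity
  have hu2 := sq_nonneg u
  have hk2 : 0 < k ^ 2 := by positivity
  have hs2 : 0 < s ^ 2 := by positivity
  constructor
  · by_contra hneg
    nlinarith [mul_nonneg hk2.le hu2, mul_le_mul_of_nonneg_left h1 hk2.le]
  · by_contra hneg
    nlinarith [mul_nonneg hk2.le hu2, mul_le_mul_of_nonneg_left h1 hk2.le]

set_option maxHeartbeats 800000 in
/-- Rational parametrization of the arc that a cycle of curvature `k`, perpendicular to the circle
of radius `arsinh s` about the apex, has inside that circle. -/
lemma HypFrame.exists_arc_param (F : HypFrame) {k s : ℝ} (hk : 0 < k) (hs : 0 < s) {β : ℂ}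
    (hβ : ‖β‖ ^ 2 = 1 + k ^ 2 * s ^ 2) {u₀ : ℝ}
    (hu₀ : u₀ = s / (√(1 + s ^ 2) + √(1 + k ^ 2 * s ^ 2))) :
    ∃ γ : ℝ → ℍ, (∀ u ∈ Set.Icc (-u₀) u₀, ∀ v ∈ Set.Icc (-u₀) u₀, Real.cosh (dist (γ u) (γ v)) =
        1 + 2 * (u - v) ^ 2 / ((1 + (k ^ 2 - 1) * u ^ 2) * (1 + (k ^ 2 - 1) * v ^ 2))) ∧
      γ '' Set.Icc (-u₀) u₀ =
        {z | F.form (k * √(1 + s ^ 2)) β z = k ∧ F.time z ≤ √(1 + s ^ 2)} := by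
  have hw : ∀ u ∈ Set.Icc (-u₀) u₀,
      0 < 1 + (k ^ 2 - 1) * u ^ 2 ∧ 0 < 1 - (k ^ 2 - 1) * u ^ 2 := by
    intro u hu
    exact one_sub_curvature_mul_sq hk hs (hu₀ ▸ abs_le.2 hu)
  have hC2 : √(1 + s ^ 2) ^ 2 = 1 + s ^ 2 := Real.sq_sqrt (by positivity)
  have hD2 : √(1 + k ^ 2 * s ^ 2) ^ 2 = 1 + k ^ 2 * s ^ 2 := Real.sq_sqrt (by positivity)
  have hC : 1 < √(1 + s ^ 2) := Real.lt_sqrt_of_sq_lt (by linarith [pow_pos hs 2])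
  have hD : 1 < √(1 + k ^ 2 * s ^ 2) := Real.lt_sqrt_of_sq_lt (by
    linarith [show 0 < k ^ 2 * s ^ 2 by positivity])
  set C := √(1 + s ^ 2)
  set D := √(1 + k ^ 2 * s ^ 2)
  have hC0 : 0 < C := by linarith
  have hD0 : 0 < D := by linarith
  have hDk : D ^ 2 = 1 + k ^ 2 * C ^ 2 - k ^ 2 := by rw [hC2, hD2]; ring
  have hu₀C : u₀ * (C + D) = s := by rw [hu₀]; field_simp
  have hu₀0 : 0 < u₀ := by rw [hu₀]; positivity
  obtain ⟨e, heβ, he⟩ : ∃ e : ℂ, β = D * e ∧ e.re ^ 2 + e.im ^ 2 = 1 := by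
    have hD' : (D : ℂ) ≠ 0 := by exact_mod_cast hD0.ne'
    refine ⟨β / D, by field_simp, ?_⟩
    rw [← norm_sq_complex, norm_div, div_pow, hβ, Complex.norm_real, Real.norm_eq_abs, sq_abs, hD2,
      div_self (by positivity)]
  -- the boost that moves the apex to the point of the arc closest to it
  obtain ⟨ch, sh, hch, hsh, e1, e2, e3⟩ : ∃ ch sh : ℝ, 0 < ch ∧ 0 ≤ sh ∧ k * C * ch - D * sh = k ∧
      D * ch - k * C * sh = 1 ∧ ch ^ 2 - sh ^ 2 = 1 := by
    refine ⟨(1 + k ^ 2 * C ^ 2) / (k ^ 2 * C + D), k * (D * C - 1) / (k ^ 2 * C + D),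
      by positivity, ?_, ?_, ?_, ?_⟩
    · have : 0 ≤ D * C - 1 := sub_nonneg.2 (one_le_mul_of_one_le_of_one_le hD.le hC.le)
      positivity
    · field_simp; linear_combination (-C) * hDk
    · field_simp; ring
    · field_simp
      linear_combination (-(1 + k ^ 2 * C ^ 2)) * hDk
  have e4 : k * ch + sh = k * C := by linear_combination -ch * e1 - sh * e2 + k * C * e3
  have e5 : k * sh + ch = D := by linear_combination -sh * e1 - ch * e2 + D * e3
  have hpos : ∀ (x y : ℝ), ‖((x : ℂ) + y * Complex.I) * e‖ ^ 2 = x ^ 2 + y ^ 2 := by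
    intro x y
    rw [norm_sq_complex]; simp
    linear_combination (x ^ 2 + y ^ 2) * he
  have hinβ : ∀ (x y : ℝ), inner ℝ β (((x : ℂ) + y * Complex.I) * e) = D * x := by
    intro x y
    rw [heβ, inner_complex]; simp
    linear_combination D * x * he
  have hin : ∀ a b c d : ℝ,
      inner ℝ (((a : ℂ) + b * Complex.I) * e) (((c : ℂ) + d * Complex.I) * e) =
      a * c + b * d := by
    intro a b c d
    rw [inner_complex]; simp
    linear_combination (a * c + b * d) * he
  -- the quadratic equation that relates the time coordinate on the cycle to the height `y`
  have hquad : ∀ t x y : ℝ, k * C * t - D * x = k → t ^ 2 = 1 + (x ^ 2 + y ^ 2) →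
      (t - C) * ((1 - k ^ 2) * t + (1 + k ^ 2) * C) = (D * y) ^ 2 - s ^ 2 := by
    intro t x y h1 h2
    have h3 : D * x = k * C * t - k := by linarith
    have h4 : (D * x) ^ 2 = (k * C * t - k) ^ 2 := by rw [h3]
    linear_combination D ^ 2 * h2 + h4 + (1 - t ^ 2) * hDk - hC2
  -- the end points of the parameter interval
  have hκ : u₀ * s * (k ^ 2 - 1) = D - C := by
    apply mul_right_cancel₀ (show C + D ≠ 0 by positivity)
    linear_combination s * (k ^ 2 - 1) * hu₀C - hD2 + hC2
  have hid : ∀ u : ℝ, s * (1 + (k ^ 2 - 1) * u ^ 2) - 2 * D * u =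
      (u₀ - u) * ((C + D) - s * (k ^ 2 - 1) * u) := by
    intro u
    linear_combination u * hκ - hu₀C
  have hend : ∀ u, -u₀ ≤ u → u ≤ u₀ → 2 * D * u ≤ s * (1 + (k ^ 2 - 1) * u ^ 2) := by
    intro u h1 h2
    rw [← sub_nonneg, hid]
    apply mul_nonneg (by linarith)
    rcases le_total 0 (s * (k ^ 2 - 1)) with h | h
    · linarith [mul_le_mul_of_nonneg_left h2 h]
    · linarith [mul_le_mul_of_nonpos_left h1 h]
  have hend' : ∀ u, (k ^ 2 - 1) * u ^ 2 < 1 → 2 * D * u ≤ s * (1 + (k ^ 2 - 1) * u ^ 2) →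
      u ≤ u₀ := by
    intro u h1 h2
    rw [← sub_nonneg, hid] at h2
    by_contra hlt
    have hlt := not_le.1 hlt
    have h3 : (C + D) - s * (k ^ 2 - 1) * u ≤ 0 := by
      by_contra h4
      have := mul_neg_of_neg_of_pos (sub_neg.2 hlt) (not_le.1 h4)
      linarith
    have hu : 0 < u := hu₀0.trans hlt
    have h5 := mul_le_mul_of_nonneg_right h3 hu.le
    have h6 := mul_lt_mul_of_pos_left h1 hs
    have h7 := mul_lt_mul_of_pos_left hlt (show 0 < C + D by positivity)
    linarith
  -- coordinates with respect to the boosted apex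
  let W : ℝ → ℝ := fun u => (1 + (k ^ 2 - 1) * u ^ 2)⁻¹
  let Y₀ : ℝ → ℝ := fun u => 1 + 2 * u ^ 2 * W u
  let Y₁ : ℝ → ℝ := fun u => 2 * k * u ^ 2 * W u
  have hW : ∀ u, 0 < 1 + (k ^ 2 - 1) * u ^ 2 → W u * (1 + (k ^ 2 - 1) * u ^ 2) = 1 := fun u hu =>
    inv_mul_cancel₀ hu.ne'
  let γ : ℝ → ℍ := fun u =>
    F.pos.symm (((sh * Y₀ u + ch * Y₁ u : ℝ) + (2 * u * W u : ℝ) * Complex.I) * e)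
  have hγ : ∀ u, F.pos (γ u) =
      ((sh * Y₀ u + ch * Y₁ u : ℝ) + (2 * u * W u : ℝ) * Complex.I) * e := fun u => by
    simp only [γ, Equiv.apply_symm_apply]
  have htime : ∀ u, 0 < 1 + (k ^ 2 - 1) * u ^ 2 → F.time (γ u) = ch * Y₀ u + sh * Y₁ u := by
    intro u hu
    have hWu : 0 < W u := inv_pos.2 hu
    have hT : 0 < ch * Y₀ u + sh * Y₁ u := by positivity
    have := F.time_sq (γ u)
    rw [hγ, hpos] at this
    refine (sq_eq_sq₀ (F.time_pos _).le hT.le).1 ?_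
    rw [this]
    linear_combination (4 * u ^ 2 * W u) * hW u hu - (Y₀ u ^ 2 - Y₁ u ^ 2) * e3
  have hform : ∀ u, 0 < 1 + (k ^ 2 - 1) * u ^ 2 → F.form (k * C) β (γ u) = k := by
    intro u hu
    rw [form, htime u hu, hγ, hinβ]
    linear_combination Y₀ u * e1 - Y₁ u * e2
  refine ⟨γ, ?_, ?_⟩
  · intro u hu v hv
    have hwu := (hw u hu).1
    have hwv := (hw v hv).1
    rw [F.cosh_dist, htime u hwu, htime v hwv, hγ, hγ, hin, div_eq_mul_inv, mul_inv]
    change _ = 1 + 2 * (u - v) ^ 2 * (W u * W v)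
    linear_combination (Y₀ u * Y₀ v - Y₁ u * Y₁ v) * e3 - 2 * u ^ 2 * W u * hW v hwv
      - 2 * v ^ 2 * W v * hW u hwu
  · ext z
    constructor
    · rintro ⟨u, hu, rfl⟩
      obtain ⟨hw1, hw2⟩ := hw u hu
      have hWu : 0 < W u := inv_pos.2 hw1
      refine ⟨hform u hw1, ?_⟩
      have hq := hquad (F.time (γ u)) (sh * Y₀ u + ch * Y₁ u) (2 * u * W u) (by
        have := hform u hw1
        rwa [form, hγ, hinβ] at this) (by rw [F.time_sq, hγ, hpos])
      have hfac : 0 < (1 - k ^ 2) * F.time (γ u) + (1 + k ^ 2) * C := by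
        have h6 : (1 - k ^ 2) * F.time (γ u) + k ^ 2 * C =
            D * (W u * (1 - (k ^ 2 - 1) * u ^ 2)) := by
          rw [htime u hw1]
          linear_combination (Y₀ u - k * Y₁ u) * e5 - k * e4 - D * hW u hw1
        have : 0 < D * (W u * (1 - (k ^ 2 - 1) * u ^ 2)) := by positivity
        linarith
      have hy : (D * (2 * u * W u)) ^ 2 ≤ s ^ 2 := by
        apply sq_le_sq'
        · have h7 := hend (-u) (by linarith [hu.2]) (by linarith [hu.1])
          have h8 := mul_le_mul_of_nonneg_right h7 hWu.le
          have h9 : s * (1 + (k ^ 2 - 1) * (-u) ^ 2) * W u = s := by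
            linear_combination s * hW u hw1
          have h10 : 2 * D * -u * W u = -(D * (2 * u * W u)) := by ring
          linarith
        · have h7 := hend u hu.1 hu.2
          have h8 := mul_le_mul_of_nonneg_right h7 hWu.le
          have h9 : s * (1 + (k ^ 2 - 1) * u ^ 2) * W u = s := by
            linear_combination s * hW u hw1
          have h10 : 2 * D * u * W u = D * (2 * u * W u) := by ring
          linarith
      by_contra hlt
      have := mul_pos (sub_pos.2 (not_le.1 hlt)) hfac
      linarith
    · rintro ⟨h1, h2⟩
      obtain ⟨x, y, hxy⟩ : ∃ x y : ℝ, F.pos z = ((x : ℂ) + y * Complex.I) * e := by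
        refine ⟨(F.pos z * (starRingEnd ℂ) e).re, (F.pos z * (starRingEnd ℂ) e).im, ?_⟩
        rw [Complex.re_add_im, mul_assoc, Complex.conj_mul', ← Complex.ofReal_pow, norm_sq_complex,
          he]
        simp
      have ht2 := F.time_sq z
      rw [hxy, hpos] at ht2
      rw [form, hxy, hinβ] at h1
      have hq := hquad _ _ _ h1 ht2
      set t := F.time z
      have ht : 0 < t := F.time_pos z
      -- inverse boost
      obtain ⟨y₀, hy₀⟩ : ∃ y₀, y₀ = ch * t - sh * x := ⟨_, rfl⟩
      have hy₁ : ch * x - sh * t = k * (y₀ - 1) := by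
        rw [hy₀]
        linear_combination (-t) * e4 + x * e5 - h1
      obtain ⟨p, hp⟩ : ∃ p, p = y₀ - k * (k * (y₀ - 1)) := ⟨_, rfl⟩
      have hpD : D * p = (1 - k ^ 2) * t + k ^ 2 * C := by
        have ht' : t = ch * y₀ + sh * (k * (y₀ - 1)) := by
          rw [← hy₁, hy₀]
          linear_combination (-t) * e3
        rw [hp]
        linear_combination -(y₀ - k * (k * (y₀ - 1))) * e5 - (1 - k ^ 2) * ht' + k * e4
      have hp0 : 0 < p := by
        have : 0 < D * p := by
          rw [hpD]
          rcases le_total k 1 with hk1 | hk1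
          · have : 0 ≤ 1 - k ^ 2 := sub_nonneg.2 (pow_le_one₀ hk.le hk1)
            positivity
          · have h6 := mul_le_mul_of_nonneg_left h2 (sub_nonneg.2 (one_le_pow₀ hk1 : 1 ≤ k ^ 2))
            have h7 : (1 - k ^ 2) * t + k ^ 2 * C = C - ((k ^ 2 - 1) * t - (k ^ 2 - 1) * C) := by
              ring
            linarith
        exact (mul_pos_iff_of_pos_left hD0).1 this
      have hy2 : y ^ 2 = (y₀ - 1) * (1 + p) := by
        have : y₀ ^ 2 - (k * (y₀ - 1)) ^ 2 = 1 + y ^ 2 := by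
          rw [← hy₁, hy₀]
          linear_combination (t ^ 2 - x ^ 2) * e3 + ht2
        rw [hp]
        linear_combination -this
      have hp1 : 1 + p ≠ 0 := by positivity
      obtain ⟨u, hu⟩ : ∃ u, u * (1 + p) = y := ⟨y / (1 + p), div_mul_cancel₀ _ hp1⟩
      have hu2 : u ^ 2 * (1 + p) = y₀ - 1 := by
        apply mul_right_cancel₀ hp1
        rw [← hy2, ← hu]; ring
      have hκu : (1 + (k ^ 2 - 1) * u ^ 2) * (1 + p) = 2 := by
        linear_combination (k ^ 2 - 1) * hu2 + hp
      have hw0 : 0 < 1 + (k ^ 2 - 1) * u ^ 2 :=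
        (mul_pos_iff_of_pos_right (show 0 < 1 + p by positivity)).1
          (by rw [hκu]; norm_num)
      have hWu : W u = (1 + p) / 2 := by
        apply mul_right_cancel₀ hw0.ne'
        rw [hW u hw0]
        linear_combination (-1 / 2 : ℝ) * hκu
      have hκ1 : (k ^ 2 - 1) * u ^ 2 < 1 := by
        have h7 : (1 - (k ^ 2 - 1) * u ^ 2) * (1 + p) = 2 * p := by linear_combination -hκu
        have h8 := (mul_pos_iff_of_pos_right (show 0 < 1 + p by positivity)).1
          (h7 ▸ (by positivity : 0 < 2 * p))
        linarith
      have hDy : |D * y| ≤ s := by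
        apply abs_le_of_sq_le_sq _ hs.le
        have : 0 ≤ (C - t) * (D * p + C) :=
          mul_nonneg (by linarith) (by positivity)
        rw [hpD] at this
        linarith
      rw [abs_le] at hDy
      refine ⟨u, ⟨?_, ?_⟩, ?_⟩
      · have := hend' (-u) (by rwa [neg_sq]) (by
          rw [neg_sq]
          have := mul_le_mul_of_nonneg_right hDy.1 hw0.le
          rw [← hu] at this
          have e : D * (u * (1 + p)) * (1 + (k ^ 2 - 1) * u ^ 2) = 2 * D * u := by
            linear_combination D * u * hκu
          linarith)
        linarith
      · apply hend' u hκ1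
        have := mul_le_mul_of_nonneg_right hDy.2 hw0.le
        rw [← hu] at this
        have e : D * (u * (1 + p)) * (1 + (k ^ 2 - 1) * u ^ 2) = 2 * D * u := by
          linear_combination D * u * hκu
        linarith
      · apply F.pos.injective
        rw [hγ, hxy]
        have hY0 : Y₀ u = y₀ := by
          simp only [Y₀, hWu]
          linear_combination hu2
        have hY1 : Y₁ u = k * (y₀ - 1) := by
          simp only [Y₁, hWu]
          linear_combination k * hu2
        have hx : sh * Y₀ u + ch * Y₁ u = x := by
          rw [hY0, hY1, ← hy₁, hy₀]
          linear_combination x * e3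
        have hyy : 2 * u * W u = y := by rw [hWu, ← hu]; ring
        rw [hx, hyy]

/-! ### The length of the arc inside the dual circle -/

lemma sinh_le_mul_cosh {x : ℝ} (hx : 0 ≤ x) : Real.sinh x ≤ x * Real.cosh x := by
  have hmono : MonotoneOn (fun y => y * Real.cosh y - Real.sinh y) (Set.Ici 0) := by
    apply monotoneOn_of_deriv_nonneg (convex_Ici 0) (by fun_prop) (by fun_prop)
    intro y hy
    rw [interior_Ici] at hy
    have h : HasDerivAt (fun y => y * Real.cosh y - Real.sinh y)
        (1 * Real.cosh y + y * Real.sinh y - Real.cosh y) y :=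
      ((hasDerivAt_id y).mul (Real.hasDerivAt_cosh y)).sub (Real.hasDerivAt_sinh y)
    rw [h.deriv]
    have : 0 ≤ Real.sinh y := Real.sinh_nonneg_iff.2 (le_of_lt hy)
    have : 0 ≤ y * Real.sinh y := mul_nonneg (le_of_lt hy) this
    linarith
  have := hmono (Set.self_mem_Ici) hx hx
  simp at this
  linarith

lemma dist_bounds_of_cosh_eq {d q w : ℝ} (hd : 0 ≤ d) (hq : 0 ≤ q) (hw : 0 < w)
    (h : Real.cosh d = 1 + 2 * q ^ 2 / w) :
    2 / √(w + q ^ 2) * q ≤ d ∧ d ≤ 2 / √w * q := by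
  have hsh : Real.sinh (d / 2) = q / √w := by
    have h1 : Real.cosh d = 1 + 2 * Real.sinh (d / 2) ^ 2 := by
      have : d = 2 * (d / 2) := by ring
      rw [this, Real.cosh_two_mul, Real.cosh_sq]
      ring_nf
    refine (sq_eq_sq₀ (Real.sinh_nonneg_iff.2 (by positivity)) (by positivity)).1 ?_
    rw [div_pow, Real.sq_sqrt hw.le]
    have : 2 * q ^ 2 / w = 2 * (q ^ 2 / w) := by ring
    linarith
  have hch : Real.cosh (d / 2) = √(w + q ^ 2) / √w := by
    refine (sq_eq_sq₀ (Real.cosh_pos _).le (by positivity)).1 ?_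
    rw [Real.cosh_sq, hsh, div_pow, div_pow, Real.sq_sqrt hw.le, Real.sq_sqrt (by positivity)]
    field_simp
    ring
  constructor
  · have := sinh_le_mul_cosh (show 0 ≤ d / 2 by positivity)
    rw [hsh, hch, ← mul_div_assoc, div_le_div_iff_of_pos_right (Real.sqrt_pos.2 hw)] at this
    rw [div_mul_eq_mul_div, div_le_iff₀ (Real.sqrt_pos.2 (by positivity))]
    linarith
  · have := Real.self_le_sinh_iff.2 (show 0 ≤ d / 2 by positivity)
    rw [hsh] at this
    rw [div_mul_eq_mul_div, mul_div_assoc]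
    linarith

/-- The total geodesic curvature `∫ 2 / ((1 + x²) √(1 + x² / k²))` of the arc of a cycle of
curvature `k` inside a perpendicular circle of radius `arsinh s`, as a function of `k` and
`X = k * s`. -/
noncomputable def arcTurn (k X : ℝ) : ℝ := ∫ x in (0)..X, 2 / ((1 + x ^ 2) * √(1 + (x / k) ^ 2))

lemma integral_speed_eq_arcTurn {k s : ℝ} (hk : 0 < k) :
    k * ∫ u in (-(s / (√(1 + s ^ 2) + √(1 + k ^ 2 * s ^ 2))))..(s / (√(1 + s ^ 2) +
      √(1 + k ^ 2 * s ^ 2))), 2 / (1 + (k ^ 2 - 1) * u ^ 2) = arcTurn k (k * s) := by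
  let A : ℝ → ℝ := fun x => √(1 + (x / k) ^ 2)
  let B : ℝ → ℝ := fun x => √(1 + x ^ 2)
  let f : ℝ → ℝ := fun x => x / k / (A x + B x)
  let f' : ℝ → ℝ := fun x => 1 / k / (A x * B x * (A x + B x))
  have hA : ∀ x, 0 < A x := fun x => Real.sqrt_pos.2 (by positivity)
  have hB : ∀ x, 0 < B x := fun x => Real.sqrt_pos.2 (by positivity)
  have hA2 : ∀ x, A x ^ 2 = 1 + (x / k) ^ 2 := fun x => Real.sq_sqrt (by positivity)
  have hB2 : ∀ x, B x ^ 2 = 1 + x ^ 2 := fun x => Real.sq_sqrt (by positivity)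
  have hAc : Continuous A := by fun_prop
  have hBc : Continuous B := by fun_prop
  have hAB : ∀ x, (B x - A x) * (A x + B x) = (k ^ 2 - 1) * (x / k) ^ 2 := fun x => by
    have : (k * (x / k)) = x := by field_simp
    linear_combination hB2 x - hA2 x + (-x - k * (x / k)) * this
  have hden : ∀ x, 1 + (k ^ 2 - 1) * f x ^ 2 = 2 * B x / (A x + B x) := fun x => by
    have h1 := hA x
    have h2 := hB x
    simp only [f, div_pow _ (A x + B x)]
    rw [← mul_div_assoc, ← hAB]
    field_simp
    ring
  have hderiv : ∀ x, HasDerivAt f (f' x) x := by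
    intro x
    have h1 := hA x
    have h2 := hB x
    have dA : HasDerivAt A (2 * (x / k) * (1 / k) / (2 * A x)) x := by
      have : HasDerivAt (fun x : ℝ => 1 + (x / k) ^ 2) (2 * (x / k) * (1 / k)) x := by
        simpa using (((hasDerivAt_id x).div_const k).pow 2).const_add 1
      exact this.sqrt (by positivity)
    have dB : HasDerivAt B (2 * x / (2 * B x)) x := by
      have : HasDerivAt (fun x : ℝ => 1 + x ^ 2) (2 * x) x := by
        simpa using ((hasDerivAt_id x).pow 2).const_add 1
      exact this.sqrt (by positivity)
    have := ((hasDerivAt_id x).div_const k).div (dA.add dB) (add_pos h1 h2).ne'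
    refine this.congr_deriv ?_
    simp only [f', Pi.add_apply, id]
    have e1 := hA2 x
    have e2 := hB2 x
    generalize A x = a at *
    generalize B x = b at *
    field_simp at e1 ⊢
    linear_combination b * e1 + a * k ^ 2 * e2
  have hfc : Continuous f' := by
    have : ∀ x, A x * B x * (A x + B x) ≠ 0 := fun x => by
      have h1 := hA x
      have h2 := hB x
      positivity
    fun_prop (disch := assumption)
  have hsub := intervalIntegral.integral_comp_mul_deriv' (a := -(k * s)) (b := k * s) (f := f)
    (f' := f') (g := fun u => 2 / (1 + (k ^ 2 - 1) * u ^ 2)) (fun x _ => hderiv x)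
    hfc.continuousOn (by
      rintro _ ⟨x, -, rfl⟩
      apply ContinuousAt.continuousWithinAt
      have : 1 + (k ^ 2 - 1) * f x ^ 2 ≠ 0 := by
        rw [hden]
        have h1 := hA x
        have h2 := hB x
        positivity
      fun_prop (disch := assumption))
  have hfs : f (k * s) = s / (√(1 + s ^ 2) + √(1 + k ^ 2 * s ^ 2)) := by
    simp only [f, A, B, mul_pow, mul_div_cancel_left₀ _ hk.ne']
  have hfneg : f (-(k * s)) = -f (k * s) := by
    simp only [f, A, B, neg_sq, neg_div]
  rw [← hfs, ← hfneg, ← hsub, ← intervalIntegral.integral_const_mul]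
  let h : ℝ → ℝ := fun x => 1 / ((1 + x ^ 2) * √(1 + (x / k) ^ 2))
  have hh : ∀ x, k * (((fun u => 2 / (1 + (k ^ 2 - 1) * u ^ 2)) ∘ f) x * f' x) = h x := fun x => by
    have h1 := hA x
    have h2 := hB x
    simp only [Function.comp, hden, f', h]
    rw [← hB2]
    change _ = 1 / (B x ^ 2 * A x)
    field_simp
  simp only [hh]
  have hc : Continuous h := by
    have : ∀ x : ℝ, (1 + x ^ 2) * √(1 + (x / k) ^ 2) ≠ 0 := fun x => by positivity
    fun_prop (disch := assumption)
  rw [← intervalIntegral.integral_add_adjacent_intervals (b := 0) (hc.intervalIntegrable _ _)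
    (hc.intervalIntegrable _ _)]
  have : ∫ x in (-(k * s))..0, h x = ∫ x in (0)..(k * s), h x := by
    have := intervalIntegral.integral_comp_neg (a := 0) (b := k * s) h
    rw [neg_zero] at this
    rw [← this]
    congr 1
    ext x
    simp only [h, neg_sq, neg_div]
  rw [this, ← two_mul, ← intervalIntegral.integral_const_mul, arcTurn]
  congr 1
  ext x
  simp only [h]
  ring

lemma HypFrame.arc_length (F : HypFrame) {k s : ℝ} (hk : 0 < k) (hs : 0 < s) {β : ℂ}
    (hβ : ‖β‖ ^ 2 = 1 + k ^ 2 * s ^ 2) :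
    k * (μH[1] : Measure ℍ).real
      {z | F.form (k * √(1 + s ^ 2)) β z = k ∧ F.time z ≤ √(1 + s ^ 2)} = arcTurn k (k * s) := by
  rw [← integral_speed_eq_arcTurn hk]
  obtain ⟨u₀, hu₀⟩ : ∃ u₀, u₀ = s / (√(1 + s ^ 2) + √(1 + k ^ 2 * s ^ 2)) := ⟨_, rfl⟩
  obtain ⟨γ, hγ, himg⟩ := F.exists_arc_param hk hs hβ hu₀
  rw [← himg, ← hu₀]
  have hu0 : 0 < u₀ := by rw [hu₀]; positivity
  have hw : ∀ u ∈ Set.Icc (-u₀) u₀, 0 < 1 + (k ^ 2 - 1) * u ^ 2 := fun u hu =>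
    (one_sub_curvature_mul_sq hk hs (hu₀ ▸ abs_le.2 hu)).1
  obtain ⟨w, hwdef⟩ : ∃ w : ℝ → ℝ, w = fun u => 1 + (k ^ 2 - 1) * u ^ 2 := ⟨_, rfl⟩
  have hw' : ∀ u ∈ Set.Icc (-u₀) u₀, 0 < w u := by simpa [hwdef] using hw
  have hwc : Continuous w := by rw [hwdef]; fun_prop
  have hbd : ∀ u ∈ Set.Icc (-u₀) u₀, ∀ v ∈ Set.Icc (-u₀) u₀,
      2 / √(w u * w v + (u - v) ^ 2) * |u - v| ≤ dist (γ u) (γ v) ∧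
      dist (γ u) (γ v) ≤ 2 / √(w u * w v) * |u - v| := by
    intro u hu v hv
    rw [← sq_abs (u - v)]
    apply dist_bounds_of_cosh_eq dist_nonneg (abs_nonneg _) (mul_pos (hw' u hu) (hw' v hv))
    rw [hγ u hu v hv, sq_abs, hwdef]
  obtain ⟨δ, hδ, hδw⟩ : ∃ δ, 0 < δ ∧ ∀ u ∈ Set.Icc (-u₀) u₀, δ ≤ w u := by
    obtain ⟨x, hx, hmin⟩ := isCompact_Icc.exists_isMinOn
      (Set.nonempty_Icc.2 (show -u₀ ≤ u₀ by linarith)) hwc.continuousOn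
    exact ⟨w x, hw' x hx, fun u hu => hmin hu⟩
  have hdiag : ∀ t ∈ Set.Icc (-u₀) u₀, √(w t * w t) = w t := fun t ht =>
    Real.sqrt_mul_self (hw' t ht).le
  congr 1
  apply hausdorffMeasure_curve (lo := fun p => 2 / √(w p.1 * w p.2 + (p.1 - p.2) ^ 2))
    (hi := fun p => 2 / √(w p.1 * w p.2)) (M := 2 / δ) (by linarith)
  · intro u hu
    apply ContinuousAt.continuousWithinAt
    have := (hw u hu).ne'
    fun_prop (disch := assumption)
  · intro u hu
    have := hw u hu
    positivity
  · intro u hu v hv huv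
    have := (hbd u hu v hv).1
    rw [huv, dist_self] at this
    by_contra hne
    have h1 : 0 < |u - v| := abs_pos.2 (sub_ne_zero.2 hne)
    have h2 : 0 < w u * w v + (u - v) ^ 2 := add_pos_of_pos_of_nonneg
      (mul_pos (hw' u hu) (hw' v hv)) (sq_nonneg _)
    have : 0 < 2 / √(w u * w v + (u - v) ^ 2) * |u - v| := by positivity
    linarith
  · exact fun u hu v hv => (hbd u hu v hv).1
  · exact fun u hu v hv => (hbd u hu v hv).2
  · intro u hu v hv
    have h1 : δ * δ ≤ w u * w v := mul_le_mul (hδw u hu) (hδw v hv) hδ.le (hw' u hu).le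
    have h2 : δ ≤ √(w u * w v) := by
      rw [← Real.sqrt_mul_self hδ.le]
      exact Real.sqrt_le_sqrt h1
    dsimp only
    gcongr
  · intro t ht
    have h0 := hdiag t ht
    have h1 := hw' t ht
    have : 2 / (1 + (k ^ 2 - 1) * t ^ 2) = (fun p : ℝ × ℝ =>
        2 / √(w p.1 * w p.2 + (p.1 - p.2) ^ 2)) (t, t) := by
      simp only [sub_self, ne_eq, OfNat.ofNat_ne_zero, not_false_eq_true, zero_pow, add_zero, h0]
      rw [hwdef]
    rw [this]
    apply ContinuousAt.tendsto
    apply ContinuousAt.div continuousAt_const (by fun_prop)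
    simp only [sub_self, ne_eq, OfNat.ofNat_ne_zero, not_false_eq_true, zero_pow, add_zero, h0]
    exact h1.ne'
  · intro t ht
    have h0 := hdiag t ht
    have h1 := hw' t ht
    have : 2 / (1 + (k ^ 2 - 1) * t ^ 2) = (fun p : ℝ × ℝ => 2 / √(w p.1 * w p.2)) (t, t) := by
      simp only [h0]
      rw [hwdef]
    rw [this]
    apply ContinuousAt.tendsto
    apply ContinuousAt.div continuousAt_const (by fun_prop)
    simp only [h0]
    exact h1.ne'

/-! ### Angles at the dual centre -/

/-- Half of the angle under which the arc of a generalized circle of curvature `k` inside the dual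
circle of radius `arsinh s` is seen from the dual centre, as a function of `x = k * s`. -/
noncomputable def halfAngle (x : ℝ) : ℝ := Real.pi / 2 - Real.arctan x

lemma halfAngle_pos (x : ℝ) : 0 < halfAngle x := sub_pos.2 (Real.arctan_lt_pi_div_two x)

lemma halfAngle_lt {x : ℝ} (hx : 0 < x) : halfAngle x < Real.pi / 2 :=
  sub_lt_self _ (Real.arctan_pos.2 hx)

lemma cos_halfAngle (x : ℝ) : Real.cos (halfAngle x) = x / √(1 + x ^ 2) := by
  rw [halfAngle, Real.cos_pi_div_two_sub, Real.sin_arctan]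

lemma sin_halfAngle (x : ℝ) : Real.sin (halfAngle x) = 1 / √(1 + x ^ 2) := by
  rw [halfAngle, Real.sin_pi_div_two_sub, Real.cos_arctan]

lemma ofReal_add_I_eq (x : ℝ) :
    (x : ℂ) + Complex.I = √(1 + x ^ 2) * Complex.exp (halfAngle x * Complex.I) := by
  have h : √(1 + x ^ 2) ≠ 0 := by positivity
  apply Complex.ext
  · rw [Complex.re_ofReal_mul, Complex.exp_ofReal_mul_I_re, cos_halfAngle]
    simp; field_simp
  · rw [Complex.im_ofReal_mul, Complex.exp_ofReal_mul_I_im, sin_halfAngle]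
    simp; field_simp

lemma ofReal_sub_I_eq (x : ℝ) :
    (x : ℂ) - Complex.I = √(1 + x ^ 2) * Complex.exp (-(halfAngle x * Complex.I)) := by
  have := congrArg (starRingEnd ℂ) (ofReal_add_I_eq x)
  rw [map_add, map_mul, ← Complex.exp_conj, map_mul, Complex.conj_I, Complex.conj_ofReal,
    Complex.conj_ofReal, Complex.conj_ofReal] at this
  rw [sub_eq_add_neg, this]
  ring_nf

lemma inner_exp_mul_I (c r ψ θ : ℝ) : inner ℝ ((c : ℂ) * Complex.exp (ψ * Complex.I))
    ((r : ℂ) * Complex.exp (θ * Complex.I)) = c * r * Real.cos (θ - ψ) := by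
  rw [inner_complex, Complex.re_ofReal_mul, Complex.re_ofReal_mul, Complex.im_ofReal_mul,
    Complex.im_ofReal_mul, Complex.exp_ofReal_mul_I_re, Complex.exp_ofReal_mul_I_re,
    Complex.exp_ofReal_mul_I_im, Complex.exp_ofReal_mul_I_im, Real.cos_sub]
  ring

lemma exists_int_abs_sub_le {a x : ℝ} (ha : 0 ≤ a) (h : Real.cos a ≤ Real.cos x) :
    ∃ m : ℤ, |x - m * (2 * Real.pi)| ≤ a := by
  refine ⟨round (x / (2 * Real.pi)), ?_⟩
  set m := round (x / (2 * Real.pi))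
  have hπ := Real.pi_pos
  have h1 : |x - m * (2 * Real.pi)| ≤ Real.pi := by
    have h2 := abs_sub_round (x / (2 * Real.pi))
    have h3 : x - m * (2 * Real.pi) = (x / (2 * Real.pi) - m) * (2 * Real.pi) := by field_simp
    rw [h3, abs_mul, abs_of_pos (show 0 < 2 * Real.pi by positivity)]
    nlinarith
  by_contra hlt
  have := Real.cos_lt_cos_of_nonneg_of_le_pi ha h1 (not_le.1 hlt)
  rw [Real.cos_abs, Real.cos_sub_int_mul_two_pi] at this
  linarith

/-- The polar angles of points in the disk of a cycle perpendicular to the dual circle are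
bounded by `halfAngle`, with equality only on the dual circle. -/
lemma HypFrame.exists_int_of_form_le {F : HypFrame} {k s ψ : ℝ} (hk : 0 < k) (hs : 0 < s) {z : ℍ}
    (h : F.form (k * √(1 + s ^ 2)) (√(1 + (k * s) ^ 2) * Complex.exp (ψ * Complex.I)) z ≤ k) :
    F.pos z ≠ 0 ∧ ∃ m : ℤ, |(F.pos z).arg - ψ - m * (2 * Real.pi)| ≤ halfAngle (k * s) := by
  have hsec := (sector_of_form_le hk h).1
  have hz : F.pos z ≠ 0 := by
    intro h0
    have ht : F.time z = 1 := by rw [F.time_eq_sqrt, h0]; simp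
    rw [form, h0, inner_zero_right, sub_zero, ht, mul_one] at h
    have : 1 < √(1 + s ^ 2) := Real.lt_sqrt_of_sq_lt (by linarith [pow_pos hs 2])
    nlinarith
  refine ⟨hz, exists_int_abs_sub_le (halfAngle_pos _).le ?_⟩
  have hr := norm_pos_iff.2 hz
  rw [← Complex.norm_mul_exp_arg_mul_I (F.pos z), inner_exp_mul_I,
    Complex.norm_mul_exp_arg_mul_I] at hsec
  rw [cos_halfAngle, div_le_iff₀ (by positivity)]
  refine le_of_mul_le_mul_right ?_ hr
  linarith

section Directions

variable {m : ℕ} (a : Fin (m + 3) → ℝ)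

/-- The polar angle of the `j`-th tangency point, if the arc of the generalized circle `i`
has angle `2 * a i`, measured from the tangency point `0`. -/
noncomputable def dirAngle (j : ℕ) : ℝ := ∑ l ∈ Finset.range j, 2 * a (Fin.ofNat (m + 3) (l + 1))

lemma dirAngle_zero : dirAngle a 0 = 0 := by simp [dirAngle]

lemma dirAngle_succ (j : ℕ) :
    dirAngle a (j + 1) = dirAngle a j + 2 * a (Fin.ofNat (m + 3) (j + 1)) := by
  rw [dirAngle, Finset.sum_range_succ, dirAngle]

lemma dirAngle_strictMono (ha : ∀ i, 0 < a i) : StrictMono (dirAngle a) :=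
  strictMono_nat_of_lt_succ fun j => by
    rw [dirAngle_succ]
    linarith [ha (Fin.ofNat (m + 3) (j + 1))]

lemma ofNat_succ (j : ℕ) : Fin.ofNat (m + 3) (j + 1) = Fin.ofNat (m + 3) j + 1 := by
  apply Fin.ext
  simp [Fin.val_add]

lemma dirAngle_card : dirAngle a (m + 3) = 2 * ∑ i, a i := by
  rw [dirAngle, ← Finset.mul_sum, ← Equiv.sum_comp (Equiv.addRight (1 : Fin (m + 3))) a,
    Finset.sum_range]
  congr 1

end Directions

lemma step_iff (x : ℝ) (p q : ℂ) : q * (x - Complex.I) = p * (x + Complex.I) ↔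
    q = p * Complex.exp ((2 * halfAngle x : ℝ) * Complex.I) := by
  have h : (√(1 + x ^ 2) : ℂ) ≠ 0 := by
    exact_mod_cast (show √(1 + x ^ 2) ≠ 0 by positivity)
  have he : Complex.exp ((2 * halfAngle x : ℝ) * Complex.I) =
      Complex.exp (halfAngle x * Complex.I) * Complex.exp (halfAngle x * Complex.I) := by
    rw [← Complex.exp_add]; congr 1; push_cast; ring
  have h1 := Complex.exp_ne_zero (halfAngle x * Complex.I)
  rw [ofReal_add_I_eq, ofReal_sub_I_eq, he, Complex.exp_neg]
  field_simp

namespace PolygonPacking.StandardPosition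

variable {m : ℕ} {Q : PolygonPacking (m + 3)} {F : HypFrame} {k : Fin (m + 3) → ℝ} {s : ℝ}
  {p : Fin (m + 3) → ℂ}

lemma pos_radius (h : Q.StandardPosition F k s p) : 0 < s :=
  h.sinh_radius ▸ Real.sinh_pos_iff.2 Q.dualRadius_pos

lemma pos_curvature (h : Q.StandardPosition F k s p) (i : Fin (m + 3)) : 0 < k i :=
  h.curvature_eq i ▸ (Q.circle i).curvature_pos

lemma dir_eq (h : Q.StandardPosition F k s p) (hp : p 0 = 1) (j : ℕ) : p (Fin.ofNat (m + 3) j) =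
    Complex.exp (dirAngle (fun i => halfAngle (k i * s)) j * Complex.I) := by
  induction j with
  | zero => rw [dirAngle_zero]; simp [hp]
  | succ j ih =>
    have hst := h.step (Fin.ofNat (m + 3) j)
    rw [finRotate_apply, ← ofNat_succ, ← Complex.ofReal_mul, step_iff, ih, ← Complex.exp_add] at hst
    rw [hst, dirAngle_succ]
    congr 1
    push_cast
    ring

lemma coeff_eq (h : Q.StandardPosition F k s p) (hp : p 0 = 1) (j : ℕ) :
    p (Fin.ofNat (m + 3) j) * (k (Fin.ofNat (m + 3) j) * s - Complex.I) =
    √(1 + (k (Fin.ofNat (m + 3) j) * s) ^ 2) *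
      Complex.exp ((dirAngle (fun i => halfAngle (k i * s)) j -
        halfAngle (k (Fin.ofNat (m + 3) j) * s) : ℝ) * Complex.I) := by
  rw [h.dir_eq hp, ← Complex.ofReal_mul, ofReal_sub_I_eq, mul_left_comm, ← Complex.exp_add]
  congr 2
  push_cast
  ring

/-- The arcs of the generalized circles together are seen under a full angle from the dual
centre. They could only go round more than once if one of the disks contained the tangency point
`0` besides the two disks that touch there. -/
lemma sum_halfAngle (h : Q.StandardPosition F k s p) (hp : p 0 = 1) :
    ∑ i, halfAngle (k i * s) = Real.pi := by
  have hs := h.pos_radius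
  have hk := h.pos_curvature
  set a : Fin (m + 3) → ℝ := fun i => halfAngle (k i * s) with hadef
  have ha0 : ∀ i, 0 < a i := fun i => halfAngle_pos _
  have ha1 : ∀ i, a i < Real.pi / 2 := fun i => halfAngle_lt (mul_pos (hk i) hs)
  have hπ := Real.pi_pos
  have hmono := dirAngle_strictMono a ha0
  have hcard := dirAngle_card a
  obtain ⟨N, hN⟩ : ∃ N : ℤ, dirAngle a (m + 3) = N * (2 * Real.pi) := by
    have h1 := h.dir_eq hp (m + 3)
    have h0 : Fin.ofNat (m + 3) (m + 3) = 0 := by apply Fin.ext; simp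
    rw [h0, hp] at h1
    obtain ⟨N, hN⟩ := Complex.exp_eq_one_iff.1 h1.symm
    refine ⟨N, ?_⟩
    have h2 : (dirAngle a (m + 3) : ℂ) = ((N * (2 * Real.pi) : ℝ) : ℂ) := by
      apply mul_right_cancel₀ Complex.I_ne_zero
      rw [hN]; push_cast; ring
    exact_mod_cast h2
  have hpos : 0 < dirAngle a (m + 3) := by
    rw [← dirAngle_zero a]; exact hmono (by omega)
  have hN0 : 0 < N := by
    rw [hN] at hpos
    exact_mod_cast (mul_pos_iff_of_pos_right (by positivity)).1 hpos
  have hN1 : N ≤ 1 := by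
    by_contra hlt
    have hN2 : (2 : ℝ) ≤ N := by exact_mod_cast (show (2 : ℤ) ≤ N by omega)
    have hbig : 4 * Real.pi ≤ dirAngle a (m + 3) := by rw [hN]; nlinarith
    have hlast : 2 * Real.pi ≤ dirAngle a (m + 2) := by
      have := dirAngle_succ a (m + 2)
      linarith [ha1 (Fin.ofNat (m + 3) (m + 2 + 1))]
    have hex : ∃ j, 2 * Real.pi ≤ dirAngle a j := ⟨_, hlast⟩
    classical
    obtain ⟨j, hj, hjmin⟩ : ∃ j, 2 * Real.pi ≤ dirAngle a j ∧
        ∀ i < j, dirAngle a i < 2 * Real.pi :=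
      ⟨Nat.find hex, Nat.find_spec hex, fun i hi => not_le.1 (Nat.find_min hex hi)⟩
    have hjle : j ≤ m + 2 := by
      by_contra hlt
      exact absurd hlast (not_le.2 (hjmin _ (by omega)))
    have hj2 : 2 ≤ j := by
      by_contra hlt
      have : dirAngle a j ≤ dirAngle a 1 := hmono.monotone (by omega)
      rw [dirAngle_succ, dirAngle_zero] at this
      linarith [ha1 (Fin.ofNat (m + 3) (0 + 1))]
    obtain ⟨j', rfl⟩ : ∃ j', j = j' + 1 := ⟨j - 1, by omega⟩
    have hj' := hjmin j' (by omega)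
    have hsucc := dirAngle_succ a j'
    have hval : (Fin.ofNat (m + 3) (j' + 1) : ℕ) = j' + 1 := by
      simp only [Fin.val_ofNat]
      exact Nat.mod_eq_of_lt (by omega)
    have hco := h.coeff_eq hp (j' + 1)
    have hdes := h.describes (Fin.ofNat (m + 3) (j' + 1))
    have hcur := h.curvature_eq (Fin.ofNat (m + 3) (j' + 1))
    have hmem : Q.tangency 0 ∈ (Q.circle (Fin.ofNat (m + 3) (j' + 1))).disk := by
      rw [hdes.disk, hco, hcur]
      have ht := h.tangency 0
      rw [hp] at ht
      rw [Set.mem_ofPred_eq, HypFrame.form_dual_point (by simp) ht]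
      have h1 : (1 : ℂ) = ((1 : ℝ) : ℂ) * Complex.exp ((2 * Real.pi : ℝ) * Complex.I) := by
        push_cast; rw [Complex.exp_two_pi_mul_I, mul_one]
      rw [h1, inner_exp_mul_I]
      have hcos : Real.cos (a (Fin.ofNat (m + 3) (j' + 1))) ≤ Real.cos (2 * Real.pi -
          (dirAngle a (j' + 1) - a (Fin.ofNat (m + 3) (j' + 1)))) := by
        rw [← Real.cos_abs (2 * Real.pi - _)]
        apply Real.cos_le_cos_of_nonneg_of_le_pi (abs_nonneg _)
        · linarith [ha1 (Fin.ofNat (m + 3) (j' + 1))]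
        · rw [abs_le]; constructor <;> linarith
      rw [hadef] at hcos
      beta_reduce at hcos
      rw [cos_halfAngle, div_le_iff₀ (by positivity)] at hcos
      have := mul_le_mul_of_nonneg_left hcos hs.le
      linarith
    have hmem0 : Q.tangency 0 ∈ (Q.circle 0).disk ∩ (Q.circle 1).disk := by
      have := Q.tangent 0
      rw [finRotate_apply, zero_add] at this
      rw [this]; rfl
    have hdis := Q.disjoint
    simp only [finRotate_apply] at hdis
    have hj1 : j' = 1 := by
      by_contra hne
      refine Set.disjoint_left.1 (hdis _ 1 ?_ ?_ ?_) hmem hmem0.2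
      · intro he
        have := congrArg Fin.val he
        rw [hval] at this
        simp at this; omega
      · intro he
        have := congrArg Fin.val he
        rw [fin_val_add_one, hval] at this
        simp at this; split_ifs at this; omega
      · intro he
        have := congrArg Fin.val he
        rw [hval, fin_val_add_one] at this
        simp at this; omega
    have hjm : j' + 1 = m + 2 := by
      by_contra hne
      refine Set.disjoint_left.1 (hdis _ 0 ?_ ?_ ?_) hmem hmem0.1
      · intro he
        have := congrArg Fin.val he
        rw [hval] at this
        simp at this
      · intro he
        have := congrArg Fin.val he
        rw [fin_val_add_one, hval] at this
        simp at this; omega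
      · intro he
        have := congrArg Fin.val he
        rw [hval, fin_val_add_one] at this
        simp at this; omega
    have hm : m = 0 := by omega
    subst hm
    rw [hcard, Fin.sum_univ_three] at hbig
    linarith [ha1 0, ha1 1, ha1 2]
  have hNe : N = 1 := by omega
  rw [hNe, hcard] at hN
  push_cast at hN
  linarith

end PolygonPacking.StandardPosition

/-! ### The generalized polygon and its arcs -/

section ArcCoordinates

variable {k s X : ℝ} {p q ξ : ℂ}

lemma inner_mul_coords (hp : ‖p‖ = 1) : (1 + X ^ 2) * inner ℝ q ξ =
    inner ℝ (p * (X - Complex.I)) q * inner ℝ (p * (X - Complex.I)) ξ +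
      inner ℝ (p * (1 + X * Complex.I)) q * inner ℝ (p * (1 + X * Complex.I)) ξ := by
  have hp2 : p.re ^ 2 + p.im ^ 2 = 1 := by rw [← norm_sq_complex, hp]; norm_num
  simp only [inner_complex]
  simp
  linear_combination (-(1 + X ^ 2) * (q.re * ξ.re + q.im * ξ.im)) * hp2

lemma norm_sq_coords (hp : ‖p‖ = 1) : (1 + X ^ 2) * ‖ξ‖ ^ 2 =
    inner ℝ (p * (X - Complex.I)) ξ ^ 2 + inner ℝ (p * (1 + X * Complex.I)) ξ ^ 2 := by
  rw [← real_inner_self_eq_norm_sq, inner_mul_coords hp]; ring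

lemma inner_dir_coords (hp : ‖p‖ = 1) : (1 + X ^ 2) * inner ℝ p ξ =
    X * inner ℝ (p * (X - Complex.I)) ξ + inner ℝ (p * (1 + X * Complex.I)) ξ := by
  have hp2 : p.re ^ 2 + p.im ^ 2 = 1 := by rw [← norm_sq_complex, hp]; norm_num
  simp only [inner_complex]
  simp
  ring

lemma inner_prev_dir_coords (h : p * (X - Complex.I) = q * (X + Complex.I)) :
    (1 + X ^ 2) * inner ℝ q ξ =
      X * inner ℝ (p * (X - Complex.I)) ξ - inner ℝ (p * (1 + X * Complex.I)) ξ := by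
  have h2 : p * (1 + X * Complex.I) = q * (X * Complex.I - 1) := by
    linear_combination Complex.I * h + (p + q) * Complex.I_sq
  rw [h, h2]
  simp only [inner_complex]
  simp
  ring

/-- Directions outside the sector of an arc are further away from a direction in the sector than
one of the end points of the sector. -/
lemma inner_le_of_sector {A B x y r : ℝ} (hX : 0 < X) (hr : 0 ≤ r) (hAB : A ^ 2 + B ^ 2 = 1 + X ^ 2)
    (hxy : (1 + X ^ 2) * r ^ 2 = x ^ 2 + y ^ 2) (hA : A ≤ X) (hx : X * r ≤ x) :
    A * x + B * y ≤ X * x + |y| := by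
  have hx0 : 0 ≤ x := le_trans (by positivity) hx
  have hyr : |y| ≤ r := by
    apply abs_le_of_sq_le_sq _ hr
    have := mul_self_le_mul_self (by positivity) hx
    nlinarith
  have hXy : X * |y| ≤ x := (mul_le_mul_of_nonneg_left hyr hX.le).trans hx
  have hBy : B * y ≤ |B| * |y| := by rw [← abs_mul]; exact le_abs_self _
  have hAx : A * x ≤ X * x := mul_le_mul_of_nonneg_right hA hx0
  have hy0 := abs_nonneg y
  rcases le_total |B| 1 with hB | hB
  · linarith [mul_le_mul_of_nonneg_right hB hy0]
  · have hAy : A * |y| ≤ X * |y| := mul_le_mul_of_nonneg_right hA hy0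
    have h1 : (X + A) * |y| ≤ x * (|B| + 1) := by
      linarith [mul_le_mul_of_nonneg_left hB hx0]
    have h2 := mul_le_mul_of_nonneg_left h1 (sub_nonneg.2 hA)
    have h3 : (|B| - 1) * (|B| + 1) = (X - A) * (X + A) := by
      linear_combination hAB + sq_abs B
    have h4 : (|B| - 1) * |y| ≤ (X - A) * x := by
      refine le_of_mul_le_mul_right ?_ (show 0 < |B| + 1 by positivity)
      calc (|B| - 1) * |y| * (|B| + 1) = (X - A) * ((X + A) * |y|) := by
            linear_combination |y| * h3
        _ ≤ (X - A) * (x * (|B| + 1)) := h2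
        _ = _ := by ring
    linarith

/-- On a cycle perpendicular to the dual circle, the two geodesics through the tangency points cut
out the same arc as the dual circle. -/
lemma time_le_iff_edges {t x y : ℝ} (hs : 0 < s) (ht : 0 < t)
    (hx : k * √(1 + s ^ 2) * t - x = k)
    (hq : (1 + (k * s) ^ 2) * (t ^ 2 - 1) = x ^ 2 + y ^ 2) :
    t ≤ √(1 + s ^ 2) ↔ √(1 + s ^ 2) * (k * s * x + |y|) ≤ s * t * (1 + (k * s) ^ 2) := by
  have hC2 : √(1 + s ^ 2) ^ 2 = 1 + s ^ 2 := Real.sq_sqrt (by positivity)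
  have hC : 0 < √(1 + s ^ 2) := Real.sqrt_pos.2 (by positivity)
  set C := √(1 + s ^ 2)
  obtain ⟨g, hg⟩ : ∃ g, g = (1 - k ^ 2) * t + k ^ 2 * C := ⟨_, rfl⟩
  have e1 : s * t * (1 + (k * s) ^ 2) - C * (k * s * x) = s * g := by
    have : x = k * C * t - k := by linarith
    rw [this, hg]
    linear_combination (-(s * k ^ 2 * t)) * hC2
  have e2 : (t - C) * (g + C) = y ^ 2 - s ^ 2 := by
    have : x ^ 2 = (k * C * t - k) ^ 2 := by rw [show x = k * C * t - k by linarith]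
    rw [hg]
    linear_combination hq + this - (1 - k ^ 2 * t ^ 2 + k ^ 2) * hC2
  have e3 : g - C = (1 - k ^ 2) * (t - C) := by rw [hg]; ring
  have e4 : s ^ 2 * g ^ 2 - C ^ 2 * y ^ 2 = (g + C) * (C - t) * (1 + (k * s) ^ 2) := by
    have e5 : s ^ 2 * ((g + C) * (g - C)) - C ^ 2 * ((t - C) * (g + C)) =
        (g + C) * (C - t) * (C ^ 2 - s ^ 2 + (k * s) ^ 2) := by rw [e3]; ring
    rw [e2] at e5
    linear_combination e5 + (g + C) * (C - t) * hC2
  have hD : 0 < 1 + (k * s) ^ 2 := by positivity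
  constructor
  · intro htC
    have hg0 : 0 ≤ g := by
      rcases le_total (k ^ 2) 1 with h | h
      · rw [hg]; have := sub_nonneg.2 h; positivity
      · have := mul_nonneg (sub_nonneg.2 h) (sub_nonneg.2 htC)
        linarith
    have h1 : 0 ≤ (g + C) * (C - t) * (1 + (k * s) ^ 2) :=
      mul_nonneg (mul_nonneg (by positivity) (by linarith)) hD.le
    have h2 : |C * y| ≤ s * g := abs_le_of_sq_le_sq (by linarith) (by positivity)
    rw [abs_mul, abs_of_pos hC] at h2
    linarith
  · intro h
    have h2 : C * |y| ≤ s * g := by linarith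
    have hg0 : 0 ≤ g := by
      refine (mul_nonneg_iff_of_pos_left hs).1 (le_trans (by positivity) h2)
    have h3 : (C * |y|) ^ 2 ≤ (s * g) ^ 2 := by gcongr
    rw [mul_pow, sq_abs] at h3
    by_contra hlt
    have := mul_pos (mul_pos (show 0 < g + C by positivity) (sub_pos.2 (not_le.1 hlt))) hD
    linarith

end ArcCoordinates

lemma inner_mul_add_I (κ ε : ℝ) (β p : ℂ) : inner ℝ β (p * (κ + ε * Complex.I)) =
    κ * inner ℝ β p + ε * inner ℝ β (p * Complex.I) := by
  simp only [inner_complex]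
  simp
  ring

namespace PolygonPacking.StandardPosition

variable {m : ℕ} {Q : PolygonPacking (m + 3)} {F : HypFrame} {k : Fin (m + 3) → ℝ} {s : ℝ}
  {p : Fin (m + 3) → ℂ}

lemma describes_succ (h : Q.StandardPosition F k s p) (i : Fin (m + 3)) :
    F.Describes (Q.circle (finRotate _ i)) (k (finRotate _ i) * √(1 + s ^ 2))
      (p i * (k (finRotate _ i) * s + Complex.I)) := by
  rw [← h.step]; exact h.describes _

lemma perpAt_geodesic_iff (h : Q.StandardPosition F k s p) {i : Fin (m + 3)} {C : GenCircle}
    {κ ε α : ℝ} {β : ℂ} (hC : C.curvature = κ) (hε : ε ^ 2 = 1)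
    (hd : F.Describes C (κ * √(1 + s ^ 2)) (p i * (κ * s + ε * Complex.I)))
    (hβ : ‖β‖ ^ 2 - α ^ 2 = 1) :
    PerpAt {z | F.form α β z = 0} C.carrier (Q.tangency i) ↔
      α * √(1 + s ^ 2) = s * inner ℝ β (p i) ∧ inner ℝ β (p i * Complex.I) = 0 := by
  have hp2 : (p i).re ^ 2 + (p i).im ^ 2 = 1 := by
    rw [← norm_sq_complex, h.norm_dir]; norm_num
  have ht := h.tangency i
  have hC2 : √(1 + s ^ 2) ^ 2 = 1 + s ^ 2 := Real.sq_sqrt (by positivity)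
  have htime : F.time (Q.tangency i) = √(1 + s ^ 2) := by
    rw [F.time_eq_sqrt, ht, norm_mul, h.norm_dir, mul_one, Complex.norm_real, Real.norm_eq_abs,
      sq_abs]
  have hin : ∀ γ : ℂ, inner ℝ γ (s * p i) = s * inner ℝ γ (p i) := by
    intro γ
    simp only [inner_complex]; simp; ring
  have h1 : F.form (κ * √(1 + s ^ 2)) (p i * (κ * s + ε * Complex.I)) (Q.tangency i) = κ := by
    rw [HypFrame.form_dual_point (h.norm_dir i) ht, inner_complex]
    simp
    linear_combination (-(κ * s ^ 2)) * hp2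
  have hdisc := hd.disc
  rw [hC] at hdisc
  rw [hd.carrier, hC, F.perpAt_form_iff (by rw [hβ]; norm_num) hdisc]
  have h2 : F.form α β (Q.tangency i) = α * √(1 + s ^ 2) - s * inner ℝ β (p i) := by
    rw [HypFrame.form, htime, ht, hin]
  have h3 := inner_mul_add_I (κ * s) ε β (p i)
  push_cast at h3
  rw [h2, h3]
  constructor
  · rintro ⟨h4, -, h5⟩
    refine ⟨by linarith, ?_⟩
    linear_combination ε * h5 + ε * κ * h4 - inner ℝ β (p i * Complex.I) * hε
  · rintro ⟨h4, h5⟩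
    refine ⟨by linarith, h1, ?_⟩
    linear_combination (-κ) * h4 + ε * h5

lemma edgeLine_eq (h : Q.StandardPosition F k s p) {i : Fin (m + 3)} {g : SL(2, ℝ)}
    (hg : Q.IsEdgeLine i g) :
    geodesicLine g = {z | F.form s (√(1 + s ^ 2) * p i) z = 0} ∧
      halfPlane g = {z | 0 ≤ F.form s (√(1 + s ^ 2) * p i) z} := by
  obtain ⟨α, β, hβ, h1, h2⟩ := F.exists_form_geodesicLine g
  have hs := h.pos_radius
  have hp2 : (p i).re ^ 2 + (p i).im ^ 2 = 1 := by
    rw [← norm_sq_complex, h.norm_dir]; norm_num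
  have hC2 : √(1 + s ^ 2) ^ 2 = 1 + s ^ 2 := Real.sq_sqrt (by positivity)
  have hC : 0 < √(1 + s ^ 2) := Real.sqrt_pos.2 (by positivity)
  have hd := h.describes i
  have hc : 0 ≤ α := by
    have := hg.2.2
    rw [h2, ← h.center_eq, Set.mem_ofPred_eq, HypFrame.form, F.time_center, F.pos_center,
      inner_zero_right] at this
    linarith
  have hperp := hg.1
  rw [h1, h.perpAt_geodesic_iff (ε := -1) (h.curvature_eq i) (by norm_num) (by
    simpa [sub_eq_add_neg] using hd) hβ] at hperp
  obtain ⟨h3, h4⟩ := hperp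
  set C := √(1 + s ^ 2)
  obtain ⟨x, hx⟩ : ∃ x, x = inner ℝ β (p i) := ⟨_, rfl⟩
  have hβx : β = x * p i := by
    rw [hx]
    rw [inner_complex] at h4 ⊢
    simp at h4
    apply Complex.ext
    · simp
      linear_combination (-β.re) * hp2 - (p i).im * h4
    · simp
      linear_combination (-β.im) * hp2 + (p i).re * h4
  rw [← hx] at h3
  have hx2 : x ^ 2 - α ^ 2 = 1 := by
    rw [← hβ, hβx, norm_mul, h.norm_dir, mul_one, Complex.norm_real, Real.norm_eq_abs, sq_abs]
  have hxs : α ^ 2 = s ^ 2 := by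
    have h5 : α ^ 2 * C ^ 2 = s ^ 2 * x ^ 2 := by rw [← mul_pow, h3, mul_pow]
    linear_combination h5 - α ^ 2 * hC2 + s ^ 2 * hx2
  have hα : α = s := (sq_eq_sq₀ hc hs.le).1 hxs
  have hxC : x = C := by
    rw [hα] at h3
    exact (mul_left_cancel₀ hs.ne' h3).symm
  rw [h1, h2, hβx, hα, hxC]
  exact ⟨rfl, rfl⟩

lemma exists_edgeLine (h : Q.StandardPosition F k s p) (i : Fin (m + 3)) :
    ∃ g, Q.IsEdgeLine i g := by
  have hs := h.pos_radius
  have hp2 : (p i).re ^ 2 + (p i).im ^ 2 = 1 := by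
    rw [← norm_sq_complex, h.norm_dir]; norm_num
  have hC2 : √(1 + s ^ 2) ^ 2 = 1 + s ^ 2 := Real.sq_sqrt (by positivity)
  have hdisc : ‖√(1 + s ^ 2) * p i‖ ^ 2 - s ^ 2 = 1 := by
    rw [norm_mul, h.norm_dir, mul_one, Complex.norm_real, Real.norm_eq_abs, sq_abs, hC2]; ring
  obtain ⟨g, h1, h2⟩ := F.exists_geodesicLine hdisc
  have hcond : s * √(1 + s ^ 2) = s * inner ℝ (√(1 + s ^ 2) * p i) (p i) ∧
      inner ℝ (√(1 + s ^ 2) * p i) (p i * Complex.I) = 0 := by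
    simp only [inner_complex]
    simp
    constructor
    · left; linear_combination (-√(1 + s ^ 2)) * hp2
    · ring
  refine ⟨g, ?_, ?_, ?_⟩
  · rw [h1, h.perpAt_geodesic_iff (ε := -1) (h.curvature_eq i) (by norm_num) (by
      simpa [sub_eq_add_neg] using h.describes i) hdisc]
    exact hcond
  · rw [h1, h.perpAt_geodesic_iff (ε := 1) (h.curvature_eq _) (by norm_num) (by
      simpa using h.describes_succ i) hdisc]
    exact hcond
  · rw [h2, ← h.center_eq, Set.mem_ofPred_eq, HypFrame.form, F.time_center, F.pos_center,
      inner_zero_right]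
    linarith

lemma polygon_eq (h : Q.StandardPosition F k s p) : Q.polygon =
    {z | (∀ i, 0 ≤ F.form s (√(1 + s ^ 2) * p i) z) ∧
      ∀ i, 0 ≤ F.form (k i * √(1 + s ^ 2)) (p i * (k i * s - Complex.I)) z} := by
  ext z
  refine and_congr ⟨?_, ?_⟩ (forall_congr' fun i => by rw [(h.describes i).axisSide]; rfl)
  · intro hz i
    obtain ⟨g, hg⟩ := h.exists_edgeLine i
    have := hz i g hg
    rwa [(h.edgeLine_eq hg).2] at this
  · intro hz i g hg
    rw [(h.edgeLine_eq hg).2]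
    exact hz i

lemma edge_eq (h : Q.StandardPosition F k s p) (i : Fin (m + 3)) : Q.edge i =
    {z | z ∈ Q.polygon ∧ F.form s (√(1 + s ^ 2) * p i) z = 0} := by
  ext z
  refine and_congr_right fun _ => ⟨?_, ?_⟩
  · rintro ⟨g, hg, hz⟩
    rwa [(h.edgeLine_eq hg).1] at hz
  · intro hz
    obtain ⟨g, hg⟩ := h.exists_edgeLine i
    exact ⟨g, hg, by rw [(h.edgeLine_eq hg).1]; exact hz⟩

/-- Every generalized disk lies outside the interiors of all the others. -/
lemma curvature_le_form (h : Q.StandardPosition F k s p) {i j : Fin (m + 3)} (hij : i ≠ j) {z : ℍ}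
    (hz : z ∈ (Q.circle j).disk) :
    k i ≤ F.form (k i * √(1 + s ^ 2)) (p i * (k i * s - Complex.I)) z := by
  by_contra hlt
  have hlt := not_le.1 hlt
  have hmem : z ∈ (Q.circle i).disk := by
    rw [(h.describes i).disk, h.curvature_eq]; exact hlt.le
  have hcar : ∀ l, Q.tangency l ∈ (Q.circle l).carrier ∧
      Q.tangency l ∈ (Q.circle (finRotate _ l)).carrier := fun l =>
    ⟨(Q.dual_perp l).1.2.1, (Q.dual_perp l).2.2.1⟩
  have hnot : z ∉ (Q.circle i).carrier := by
    rw [(h.describes i).carrier, h.curvature_eq]; exact hlt.ne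
  by_cases h1 : j = finRotate _ i
  · subst h1
    have : z ∈ (Q.circle i).disk ∩ (Q.circle (finRotate _ i)).disk := ⟨hmem, hz⟩
    rw [Q.tangent i] at this
    exact hnot (this ▸ (hcar i).1)
  by_cases h2 : i = finRotate _ j
  · subst h2
    have : z ∈ (Q.circle j).disk ∩ (Q.circle (finRotate _ j)).disk := ⟨hz, hmem⟩
    rw [Q.tangent j] at this
    exact hnot (this ▸ (hcar j).2)
  · exact Set.disjoint_left.1 (Q.disjoint i j hij h1 h2) hmem hz

/-- The direction of a tangency point is never inside the sector of a generalized circle. -/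
lemma inner_coeff_le (h : Q.StandardPosition F k s p) (i j : Fin (m + 3)) :
    inner ℝ (p i * (k i * s - Complex.I)) (p j) ≤ k i * s := by
  have hs := h.pos_radius
  have : k i ≤ F.form (k i * √(1 + s ^ 2)) (p i * (k i * s - Complex.I)) (Q.tangency j) := by
    have hmem : Q.tangency j ∈ (Q.circle j).disk ∩ (Q.circle (finRotate _ j)).disk := by
      rw [Q.tangent]; rfl
    by_cases hij : i = j
    · refine h.curvature_le_form ?_ hmem.2
      rw [hij, finRotate_apply]
      simp
    · exact h.curvature_le_form hij hmem.1
  rw [HypFrame.form_dual_point (h.norm_dir j) (h.tangency j)] at this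
  refine le_of_mul_le_mul_left ?_ hs
  linarith

/-- The part of the `i`-th generalized circle in the generalized polygon is its part inside the
dual circle. -/
lemma carrier_inter_polygon (h : Q.StandardPosition F k s p) (i : Fin (m + 3)) :
    (Q.circle i).carrier ∩ Q.polygon =
      {z | F.form (k i * √(1 + s ^ 2)) (p i * (k i * s - Complex.I)) z = k i ∧
        F.time z ≤ √(1 + s ^ 2)} := by
  have hs := h.pos_radius
  have hk := h.pos_curvature i
  have hC : 0 < √(1 + s ^ 2) := Real.sqrt_pos.2 (by positivity)
  rw [(h.describes i).carrier, h.curvature_eq, h.polygon_eq]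
  ext z
  simp only [Set.mem_inter_iff, Set.mem_ofPred_eq]
  refine and_congr_right fun hz => ?_
  have ht := F.time_pos z
  set x := inner ℝ (p i * ((k i * s : ℝ) - Complex.I)) (F.pos z) with hx
  set y := inner ℝ (p i * (1 + (k i * s : ℝ) * Complex.I)) (F.pos z) with hy
  have hX : 0 < k i * s := mul_pos hk hs
  have hD : 0 < 1 + (k i * s) ^ 2 := by positivity
  have hnorm := norm_sq_coords (X := k i * s) (ξ := F.pos z) (h.norm_dir i)
  have hform : k i * √(1 + s ^ 2) * F.time z - x = k i := by
    rw [hx]; push_cast; exact hz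
  have hedge : ∀ q : ℂ, 0 ≤ F.form s (√(1 + s ^ 2) * q) z ↔ √(1 + s ^ 2) *
      ((1 + (k i * s) ^ 2) * inner ℝ q (F.pos z)) ≤ s * F.time z * (1 + (k i * s) ^ 2) := by
    intro q
    have : inner ℝ (√(1 + s ^ 2) * q) (F.pos z) = √(1 + s ^ 2) * inner ℝ q (F.pos z) := by
      simp only [inner_complex]; simp; ring
    rw [HypFrame.form, this, sub_nonneg, ← mul_le_mul_iff_of_pos_right hD]
    ring_nf
  have hiff := time_le_iff_edges hs ht hform (y := y) (by
    rw [F.time_sq]; linear_combination hnorm)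
  obtain ⟨j, hj⟩ : ∃ j, finRotate _ j = i := (finRotate (m + 3)).surjective i
  have hprev : p i * ((k i * s : ℝ) - Complex.I) = p j * ((k i * s : ℝ) + Complex.I) := by
    have := h.step j
    rw [hj] at this
    push_cast; exact this
  rw [hiff]
  constructor
  · rintro ⟨h1, -⟩
    have hi := (hedge _).1 (h1 i)
    have hj := (hedge _).1 (h1 j)
    rw [inner_dir_coords (h.norm_dir i), ← hx, ← hy] at hi
    rw [inner_prev_dir_coords hprev, ← hx, ← hy] at hj
    rcases abs_cases y with ⟨h, -⟩ | ⟨h, -⟩ <;> rw [h]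
    · exact hi
    · exact hj
  · intro h1
    refine ⟨fun l => ?_, fun l => ?_⟩
    · rw [hedge, inner_mul_coords (h.norm_dir i), ← hx, ← hy]
      refine le_trans (mul_le_mul_of_nonneg_left ?_ hC.le) h1
      refine inner_le_of_sector hX (norm_nonneg (F.pos z)) ?_ hnorm ?_ ?_
      · rw [← norm_sq_coords (h.norm_dir i), h.norm_dir]; ring
      · have := h.inner_coeff_le i l
        push_cast; exact this
      · have := (HypFrame.sector_of_form_le hk hz.le).1
        rw [hx]; push_cast; linarith
    · by_cases hl : l = i
      · rw [hl, hz]; exact hk.le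
      · refine (h.pos_curvature l).le.trans (h.curvature_le_form hl ?_)
        rw [(h.describes i).disk, h.curvature_eq]
        exact hz.le

lemma arcCurvature_eq (h : Q.StandardPosition F k s p) (i : Fin (m + 3)) :
    Q.arcCurvature i = arcTurn (k i) (k i * s) := by
  have hs := h.pos_radius
  rw [PolygonPacking.arcCurvature, h.carrier_inter_polygon, h.curvature_eq,
    setIntegral_const, smul_eq_mul, mul_comm]
  apply F.arc_length (h.pos_curvature i) hs
  have := (h.describes i).disc
  have hC2 : √(1 + s ^ 2) ^ 2 = 1 + s ^ 2 := Real.sq_sqrt (by positivity)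
  rw [h.curvature_eq] at this
  linear_combination this + k i ^ 2 * hC2

end PolygonPacking.StandardPosition

/-! ### Existence of polygon packings -/

section Existence

variable {m : ℕ} {a : Fin (m + 3) → ℝ}

lemma exp_dirAngle_succ (hsum : ∑ i, a i = Real.pi) (i : Fin (m + 3)) :
    Complex.exp (dirAngle a ((finRotate _ i : Fin (m + 3)) : ℕ) * Complex.I) =
      Complex.exp (dirAngle a (i : ℕ) * Complex.I) *
        Complex.exp ((2 * a (finRotate _ i) : ℝ) * Complex.I) := by
  have h : Fin.ofNat (m + 3) ((i : ℕ) + 1) = finRotate _ i := by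
    rw [ofNat_succ, finRotate_apply]; congr 1; apply Fin.ext; simp
  have h1 : Complex.exp (dirAngle a ((finRotate _ i : Fin (m + 3)) : ℕ) * Complex.I) =
      Complex.exp (dirAngle a ((i : ℕ) + 1) * Complex.I) := by
    rw [finRotate_apply, fin_val_add_one]
    split_ifs with hi
    · rw [hi, dirAngle_zero, dirAngle_card, hsum]
      push_cast
      rw [Complex.exp_two_pi_mul_I]; simp
    · rfl
  rw [h1, dirAngle_succ, h, ← Complex.exp_add]
  congr 1
  push_cast
  ring

/-- The sectors of two vertices that are not adjacent are disjoint. -/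
lemma abs_dirAngle_sub_gt (ha : ∀ i, 0 < a i) (hsum : ∑ i, a i = Real.pi) {i j : Fin (m + 3)}
    (hij : i < j) (h1 : j ≠ finRotate _ i) (h2 : i ≠ finRotate _ j) (N : ℤ) :
    a i + a j < |(dirAngle a j - a j) - (dirAngle a i - a i) - N * (2 * Real.pi)| := by
  have hmono := dirAngle_strictMono a ha
  have hcard := dirAngle_card a
  rw [hsum] at hcard
  have hπ := Real.pi_pos
  have hof : ∀ l : Fin (m + 3), Fin.ofNat (m + 3) (l : ℕ) = l := fun l => by apply Fin.ext; simp
  rw [finRotate_apply] at h1 h2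
  have h1' : (i : ℕ) + 1 < j := by
    have h3 : (j : ℕ) ≠ ((i + 1 : Fin (m + 3)) : ℕ) := fun h => h1 (Fin.ext h)
    rw [fin_val_add_one] at h3
    have h4 : (i : ℕ) < j := hij
    have h5 := j.2
    split_ifs at h3 <;> omega
  have hlow : a i + a j < (dirAngle a j - a j) - (dirAngle a i - a i) := by
    obtain ⟨j', hj'⟩ : ∃ j', (j : ℕ) = j' + 1 := ⟨j - 1, by omega⟩
    have h3 := dirAngle_succ a j'
    rw [← hj', hof] at h3
    have h4 : dirAngle a i < dirAngle a j' := hmono (by omega)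
    linarith
  have hhigh : (dirAngle a j - a j) - (dirAngle a i - a i) < 2 * Real.pi - (a i + a j) := by
    by_cases hi : (i : ℕ) = 0
    · have h3 := dirAngle_succ a (m + 2)
      rw [hcard] at h3
      have hi0 : i = 0 := Fin.ext hi
      have h4 : Fin.ofNat (m + 3) (m + 2 + 1) = i := by
        rw [hi0]; apply Fin.ext; simp
      have h5 : (j : ℕ) < m + 2 := by
        have h6 : (i : ℕ) ≠ ((j + 1 : Fin (m + 3)) : ℕ) := fun h => h2 (Fin.ext h)
        rw [fin_val_add_one] at h6
        have h7 := j.2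
        split_ifs at h6 <;> omega
      have h6 := hmono h5
      rw [h4] at h3
      rw [hi, dirAngle_zero]
      linarith
    · obtain ⟨i', hi'⟩ : ∃ i', (i : ℕ) = i' + 1 := ⟨i - 1, by omega⟩
      have h3 := dirAngle_succ a i'
      rw [← hi', hof] at h3
      have h4 : dirAngle a 0 ≤ dirAngle a i' := hmono.monotone (by omega)
      rw [dirAngle_zero] at h4
      have h5 := hmono j.2
      linarith
  rcases le_or_gt N 0 with hN | hN
  · have : (N : ℝ) ≤ 0 := by exact_mod_cast hN
    refine lt_of_lt_of_le ?_ (le_abs_self _)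
    nlinarith
  · have : (1 : ℝ) ≤ N := by exact_mod_cast hN
    refine lt_of_lt_of_le ?_ (neg_le_abs _)
    nlinarith

lemma eq_dual_point {F : HypFrame} {k k' s : ℝ} {p : ℂ} {z : ℍ} (hk : 0 < k) (hk' : 0 < k')
    (hs : 0 < s) (hp : ‖p‖ = 1)
    (h : F.form (k * √(1 + s ^ 2)) (p * (k * s - Complex.I)) z ≤ k)
    (h' : F.form (k' * √(1 + s ^ 2)) (p * (k' * s + Complex.I)) z ≤ k') : F.pos z = s * p := by
  have hp2 : p.re ^ 2 + p.im ^ 2 = 1 := by rw [← norm_sq_complex, hp]; norm_num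
  obtain ⟨h1, h2⟩ := HypFrame.sector_of_form_le hk h
  obtain ⟨h1', -⟩ := HypFrame.sector_of_form_le hk' h'
  have e1 := inner_mul_add_I (k * s) (-1) (F.pos z) p
  have e2 := inner_mul_add_I (k' * s) 1 (F.pos z) p
  rw [real_inner_comm] at h1 h2 h1'
  have e1' : p * (((k * s : ℝ) : ℂ) + ((-1 : ℝ) : ℂ) * Complex.I) = p * (k * s - Complex.I) := by
    push_cast; ring
  have e2' : p * (((k' * s : ℝ) : ℂ) + ((1 : ℝ) : ℂ) * Complex.I) = p * (k' * s + Complex.I) := by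
    push_cast; ring
  rw [e1'] at e1
  rw [e2'] at e2
  rw [e1] at h1 h2
  rw [e2] at h1'
  have hcs := real_inner_le_norm (F.pos z) p
  rw [hp, mul_one] at hcs
  have hle : ‖F.pos z‖ ≤ inner ℝ (F.pos z) p := by
    refine le_of_mul_le_mul_left ?_ (show 0 < (k + k') * s by positivity)
    linarith
  have heq : inner ℝ (F.pos z) p = ‖F.pos z‖ := le_antisymm hcs hle
  rw [heq] at h1 h2 h1'
  have hy : inner ℝ (F.pos z) (p * Complex.I) = 0 := by
    apply le_antisymm <;> linarith
  rw [hy] at h2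
  have hr := h2 (by linarith)
  rw [hr] at heq
  rw [inner_complex] at heq hy
  simp at hy
  apply Complex.ext
  · simp
    linear_combination (-(F.pos z).re) * hp2 + p.re * heq - p.im * hy
  · simp
    linear_combination (-(F.pos z).im) * hp2 + p.im * heq + p.re * hy

theorem exists_polygonPacking {k : Fin (m + 3) → ℝ} (hk : ∀ i, 0 < k i) {s : ℝ} (hs : 0 < s)
    (hsum : ∑ i, halfAngle (k i * s) = Real.pi) :
    ∃ Q : PolygonPacking (m + 3), ∀ i, (Q.circle i).curvature = k i := by
  obtain ⟨a, hadef⟩ : ∃ a : Fin (m + 3) → ℝ, a = fun i => halfAngle (k i * s) := ⟨_, rfl⟩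
  have ha : ∀ i, a i = halfAngle (k i * s) := fun i => by rw [hadef]
  have hsum' : ∑ i, a i = Real.pi := by rw [hadef]; exact hsum
  have ha0 : ∀ i, 0 < a i := fun i => by rw [ha]; exact halfAngle_pos _
  let F : HypFrame := ⟨UpperHalfPlane.I, LinearIsometryEquiv.refl ℝ ℂ⟩
  obtain ⟨p, hpdef⟩ : ∃ p : Fin (m + 3) → ℂ,
      p = fun i : Fin (m + 3) => Complex.exp (dirAngle a (i : ℕ) * Complex.I) := ⟨_, rfl⟩
  have hp : ∀ i, ‖p i‖ = 1 := fun i => by rw [hpdef]; exact Complex.norm_exp_ofReal_mul_I _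
  have hp2 : ∀ i, (p i).re ^ 2 + (p i).im ^ 2 = 1 := fun i => by
    rw [← norm_sq_complex, hp]; norm_num
  have hC2 : √(1 + s ^ 2) ^ 2 = 1 + s ^ 2 := Real.sq_sqrt (by positivity)
  have hstep : ∀ i, p (finRotate _ i) * (k (finRotate _ i) * s - Complex.I) =
      p i * (k (finRotate _ i) * s + Complex.I) := by
    intro i
    rw [← Complex.ofReal_mul, step_iff, ← ha, hpdef]
    exact exp_dirAngle_succ hsum' i
  have hcoeff : ∀ i, p i * (k i * s - Complex.I) = √(1 + (k i * s) ^ 2) *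
      Complex.exp ((dirAngle a i - a i : ℝ) * Complex.I) := by
    intro i
    rw [← Complex.ofReal_mul, ofReal_sub_I_eq, ← ha, hpdef, mul_left_comm, ← Complex.exp_add]
    congr 2
    push_cast
    ring
  have hdisc : ∀ i, ‖p i * (k i * s - Complex.I)‖ ^ 2 - (k i * √(1 + s ^ 2)) ^ 2 =
      1 - k i ^ 2 := by
    intro i
    rw [norm_mul, hp, one_mul, norm_sq_complex]
    simp
    linear_combination (-k i ^ 2) * hC2
  choose C hC hd using fun i => F.exists_genCircle (hk i) (hdisc i)
    (mul_pos (hk i) (Real.sqrt_pos.2 (by positivity)))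
  let t : Fin (m + 3) → ℍ := fun i => F.pos.symm (s * p i)
  have ht : ∀ i, F.pos (t i) = s * p i := fun i => Equiv.apply_symm_apply _ _
  have hd' : ∀ i, F.Describes (C (finRotate _ i)) (k (finRotate _ i) * √(1 + s ^ 2))
      (p i * (k (finRotate _ i) * s + Complex.I)) := by
    intro i
    rw [← hstep]; exact hd _
  have hform : ∀ i (κ ε : ℝ),
      F.form (κ * √(1 + s ^ 2)) (p i * (κ * s + ε * Complex.I)) (t i) = κ := by
    intro i κ ε
    rw [HypFrame.form_dual_point (hp i) (ht i), inner_complex]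
    simp
    linear_combination (-(κ * s ^ 2)) * hp2 i
  have hform1 : ∀ i, F.form (k i * √(1 + s ^ 2)) (p i * (k i * s - Complex.I)) (t i) = k i := by
    intro i
    simpa [sub_eq_add_neg] using hform i (k i) (-1)
  have hform2 : ∀ i, F.form (k (finRotate _ i) * √(1 + s ^ 2))
      (p i * (k (finRotate _ i) * s + Complex.I)) (t i) = k (finRotate _ i) := by
    intro i
    simpa using hform i (k (finRotate _ i)) 1
  have hdisj : ∀ i j, i < j → j ≠ finRotate _ i → i ≠ finRotate _ j →
      Disjoint (C i).disk (C j).disk := by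
    intro i j hij h1 h2
    rw [Set.disjoint_left]
    intro z hzi hzj
    rw [(hd i).disk, hC, hcoeff] at hzi
    rw [(hd j).disk, hC, hcoeff] at hzj
    obtain ⟨-, M, hM⟩ := HypFrame.exists_int_of_form_le (hk i) hs hzi
    obtain ⟨-, N, hN⟩ := HypFrame.exists_int_of_form_le (hk j) hs hzj
    rw [← ha] at hM hN
    have := abs_dirAngle_sub_gt ha0 hsum' hij h1 h2 (M - N)
    rw [abs_le] at hM hN
    refine absurd this (not_lt.2 ?_)
    push_cast
    rw [abs_le]
    constructor <;> linarith
  have har : 0 < Real.arsinh s := Real.arsinh_pos_iff.2 hs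
  have hperp : ∀ i (κ ε : ℝ) (D : GenCircle), ε ^ 2 = 1 → D.curvature = κ →
      F.Describes D (κ * √(1 + s ^ 2)) (p i * (κ * s + ε * Complex.I)) →
      PerpAt (Metric.sphere F.center (Real.arsinh s)) D.carrier (t i) := by
    intro i κ ε D hε hκ hD
    have hdis := hD.disc
    rw [hκ] at hdis
    rw [F.sphere_eq har, hD.carrier, hκ, F.perpAt_form_iff (HypFrame.sphere_disc har) hdis]
    refine ⟨?_, hform i κ ε, ?_⟩
    · rw [Real.sinh_arsinh, Real.cosh_arsinh, HypFrame.form, inner_zero_left, sub_zero,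
        F.time_eq_sqrt, ht, norm_mul, hp, mul_one, Complex.norm_real, Real.norm_eq_abs, sq_abs]
      ring
    · rw [Real.sinh_arsinh, Real.cosh_arsinh, inner_zero_left]
      ring
  refine ⟨⟨C, t, F.center, Real.arsinh s, har, ?_, ?_, ?_⟩, hC⟩
  · intro i
    ext z
    rw [Set.mem_inter_iff, (hd i).disk, (hd' i).disk, hC, hC, Set.mem_singleton_iff]
    constructor
    · rintro ⟨h1, h2⟩
      apply F.pos.injective
      rw [ht]
      exact eq_dual_point (hk i) (hk _) hs (hp i) h1 h2
    · rintro rfl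
      exact ⟨(hform1 i).le, (hform2 i).le⟩
  · intro i j hij h1 h2
    rcases lt_or_gt_of_ne hij with h | h
    · exact hdisj i j h h1 h2
    · exact (hdisj j i h h2 h1).symm
  · intro i
    exact ⟨hperp i (k i) (-1) _ (by norm_num) (hC i) (by simpa [sub_eq_add_neg] using hd i),
      hperp i _ 1 _ (by norm_num) (hC _) (by simpa using hd' i)⟩

end Existence

/-! ### Estimates for the total geodesic curvature of an arc -/

lemma continuous_arcTurn_integrand (k : ℝ) :
    Continuous fun x : ℝ => 2 / ((1 + x ^ 2) * √(1 + (x / k) ^ 2)) := by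
  have : ∀ x : ℝ, (1 + x ^ 2) * √(1 + (x / k) ^ 2) ≠ 0 := fun x => by positivity
  fun_prop (disch := assumption)

lemma integral_two_mul_div_sq_add_sq {k : ℝ} (hk : 0 < k) (X : ℝ) :
    ∫ x in (0)..X, 2 * k / (k ^ 2 + x ^ 2) = 2 * Real.arctan (X / k) := by
  have hd : ∀ x ∈ Set.uIcc 0 X, HasDerivAt (fun x => 2 * Real.arctan (x / k))
      (2 * k / (k ^ 2 + x ^ 2)) x := by
    intro x _
    have := ((Real.hasDerivAt_arctan (x / k)).comp x ((hasDerivAt_id x).div_const k)).const_mul 2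
    refine this.congr_deriv ?_
    have : 0 < k ^ 2 + x ^ 2 := by positivity
    field_simp
  have hc : Continuous fun x : ℝ => 2 * k / (k ^ 2 + x ^ 2) := by
    have : ∀ x : ℝ, k ^ 2 + x ^ 2 ≠ 0 := fun x => by positivity
    fun_prop (disch := assumption)
  rw [intervalIntegral.integral_eq_sub_of_hasDerivAt hd (hc.intervalIntegrable _ _)]
  simp

lemma integral_two_div_one_add_sq (X : ℝ) :
    ∫ x in (0)..X, 2 / (1 + x ^ 2) = 2 * Real.arctan X := by
  have := integral_two_mul_div_sq_add_sq one_pos X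
  simpa using this

lemma arcTurn_mono {k X Y : ℝ} (hX : 0 ≤ X) (h : X ≤ Y) : arcTurn k X ≤ arcTurn k Y := by
  apply intervalIntegral.integral_mono_interval le_rfl hX h
  · exact Filter.Eventually.of_forall fun x => by positivity
  · exact (continuous_arcTurn_integrand k).intervalIntegrable _ _

lemma arcTurn_strictMono {k k' X : ℝ} (hk : 0 < k) (hkk : k < k') (hX : 0 < X) :
    arcTurn k X < arcTurn k' X := by
  have hk' := hk.trans hkk
  have key : ∀ x : ℝ, x ^ 2 / k' ^ 2 ≤ x ^ 2 / k ^ 2 := fun x => by gcongr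
  apply intervalIntegral.integral_lt_integral_of_continuousOn_of_le_of_exists_lt hX
    (continuous_arcTurn_integrand k).continuousOn (continuous_arcTurn_integrand k').continuousOn
  · intro x _
    simp only [div_pow]
    gcongr
  · refine ⟨X, ⟨hX.le, le_rfl⟩, ?_⟩
    simp only [div_pow]
    gcongr

lemma arcTurn_lt {k X : ℝ} (hk : 0 < k) (hX : 0 < X) : arcTurn k X < 2 * Real.arctan X := by
  rw [← integral_two_div_one_add_sq]
  have hc : Continuous fun x : ℝ => 2 / (1 + x ^ 2) := by
    have : ∀ x : ℝ, 1 + x ^ 2 ≠ 0 := fun x => by positivity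
    fun_prop (disch := assumption)
  apply intervalIntegral.integral_lt_integral_of_continuousOn_of_le_of_exists_lt hX
    (continuous_arcTurn_integrand k).continuousOn hc.continuousOn
  · intro x _
    gcongr
    exact le_mul_of_one_le_right (by positivity)
      (Real.one_le_sqrt.2 (le_add_of_nonneg_right (by positivity)))
  · refine ⟨X, ⟨hX.le, le_rfl⟩, ?_⟩
    gcongr
    refine lt_mul_of_one_lt_right (by positivity) (Real.lt_sqrt_of_sq_lt ?_)
    have : 0 < (X / k) ^ 2 := by positivity
    linarith

lemma inv_sqrt_sq {k : ℝ} (hk : 0 < k) (x : ℝ) :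
    (√(1 + (x / k) ^ 2))⁻¹ ^ 2 = k ^ 2 / (k ^ 2 + x ^ 2) := by
  have : 0 < k ^ 2 + x ^ 2 := by positivity
  rw [inv_pow, Real.sq_sqrt (by positivity)]
  field_simp

lemma le_arcTurn {k X : ℝ} (hk : 0 < k) (hX : 0 ≤ X) :
    2 * Real.arctan X - Real.pi / k ≤ arcTurn k X := by
  have h1 : 2 * Real.arctan X - Real.pi / k ≤
      (∫ x in (0)..X, 2 / (1 + x ^ 2)) - ∫ x in (0)..X, 1 / k * (2 * k / (k ^ 2 + x ^ 2)) := by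
    rw [integral_two_div_one_add_sq, intervalIntegral.integral_const_mul,
      integral_two_mul_div_sq_add_sq hk]
    have := mul_le_mul_of_nonneg_left (Real.arctan_lt_pi_div_two (X / k)).le
      (show 0 ≤ 2 * (1 / k) by positivity)
    have e : 2 * (1 / k) * (Real.pi / 2) = Real.pi / k := by field_simp
    linarith
  have hc1 : Continuous fun x : ℝ => 2 / (1 + x ^ 2) := by
    have : ∀ x : ℝ, 1 + x ^ 2 ≠ 0 := fun x => by positivity
    fun_prop (disch := assumption)
  have hc2 : Continuous fun x : ℝ => 1 / k * (2 * k / (k ^ 2 + x ^ 2)) := by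
    have : ∀ x : ℝ, k ^ 2 + x ^ 2 ≠ 0 := fun x => by positivity
    fun_prop (disch := assumption)
  rw [← intervalIntegral.integral_sub (hc1.intervalIntegrable _ _)
    (hc2.intervalIntegrable _ _)] at h1
  refine h1.trans (intervalIntegral.integral_mono_on hX ((hc1.sub hc2).intervalIntegrable _ _)
    ((continuous_arcTurn_integrand k).intervalIntegrable _ _) fun x _ => ?_)
  have h2 := inv_sqrt_sq hk x
  have h3 : (√(1 + (x / k) ^ 2))⁻¹ ≤ 1 := inv_le_one_of_one_le₀
    (Real.one_le_sqrt.2 (le_add_of_nonneg_right (by positivity)))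
  have h4 : 0 < (√(1 + (x / k) ^ 2))⁻¹ := by positivity
  rw [← div_div, div_eq_mul_inv (2 / (1 + x ^ 2)) (√_)]
  generalize (√(1 + (x / k) ^ 2))⁻¹ = c at *
  have h5 : 1 - c ≤ x ^ 2 / (k ^ 2 + x ^ 2) := by
    have : x ^ 2 / (k ^ 2 + x ^ 2) = 1 - c ^ 2 := by
      have : 0 < k ^ 2 + x ^ 2 := by positivity
      rw [h2]; field_simp; ring
    nlinarith
  have h6 : 2 / (1 + x ^ 2) * (1 - c) ≤ 2 / (1 + x ^ 2) * (x ^ 2 / (k ^ 2 + x ^ 2)) := by gcongr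
  have h7 : 2 / (1 + x ^ 2) * (x ^ 2 / (k ^ 2 + x ^ 2)) ≤ 1 / k * (2 * k / (k ^ 2 + x ^ 2)) := by
    have e1 : 2 / (1 + x ^ 2) * (x ^ 2 / (k ^ 2 + x ^ 2)) =
        x ^ 2 / (1 + x ^ 2) * (2 / (k ^ 2 + x ^ 2)) := by ring
    have e2 : 1 / k * (2 * k / (k ^ 2 + x ^ 2)) = 1 * (2 / (k ^ 2 + x ^ 2)) := by field_simp
    rw [e1, e2]
    gcongr
    rw [div_le_one (by positivity)]
    linarith
  linarith

lemma arcTurn_le_sqrt {k X : ℝ} (hk : 0 < k) (hX : 0 ≤ X) : arcTurn k X ≤ Real.pi * √k := by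
  obtain ⟨δ, hδ⟩ : ∃ δ, δ = √k := ⟨_, rfl⟩
  have hδ0 : 0 < δ := hδ ▸ Real.sqrt_pos.2 hk
  have hδ2 : δ ^ 2 = k := hδ ▸ Real.sq_sqrt hk.le
  have hc1 : Continuous fun x : ℝ => δ / 2 * (2 / (1 + x ^ 2)) := by
    have : ∀ x : ℝ, 1 + x ^ 2 ≠ 0 := fun x => by positivity
    fun_prop (disch := assumption)
  have hc2 : Continuous fun x : ℝ => δ / 2 * (2 * k / (k ^ 2 + x ^ 2)) := by
    have : ∀ x : ℝ, k ^ 2 + x ^ 2 ≠ 0 := fun x => by positivity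
    fun_prop (disch := assumption)
  have h1 : (∫ x in (0)..X, δ / 2 * (2 / (1 + x ^ 2))) +
      (∫ x in (0)..X, δ / 2 * (2 * k / (k ^ 2 + x ^ 2))) ≤ Real.pi * δ := by
    rw [intervalIntegral.integral_const_mul, intervalIntegral.integral_const_mul,
      integral_two_mul_div_sq_add_sq hk, integral_two_div_one_add_sq]
    have h2 := mul_le_mul_of_nonneg_left (Real.arctan_lt_pi_div_two (X / k)).le hδ0.le
    have h3 := mul_le_mul_of_nonneg_left (Real.arctan_lt_pi_div_two X).le hδ0.le
    linarith
  rw [← intervalIntegral.integral_add (hc1.intervalIntegrable _ _)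
    (hc2.intervalIntegrable _ _)] at h1
  rw [← hδ]
  refine (intervalIntegral.integral_mono_on hX
    ((continuous_arcTurn_integrand k).intervalIntegrable _ _)
    ((hc1.add hc2).intervalIntegrable _ _) fun x _ => ?_).trans h1
  have h2 := inv_sqrt_sq hk x
  rw [← div_div, div_eq_mul_inv (2 / (1 + x ^ 2)) (√_)]
  generalize (√(1 + (x / k) ^ 2))⁻¹ = c at *
  have h3 : δ / 2 * (2 * k / (k ^ 2 + x ^ 2)) = c ^ 2 / δ := by
    rw [h2, ← hδ2]
    have : 0 < (δ ^ 2) ^ 2 + x ^ 2 := by positivity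
    field_simp
  have h4 : 2 * c ≤ δ + c ^ 2 / δ := by
    rw [← sub_nonneg]
    have : δ + c ^ 2 / δ - 2 * c = (δ - c) ^ 2 / δ := by field_simp; ring
    rw [this]; positivity
  have h5 : (1 + x ^ 2)⁻¹ ≤ 1 := inv_le_one_of_one_le₀ (le_add_of_nonneg_right (by positivity))
  have h6 : 0 < (1 + x ^ 2)⁻¹ := by positivity
  have h7 : 0 ≤ c ^ 2 / δ := by positivity
  rw [Pi.add_apply, h3, div_eq_mul_inv 2]
  generalize (1 + x ^ 2)⁻¹ = b at *
  have h8 := mul_le_mul_of_nonneg_left h4 h6.le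
  have h9 := mul_le_mul_of_nonneg_right h5 h7
  linarith

/-- Multiplicative continuity of the total geodesic curvature of an arc. -/
lemma arcTurn_le_mul {k k₀ X X₀ c : ℝ} (hk : 0 < k) (hc : 1 ≤ c) (hX : 0 ≤ X) (hX₀ : 0 ≤ X₀)
    (hkk : k ≤ c * k₀) (hXX : X ≤ c ^ 2 * X₀) : arcTurn k X ≤ c ^ 2 * arcTurn k₀ X₀ := by
  have hc0 : 0 < c := by linarith
  have hk0 : 0 < k₀ := (mul_pos_iff_of_pos_left hc0).1 (hk.trans_le hkk)
  have h1 := intervalIntegral.mul_integral_comp_mul_left (a := 0) (b := X₀)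
    (f := fun x : ℝ => 2 / ((1 + x ^ 2) * √(1 + (x / k) ^ 2))) (c ^ 2)
  rw [mul_zero] at h1
  refine (arcTurn_mono hX hXX).trans ?_
  rw [arcTurn, ← h1]
  refine mul_le_mul_of_nonneg_left ?_ (by positivity)
  have hcont : Continuous fun x : ℝ =>
      2 / ((1 + (c ^ 2 * x) ^ 2) * √(1 + (c ^ 2 * x / k) ^ 2)) :=
    (continuous_arcTurn_integrand k).comp (continuous_const.mul continuous_id)
  refine intervalIntegral.integral_mono_on hX₀ (hcont.intervalIntegrable _ _)
    ((continuous_arcTurn_integrand k₀).intervalIntegrable _ _) fun x hx => ?_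
  have hx0 : 0 ≤ x := hx.1
  have h2 : x ≤ c ^ 2 * x := le_mul_of_one_le_left hx0 (one_le_pow₀ hc)
  have h3 : x / k₀ ≤ c ^ 2 * x / k := by
    rw [div_le_div_iff₀ hk0 hk]
    have h4 : c * (x * k₀) ≤ c ^ 2 * (x * k₀) := by
      gcongr
      nlinarith
    have h5 := mul_le_mul_of_nonneg_left hkk hx0
    linarith
  gcongr

/-! ### The radius of the dual circle -/

section Radius

variable {ι : Type*} [Fintype ι] {k k' : ι → ℝ} {s s' : ℝ}

lemma halfAngle_strictAnti : StrictAnti halfAngle := fun _ _ h =>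
  sub_lt_sub_left (Real.arctan_strictMono h) _

lemma exists_radius (hι : 2 < Fintype.card ι) (hk : ∀ i, 0 < k i) :
    ∃ s, 0 < s ∧ ∑ i, halfAngle (k i * s) = Real.pi := by
  have hπ := Real.pi_pos
  have hc : Continuous fun s => ∑ i, halfAngle (k i * s) := by
    unfold halfAngle
    fun_prop
  have h0 : Real.pi < ∑ i, halfAngle (k i * 0) := by
    have : (2 : ℝ) < Fintype.card ι := by exact_mod_cast hι
    simp only [mul_zero, halfAngle, Real.arctan_zero, sub_zero, Finset.sum_const, nsmul_eq_mul,
      Finset.card_univ]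
    nlinarith
  have hlim : Filter.Tendsto (fun s => ∑ i, halfAngle (k i * s)) Filter.atTop (nhds 0) := by
    have : ∀ i ∈ Finset.univ, Filter.Tendsto (fun s => halfAngle (k i * s)) Filter.atTop
        (nhds 0) := by
      intro i _
      have h1 : Filter.Tendsto (fun s => Real.arctan (k i * s)) Filter.atTop
          (nhds (Real.pi / 2)) :=
        (Real.tendsto_arctan_atTop.mono_right nhdsWithin_le_nhds).comp
          (Filter.tendsto_id.const_mul_atTop (hk i))
      simpa [halfAngle] using h1.const_sub (Real.pi / 2)
    simpa using tendsto_finsetSum _ this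
  obtain ⟨s₁, hs₁, hs₁0⟩ :=
    ((hlim.eventually_lt_const hπ).and (Filter.eventually_ge_atTop 0)).exists
  obtain ⟨s, hs, hval⟩ := intermediate_value_Icc' hs₁0 hc.continuousOn ⟨hs₁.le, h0.le⟩
  refine ⟨s, lt_of_le_of_ne hs.1 ?_, hval⟩
  rintro rfl
  exact h0.ne' hval

lemma radius_le (hs' : 0 < s') (hk : ∀ i, 0 < k i)
    (h : ∑ i, halfAngle (k i * s) = Real.pi) (h' : ∑ i, halfAngle (k' i * s') = Real.pi) {c : ℝ}
    (hkk : ∀ i, k' i ≤ c * k i) : s ≤ c * s' := by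
  by_contra hlt
  have hlt := not_le.1 hlt
  have hne : (Finset.univ : Finset ι).Nonempty := by
    rw [Finset.nonempty_iff_ne_empty]
    intro he
    rw [he, Finset.sum_empty] at h
    exact Real.pi_ne_zero h.symm
  have : ∑ i, halfAngle (k i * s) < ∑ i, halfAngle (k' i * s') := by
    refine Finset.sum_lt_sum_of_nonempty hne fun i _ => halfAngle_strictAnti ?_
    calc k' i * s' ≤ c * k i * s' := mul_le_mul_of_nonneg_right (hkk i) hs'.le
      _ = k i * (c * s') := by ring
      _ < k i * s := mul_lt_mul_of_pos_left hlt (hk i)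
  rw [h, h'] at this
  exact lt_irrefl _ this

lemma radius_unique (hs : 0 < s) (hs' : 0 < s') (hk : ∀ i, 0 < k i)
    (h : ∑ i, halfAngle (k i * s) = Real.pi) (h' : ∑ i, halfAngle (k i * s') = Real.pi) :
    s = s' := by
  have h1 := radius_le hs' hk h h' (c := 1) (by simp)
  have h2 := radius_le hs hk h' h (c := 1) (by simp)
  linarith

end Radius

/-! ### Polygon packings are determined by their curvatures -/

lemma PolygonPacking.exists_radius_arcCurvature {n : ℕ} (hn : 3 ≤ n) (Q : PolygonPacking n) :
    ∃ s, 0 < s ∧ ∑ i, halfAngle ((Q.circle i).curvature * s) = Real.pi ∧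
      ∀ i, Q.arcCurvature i =
        arcTurn (Q.circle i).curvature ((Q.circle i).curvature * s) := by
  obtain ⟨m, rfl⟩ : ∃ m, n = m + 3 := ⟨n - 3, by omega⟩
  obtain ⟨F, p, h, hp⟩ := Q.exists_standardPosition
  exact ⟨_, h.pos_radius, h.sum_halfAngle hp, h.arcCurvature_eq⟩

lemma exists_polygonPacking_curvature {n : ℕ} (hn : 3 ≤ n) {k : Fin n → ℝ} (hk : ∀ i, 0 < k i) :
    ∃ Q : PolygonPacking n, ∀ i, (Q.circle i).curvature = k i := by
  obtain ⟨m, rfl⟩ : ∃ m, n = m + 3 := ⟨n - 3, by omega⟩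
  obtain ⟨s, hs, hsum⟩ := exists_radius (by simp) hk
  exact exists_polygonPacking hk hs hsum

/-- An isometry of the hyperbolic plane that carries the polygon packing `Q` with all its parts to
the polygon packing `Q'`. -/
structure PolygonPacking.Congruence {n : ℕ} (Q Q' : PolygonPacking n) (Φ : ℍ ≃ ℍ) : Prop where
  dist_eq : ∀ z w, dist (Φ z) (Φ w) = dist z w
  mem_polygon : ∀ z, Φ z ∈ Q'.polygon ↔ z ∈ Q.polygon
  mem_edge : ∀ i z, Φ z ∈ Q'.edge i ↔ z ∈ Q.edge i
  mem_carrier : ∀ i z, Φ z ∈ (Q'.circle i).carrier ↔ z ∈ (Q.circle i).carrier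
  mem_disk : ∀ i z, Φ z ∈ (Q'.circle i).disk ↔ z ∈ (Q.circle i).disk
  tangency : ∀ i, Φ (Q.tangency i) = Q'.tangency i

theorem PolygonPacking.exists_congruence {n : ℕ} (hn : 3 ≤ n) {Q Q' : PolygonPacking n}
    (hQ : ∀ i, (Q'.circle i).curvature = (Q.circle i).curvature) : ∃ Φ, Q.Congruence Q' Φ := by
  obtain ⟨m, rfl⟩ : ∃ m, n = m + 3 := ⟨n - 3, by omega⟩
  obtain ⟨F, p, h, hp⟩ := Q.exists_standardPosition
  obtain ⟨F', p', h', hp'⟩ := Q'.exists_standardPosition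
  obtain ⟨k, hk⟩ : ∃ k, k = fun i => (Q.circle i).curvature := ⟨_, rfl⟩
  have hk' : (fun i => (Q'.circle i).curvature) = k := by rw [hk]; exact funext hQ
  rw [← hk] at h
  rw [hk'] at h'
  have hs : Real.sinh Q'.dualRadius = Real.sinh Q.dualRadius :=
    radius_unique h'.pos_radius h.pos_radius h.pos_curvature (h'.sum_halfAngle hp')
      (h.sum_halfAngle hp)
  rw [hs] at h'
  have hpp : p' = p := by
    funext i
    have hof : Fin.ofNat (m + 3) (i : ℕ) = i := by apply Fin.ext; simp
    have h1 := h.dir_eq hp i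
    have h2 := h'.dir_eq hp' i
    rw [hof] at h1 h2
    rw [h1, h2]
  rw [hpp] at h'
  have hpoly : ∀ z, F.map F' z ∈ Q'.polygon ↔ z ∈ Q.polygon := by
    intro z
    rw [h.polygon_eq, h'.polygon_eq]
    simp only [Set.mem_ofPred_eq, F.form_map F']
  refine ⟨F.map F', F.dist_map F', hpoly, ?_, ?_, ?_, ?_⟩
  · intro i z
    rw [h.edge_eq, h'.edge_eq, Set.mem_ofPred_eq, Set.mem_ofPred_eq, hpoly, F.form_map F']
  · intro i z
    rw [(h.describes i).carrier, (h'.describes i).carrier, h.curvature_eq, h'.curvature_eq,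
      Set.mem_ofPred_eq, Set.mem_ofPred_eq, F.form_map F']
  · intro i z
    rw [(h.describes i).disk, (h'.describes i).disk, h.curvature_eq, h'.curvature_eq,
      Set.mem_ofPred_eq, Set.mem_ofPred_eq, F.form_map F']
  · intro i
    apply F'.pos.injective
    rw [F.pos_map F', h.tangency, h'.tangency]

/-! ### Isometry of the glued surfaces -/

namespace CirclePackingMetric

variable {S : Type*} [TopologicalSpace S] [ChartedSpace (EuclideanHalfSpace 2) S]
  {T : PolygonalDecomposition S}

lemma Chain.map {M M' : CirclePackingMetric T} {f : M.Surface → M'.Surface}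
    {e : ∀ P, (M.packing P).polygon → (M'.packing P).polygon}
    (hf : ∀ P x, f (M.toSurface ⟨P, x⟩) = M'.toSurface ⟨P, e P x⟩)
    (hd : ∀ P x y, dist (e P x : ℍ) (e P y) = dist (x : ℍ) y) {a b : M.Surface} {ℓ : ℝ}
    (h : M.Chain a b ℓ) : M'.Chain (f a) (f b) ℓ := by
  induction h with
  | nil a => exact Chain.nil _
  | cons P x y b ℓ _ ih =>
    rw [hf] at ih
    rw [hf, ← hd P x y]
    exact Chain.cons P _ _ _ _ ih

lemma glue_iff {M M' : CirclePackingMetric T} {Φ : T.F → ℍ ≃ ℍ}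
    (hΦ : ∀ P, (M.packing P).Congruence (M'.packing P) (Φ P)) {x y : M.Point} {x' y' : M'.Point}
    (hx : x'.1 = x.1) (hy : y'.1 = y.1) (hxx : (x'.2 : ℍ) = Φ x.1 x.2)
    (hyy : (y'.2 : ℍ) = Φ y.1 y.2) : M.Glue x y ↔ M'.Glue x' y' := by
  obtain ⟨P, x⟩ := x
  obtain ⟨R, y⟩ := y
  obtain ⟨P', x'⟩ := x'
  obtain ⟨R', y'⟩ := y'
  dsimp only at hx hy
  subst hx hy
  refine exists_congr fun i => exists_congr fun j => ?_
  dsimp only at hxx hyy ⊢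
  simp only [hxx, hyy, (hΦ _).mem_edge, (hΦ _).mem_disk, ← (hΦ _).tangency, (hΦ _).dist_eq]

theorem same_of_k_eq {M M' : CirclePackingMetric T} (h : M.k = M'.k) : M.Same M' := by
  have hcong : ∀ P, ∃ Φ, (M.packing P).Congruence (M'.packing P) Φ := fun P =>
    PolygonPacking.exists_congruence (T.three_le_sides P) fun i => by
      rw [M.curvature_eq, M'.curvature_eq, h]
  choose Φ hΦ using hcong
  let e : ∀ P, (M.packing P).polygon ≃ (M'.packing P).polygon := fun P =>
    (Φ P).subtypeEquiv fun z => ((hΦ P).mem_polygon z).symm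
  have he : ∀ P x, (e P x : ℍ) = Φ P x := fun P x => rfl
  let ψ : M.Surface ≃ M'.Surface := Quot.congr (Equiv.sigmaCongrRight e) fun x y =>
    glue_iff hΦ rfl rfl rfl rfl
  have hψ : ∀ P x, ψ (M.toSurface ⟨P, x⟩) = M'.toSurface ⟨P, e P x⟩ := fun P x => rfl
  have hψ' : ∀ P x, ψ.symm (M'.toSurface ⟨P, x⟩) = M.toSurface ⟨P, (e P).symm x⟩ := by
    intro P x
    rw [Equiv.symm_apply_eq, hψ, Equiv.apply_symm_apply]
  have hd : ∀ P x y, dist (e P x : ℍ) (e P y) = dist (x : ℍ) y := fun P x y => by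
    rw [he, he, (hΦ P).dist_eq]
  have hd' : ∀ P x y, dist ((e P).symm x : ℍ) ((e P).symm y) = dist (x : ℍ) y := fun P x y => by
    rw [← hd, Equiv.apply_symm_apply, Equiv.apply_symm_apply]
  refine ⟨h, ψ, ?_, ?_, ?_⟩
  · intro a b
    unfold surfaceDist
    refine iInf_congr fun ℓ => iInf_congr_Prop ⟨fun hc => ?_, fun hc => ?_⟩ fun _ => rfl
    · have := hc.map hψ' hd'
      rwa [Equiv.symm_apply_apply, Equiv.symm_apply_apply] at this
    · exact hc.map hψ hd
  · intro v
    ext a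
    constructor
    · rintro ⟨_, ⟨P, i, x, hv, hx, rfl⟩, rfl⟩
      exact ⟨P, i, e P x, hv, ((hΦ P).mem_carrier i _).2 hx, hψ P x⟩
    · rintro ⟨P, i, x, hv, hx, rfl⟩
      refine ⟨_, ⟨P, i, (e P).symm x, hv, ?_, rfl⟩, ?_⟩
      · rw [← (hΦ P).mem_carrier i, ← he, Equiv.apply_symm_apply]
        exact hx
      · rw [hψ, Equiv.apply_symm_apply]
  · intro P
    ext a
    constructor
    · rintro ⟨_, ⟨x, rfl⟩, rfl⟩
      exact ⟨e P x, (hψ P x).symm⟩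
    · rintro ⟨x, rfl⟩
      exact ⟨_, ⟨(e P).symm x, rfl⟩, by rw [hψ, Equiv.apply_symm_apply]⟩

end CirclePackingMetric

lemma arctan_le_self {x : ℝ} (hx : 0 ≤ x) : Real.arctan x ≤ x := by
  have := Real.le_tan (Real.arctan_nonneg.2 hx) (Real.arctan_lt_pi_div_two x)
  rwa [Real.tan_arctan] at this

/-! ### Total geodesic curvatures as functions of the geodesic curvatures -/

namespace PolygonalDecomposition

variable {S : Type*} [TopologicalSpace S] [ChartedSpace (EuclideanHalfSpace 2) S]
  (T : PolygonalDecomposition S)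

lemma exists_faceRadius {k : T.V → ℝ} (hk : ∀ v, 0 < k v) (P : T.F) :
    ∃ s, 0 < s ∧ ∑ i, halfAngle (k (T.corner P i) * s) = Real.pi :=
  exists_radius (by rw [Fintype.card_fin]; have := T.three_le_sides P; omega) fun _ => hk _

open scoped Classical in
/-- The hyperbolic sine of the radius of the dual circle of the face `P`, for the geodesic
curvatures `k`; set to `1` if `k` is not positive. -/
noncomputable def faceRadius (k : T.V → ℝ) (P : T.F) : ℝ :=
  if hk : ∀ v, 0 < k v then (T.exists_faceRadius hk P).choose else 1

open scoped Classical in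
/-- The total geodesic curvature at the vertex `v` as a function of all geodesic curvatures. -/
noncomputable def vertexCurvature (k : T.V → ℝ) (v : T.V) : ℝ :=
  ∑ P : T.F, ∑ _i : Fin (T.sides P) with T.corner P _i = v, arcTurn (k v) (k v * T.faceRadius k P)

variable {T} {k k' : T.V → ℝ}

lemma faceRadius_pos (hk : ∀ v, 0 < k v) (P : T.F) : 0 < T.faceRadius k P := by
  rw [faceRadius, dif_pos hk]
  exact (T.exists_faceRadius hk P).choose_spec.1

lemma sum_halfAngle_faceRadius (hk : ∀ v, 0 < k v) (P : T.F) :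
    ∑ i, halfAngle (k (T.corner P i) * T.faceRadius k P) = Real.pi := by
  rw [faceRadius, dif_pos hk]
  exact (T.exists_faceRadius hk P).choose_spec.2

lemma faceRadius_le (hk : ∀ v, 0 < k v) (hk' : ∀ v, 0 < k' v) {c : ℝ} (h : ∀ v, k' v ≤ c * k v)
    (P : T.F) : T.faceRadius k P ≤ c * T.faceRadius k' P :=
  radius_le (faceRadius_pos hk' P) (fun i => hk (T.corner P i)) (sum_halfAngle_faceRadius hk P)
    (sum_halfAngle_faceRadius hk' P) fun _ => h _

lemma faceRadius_anti (hk : ∀ v, 0 < k v) (hk' : ∀ v, 0 < k' v) (h : ∀ v, k v ≤ k' v) (P : T.F) :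
    T.faceRadius k' P ≤ T.faceRadius k P := by
  simpa using faceRadius_le (c := 1) hk' hk (by simpa using h) P

/-- If the geodesic curvatures increase but the one at `v` does not change, then the total
geodesic curvature at `v` decreases. -/
lemma vertexCurvature_anti (hk : ∀ v, 0 < k v) (hk' : ∀ v, 0 < k' v) (h : ∀ v, k v ≤ k' v)
    {v : T.V} (hv : k' v = k v) : T.vertexCurvature k' v ≤ T.vertexCurvature k v := by
  refine Finset.sum_le_sum fun P _ => Finset.sum_le_sum fun _ _ => ?_
  rw [hv]
  exact arcTurn_mono (mul_nonneg (hk v).le (faceRadius_pos hk' P).le)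
    (mul_le_mul_of_nonneg_left (faceRadius_anti hk hk' h P) (hk v).le)

lemma vertexCurvature_le_mul (hk : ∀ v, 0 < k v) (hk' : ∀ v, 0 < k' v) (h : ∀ v, k v ≤ k' v)
    {c : ℝ} (hc : 1 ≤ c) {v : T.V} (hv : k' v ≤ c * k v) :
    T.vertexCurvature k' v ≤ c ^ 2 * T.vertexCurvature k v := by
  rw [vertexCurvature, vertexCurvature, Finset.mul_sum]
  refine Finset.sum_le_sum fun P _ => ?_
  rw [Finset.mul_sum]
  refine Finset.sum_le_sum fun i _ => ?_
  have hs := faceRadius_pos hk P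
  have hs' := faceRadius_pos hk' P
  refine arcTurn_le_mul (hk' v) hc (mul_nonneg (hk' v).le hs'.le) (mul_nonneg (hk v).le hs.le) hv ?_
  calc k' v * T.faceRadius k' P ≤ c * k v * T.faceRadius k P :=
        mul_le_mul hv (faceRadius_anti hk hk' h P) hs'.le
          (mul_nonneg (by linarith) (hk v).le)
    _ ≤ c ^ 2 * (k v * T.faceRadius k P) := by
        rw [mul_assoc]
        refine mul_le_mul_of_nonneg_right ?_ (mul_pos (hk v) hs).le
        exact le_self_pow₀ hc two_ne_zero

lemma exists_corner_of_vertexCurvature_pos {v : T.V} (h : 0 < T.vertexCurvature k v) :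
    ∃ P i, T.corner P i = v := by
  classical
  by_contra hne
  push Not at hne
  refine h.ne' (Finset.sum_eq_zero fun P _ => Finset.sum_eq_zero fun i hi => ?_)
  exact absurd (Finset.mem_filter.1 hi).2 (hne P i)

/-- Maximum principle: at a vertex where the quotient of the geodesic curvatures is largest, the
total geodesic curvature is larger. -/
lemma le_of_vertexCurvature_eq (hk : ∀ v, 0 < k v) (hk' : ∀ v, 0 < k' v)
    (hpos : ∀ v, 0 < T.vertexCurvature k v)
    (heq : ∀ v, T.vertexCurvature k' v = T.vertexCurvature k v) (v₀ : T.V) : k' v₀ ≤ k v₀ := by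
  obtain ⟨v, -, hmax⟩ := Finset.exists_max_image Finset.univ (fun v => k' v / k v)
    ⟨v₀, Finset.mem_univ _⟩
  obtain ⟨c, hc⟩ : ∃ c, c = k' v / k v := ⟨_, rfl⟩
  have hle : ∀ w, k' w ≤ c * k w := fun w => by
    rw [hc, ← div_le_iff₀ (hk w)]; exact hmax w (Finset.mem_univ _)
  have hv : k' v = c * k v := by rw [hc, div_mul_cancel₀ _ (hk v).ne']
  by_contra hlt
  have hc1 : 1 < c := by
    by_contra h1
    have := hle v₀
    have := mul_le_mul_of_nonneg_right (not_lt.1 h1) (hk v₀).le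
    linarith
  have key : ∀ P, arcTurn (k v) (k v * T.faceRadius k P) <
      arcTurn (k' v) (k' v * T.faceRadius k' P) := by
    intro P
    have hs := mul_pos (hk v) (faceRadius_pos hk P)
    have hX : k v * T.faceRadius k P ≤ k' v * T.faceRadius k' P := by
      rw [hv, mul_comm c, mul_assoc]
      exact mul_le_mul_of_nonneg_left (faceRadius_le hk hk' hle P) (hk v).le
    refine (arcTurn_strictMono (hk v) ?_ hs).trans_le (arcTurn_mono hs.le hX)
    rw [hv]
    exact lt_mul_of_one_lt_left (hk v) hc1
  obtain ⟨P, i, hi⟩ := exists_corner_of_vertexCurvature_pos (hpos v)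
  have : T.vertexCurvature k v < T.vertexCurvature k' v := by
    refine Finset.sum_lt_sum (fun P _ => Finset.sum_le_sum fun i _ => (key P).le)
      ⟨P, Finset.mem_univ _, Finset.sum_lt_sum_of_nonempty ⟨i, by simpa using hi⟩ fun i _ => key P⟩
  rw [heq] at this
  exact lt_irrefl _ this

/-! ### The sum of total geodesic curvatures over a set of vertices -/

open scoped Classical in
/-- The corners of the face `P` at the vertices in `W`. -/
noncomputable def cornersIn (T : PolygonalDecomposition S) (P : T.F) (W : Finset T.V) :
    Finset (Fin (T.sides P)) := {i | T.corner P i ∈ W}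

lemma card_cornersIn (P : T.F) (W : Finset T.V) : (T.cornersIn P W).card = T.numIn P W := by
  classical
  rw [numIn, ← Finset.card_image_of_injective _ (T.corner_injective P)]
  congr 1
  ext v
  simp only [cornersIn, Finset.mem_image, Finset.mem_filter, Finset.mem_univ, true_and,
    Set.mem_range]
  constructor
  · rintro ⟨i, hi, rfl⟩
    exact ⟨hi, i, rfl⟩
  · rintro ⟨hv, i, rfl⟩
    exact ⟨i, hv, rfl⟩

lemma mem_facesMeeting_iff {P : T.F} {W : Finset T.V} :
    P ∈ T.facesMeeting W ↔ (T.cornersIn P W).Nonempty := by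
  classical
  simp only [facesMeeting, Finset.mem_filter, Finset.mem_univ, true_and, cornersIn,
    Finset.Nonempty, Set.mem_range]
  constructor
  · rintro ⟨v, hv, i, rfl⟩
    exact ⟨i, hv⟩
  · rintro ⟨i, hi⟩
    exact ⟨_, hi, i, rfl⟩

lemma sum_vertexCurvature (W : Finset T.V) : ∑ w ∈ W, T.vertexCurvature k w =
    ∑ P ∈ T.facesMeeting W, ∑ i ∈ T.cornersIn P W,
      arcTurn (k (T.corner P i)) (k (T.corner P i) * T.faceRadius k P) := by
  classical
  have h1 : ∀ P, ∑ w ∈ W, ∑ _i : Fin (T.sides P) with T.corner P _i = w,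
      arcTurn (k w) (k w * T.faceRadius k P) = ∑ i ∈ T.cornersIn P W,
      arcTurn (k (T.corner P i)) (k (T.corner P i) * T.faceRadius k P) := by
    intro P
    rw [← Finset.sum_fiberwise_of_maps_to (s := T.cornersIn P W) (t := W) (g := T.corner P)
      (fun i hi => (Finset.mem_filter.1 hi).2)]
    refine Finset.sum_congr rfl fun w hw => ?_
    have h2 : ({i ∈ T.cornersIn P W | T.corner P i = w} : Finset _) =
        ({i | T.corner P i = w} : Finset (Fin (T.sides P))) := by
      ext i
      simp only [cornersIn, Finset.mem_filter, Finset.mem_univ, true_and, and_iff_right_iff_imp]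
      rintro rfl
      exact hw
    rw [h2]
    refine Finset.sum_congr (by congr) fun i hi => ?_
    rw [(Finset.mem_filter.1 hi).2]
  unfold vertexCurvature
  rw [Finset.sum_comm]
  have h3 : ∀ P, ∑ w ∈ W, ∑ _i : Fin (T.sides P) with T.corner P _i = w,
      arcTurn (k w) (k w * T.faceRadius k P) = ∑ i ∈ T.cornersIn P W,
      arcTurn (k (T.corner P i)) (k (T.corner P i) * T.faceRadius k P) := h1
  rw [Finset.sum_congr rfl fun P _ => h3 P]
  symm
  refine Finset.sum_subset (Finset.subset_univ _) fun P _ hP => ?_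
  rw [mem_facesMeeting_iff, Finset.not_nonempty_iff_eq_empty] at hP
  rw [hP, Finset.sum_empty]

lemma sum_arctan (hk : ∀ v, 0 < k v) (P : T.F) :
    ∑ i, 2 * Real.arctan (k (T.corner P i) * T.faceRadius k P) =
      Real.pi * ((T.sides P : ℝ) - 2) := by
  have h := sum_halfAngle_faceRadius hk P
  simp only [halfAngle, Finset.sum_sub_distrib, Finset.sum_const, Finset.card_univ,
    Fintype.card_fin, nsmul_eq_mul] at h
  rw [← Finset.mul_sum]
  linarith

/-- The upper bound for the total geodesic curvatures of the arcs of a face. -/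
lemma sum_arcTurn_lt (hk : ∀ v, 0 < k v) {P : T.F} {W : Finset T.V} (hP : P ∈ T.facesMeeting W) :
    ∑ i ∈ T.cornersIn P W, arcTurn (k (T.corner P i)) (k (T.corner P i) * T.faceRadius k P) <
      Real.pi * min (T.numIn P W : ℝ) ((T.sides P : ℝ) - 2) := by
  have hπ := Real.pi_pos
  have hs := faceRadius_pos hk P
  refine (Finset.sum_lt_sum_of_nonempty (mem_facesMeeting_iff.1 hP)
    fun i _ => arcTurn_lt (hk _) (mul_pos (hk _) hs)).trans_le ?_
  rw [mul_min_of_nonneg _ _ hπ.le, le_min_iff]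
  constructor
  · rw [← card_cornersIn, mul_comm, ← nsmul_eq_mul]
    refine Finset.sum_le_card_nsmul _ _ _ fun i _ => ?_
    linarith [Real.arctan_lt_pi_div_two (k (T.corner P i) * T.faceRadius k P)]
  · rw [← sum_arctan hk P]
    refine Finset.sum_le_univ_sum_of_nonneg fun i => ?_
    have := Real.arctan_nonneg.2 (mul_pos (hk (T.corner P i)) hs).le
    positivity

/-- The upper bound is almost attained if the geodesic curvatures in `W` are large and the others
are bounded. -/
lemma le_sum_arcTurn (hk : ∀ v, 0 < k v) (P : T.F) {W : Finset T.V} {K b : ℝ} (hK : 0 ≤ K)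
    (hb : 1 ≤ b) (hW : ∀ v ∈ W, b ^ 2 ≤ k v) (hW' : ∀ v ∉ W, k v ≤ K) :
    Real.pi * min (T.numIn P W : ℝ) ((T.sides P : ℝ) - 2) -
        T.sides P * ((2 * K + 2 + Real.pi) / b) ≤
      ∑ i ∈ T.cornersIn P W,
        arcTurn (k (T.corner P i)) (k (T.corner P i) * T.faceRadius k P) := by
  classical
  have hπ := Real.pi_pos
  have hb0 : 0 < b := by linarith
  have hs := faceRadius_pos hk P
  set s := T.faceRadius k P
  have hmem : ∀ i, i ∈ T.cornersIn P W ↔ T.corner P i ∈ W := fun i => by simp [cornersIn]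
  have hcard : ((T.cornersIn P W).card : ℝ) ≤ T.sides P := by
    have := Finset.card_le_univ (T.cornersIn P W)
    rw [Fintype.card_fin] at this
    exact_mod_cast this
  have hcard' : (((T.cornersIn P W)ᶜ).card : ℝ) ≤ T.sides P := by
    have := Finset.card_le_univ (T.cornersIn P W)ᶜ
    rw [Fintype.card_fin] at this
    exact_mod_cast this
  have h1 : ∑ i ∈ T.cornersIn P W, (2 * Real.arctan (k (T.corner P i) * s) - Real.pi / b) ≤
      ∑ i ∈ T.cornersIn P W, arcTurn (k (T.corner P i)) (k (T.corner P i) * s) := by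
    refine Finset.sum_le_sum fun i hi => ?_
    refine le_trans ?_ (le_arcTurn (hk _) (mul_pos (hk _) hs).le)
    have h2 : b ≤ k (T.corner P i) := le_trans (by nlinarith) (hW _ ((hmem i).1 hi))
    have : Real.pi / k (T.corner P i) ≤ Real.pi / b := by gcongr
    linarith
  refine le_trans ?_ h1
  rw [Finset.sum_sub_distrib, Finset.sum_const, nsmul_eq_mul]
  have h2 : (T.cornersIn P W).card * (Real.pi / b) ≤ T.sides P * (Real.pi / b) := by gcongr
  have hsplit : (T.sides P : ℝ) * ((2 * K + 2 + Real.pi) / b) = T.sides P * (2 * K / b) +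
      T.sides P * (2 / b) + T.sides P * (Real.pi / b) := by ring
  have hK' : 0 ≤ T.sides P * (2 * K / b) := by positivity
  have h2' : 0 ≤ T.sides P * (2 / b) := by positivity
  suffices h : Real.pi * min (T.numIn P W : ℝ) ((T.sides P : ℝ) - 2) - T.sides P * (2 * K / b) -
      T.sides P * (2 / b) ≤ ∑ i ∈ T.cornersIn P W, 2 * Real.arctan (k (T.corner P i) * s) by
    linarith
  rcases le_total s b⁻¹ with hsb | hsb
  · -- the dual circle is small: the corners outside `W` contribute little
    have h3 := Finset.sum_add_sum_compl (T.cornersIn P W)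
      fun i => 2 * Real.arctan (k (T.corner P i) * s)
    rw [sum_arctan hk P] at h3
    have h4 : ∑ i ∈ (T.cornersIn P W)ᶜ, 2 * Real.arctan (k (T.corner P i) * s) ≤
        T.sides P * (2 * K / b) := by
      refine (Finset.sum_le_card_nsmul _ _ (2 * K / b) fun i hi => ?_).trans ?_
      · have h5 : k (T.corner P i) ≤ K := hW' _ fun h => Finset.mem_compl.1 hi ((hmem i).2 h)
        have h6 : Real.arctan (k (T.corner P i) * s) ≤ k (T.corner P i) * s :=
          arctan_le_self (mul_pos (hk _) hs).le
        have h7 : k (T.corner P i) * s ≤ K * b⁻¹ := mul_le_mul h5 hsb hs.le hK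
        rw [div_eq_mul_inv]
        linarith
      · rw [nsmul_eq_mul]
        gcongr
    have h5 : Real.pi * min (T.numIn P W : ℝ) ((T.sides P : ℝ) - 2) ≤
        Real.pi * ((T.sides P : ℝ) - 2) := by
      gcongr; exact min_le_right _ _
    linarith
  · -- the dual circle is large: the arcs at the corners in `W` have small angles
    have h3 : ∑ i ∈ T.cornersIn P W, (Real.pi - 2 / b) ≤
        ∑ i ∈ T.cornersIn P W, 2 * Real.arctan (k (T.corner P i) * s) := by
      refine Finset.sum_le_sum fun i hi => ?_
      have hks : b ≤ k (T.corner P i) * s := by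
        have := mul_le_mul (hW _ ((hmem i).1 hi)) hsb (by positivity) (hk _).le
        have e : b ^ 2 * b⁻¹ = b := by field_simp
        rwa [e] at this
      have h4 : Real.pi / 2 - Real.arctan (k (T.corner P i) * s) ≤ 1 / b := by
        rw [← Real.arctan_inv_of_pos (mul_pos (hk _) hs)]
        refine (arctan_le_self (by have := mul_pos (hk (T.corner P i)) hs; positivity)).trans ?_
        rw [one_div]
        gcongr
      have e : 2 / b = 2 * (1 / b) := by ring
      rw [e]
      linarith
    rw [Finset.sum_const, nsmul_eq_mul, mul_sub, card_cornersIn] at h3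
    rw [card_cornersIn] at hcard
    have h4 : (T.numIn P W : ℝ) * (2 / b) ≤ T.sides P * (2 / b) := by gcongr
    have h5 : Real.pi * min (T.numIn P W : ℝ) ((T.sides P : ℝ) - 2) ≤
        Real.pi * (T.numIn P W : ℝ) := by
      gcongr; exact min_le_left _ _
    linarith

end PolygonalDecomposition

/-! ### Existence of curvatures with prescribed total geodesic curvatures -/

namespace PolygonalDecomposition

variable {S : Type*} [TopologicalSpace S] [ChartedSpace (EuclideanHalfSpace 2) S]
  {T : PolygonalDecomposition S} {L : T.V → ℝ}

variable (T L) in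
/-- The positive geodesic curvatures whose total geodesic curvatures are at most `L`. -/
def subsolutions : Set (T.V → ℝ) := {k | (∀ v, 0 < k v) ∧ ∀ v, T.vertexCurvature k v ≤ L v}

lemma sup_mem_subsolutions {k k' : T.V → ℝ} (hk : k ∈ T.subsolutions L)
    (hk' : k' ∈ T.subsolutions L) : k ⊔ k' ∈ T.subsolutions L := by
  have hpos : ∀ v, 0 < (k ⊔ k') v := fun v => lt_sup_of_lt_left (hk.1 v)
  refine ⟨hpos, fun v => ?_⟩
  rcases le_total (k v) (k' v) with h | h
  · exact (vertexCurvature_anti hk'.1 hpos (fun w => le_sup_right) (sup_eq_right.2 h)).trans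
      (hk'.2 v)
  · exact (vertexCurvature_anti hk.1 hpos (fun w => le_sup_left) (sup_eq_left.2 h)).trans (hk.2 v)

lemma exists_mem_subsolutions (hL : ∀ v, 0 < L v) : (T.subsolutions L).Nonempty := by
  obtain ⟨δ, hδ, hδL⟩ : ∃ δ, 0 < δ ∧ ∀ v, δ ≤ L v := by
    rcases isEmpty_or_nonempty T.V with h | h
    · exact ⟨1, one_pos, fun v => h.elim v⟩
    · obtain ⟨v, -, hv⟩ := Finset.exists_min_image Finset.univ L Finset.univ_nonempty
      exact ⟨L v, hL v, fun w => hv w (Finset.mem_univ _)⟩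
  obtain ⟨A, hA⟩ : ∃ A : ℝ, A = ∑ P : T.F, (T.sides P : ℝ) := ⟨_, rfl⟩
  have hA0 : 0 ≤ A := by rw [hA]; positivity
  have hπ := Real.pi_pos
  obtain ⟨r, hr⟩ : ∃ r, r = δ / (Real.pi * (A + 1)) := ⟨_, rfl⟩
  have hr0 : 0 < r := by rw [hr]; positivity
  have hpos : ∀ v : T.V, 0 < (fun _ => r ^ 2 : T.V → ℝ) v := fun _ => by positivity
  classical
  refine ⟨fun _ => r ^ 2, hpos, fun v => le_trans ?_ (hδL v)⟩
  have h1 : T.vertexCurvature (fun _ => r ^ 2) v ≤ ∑ P : T.F, T.sides P * (Real.pi * r) := by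
    refine Finset.sum_le_sum fun P _ => ?_
    rw [Finset.sum_const, nsmul_eq_mul]
    have h2 := arcTurn_le_sqrt (hpos v) (mul_pos (hpos v) (faceRadius_pos hpos P)).le
    beta_reduce at h2
    rw [Real.sqrt_sq hr0.le] at h2
    refine (mul_le_mul_of_nonneg_left h2 (Nat.cast_nonneg _)).trans
      (mul_le_mul_of_nonneg_right ?_ (by positivity))
    have h3 := Finset.card_filter_le (Finset.univ : Finset (Fin (T.sides P)))
      fun i => T.corner P i = v
    rw [Finset.card_univ, Fintype.card_fin] at h3
    exact_mod_cast h3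
  rw [← Finset.sum_mul, ← hA] at h1
  refine h1.trans ?_
  have : Real.pi * r * (A + 1) = δ := by rw [hr]; field_simp
  have : 0 < Real.pi * r := by positivity
  linarith

/-- Geodesic curvatures with bounded total geodesic curvatures cannot become large on a nonempty
set of vertices `W` only, if the condition on the sum over `W` is satisfied. -/
lemma exists_bound_of_large {W : Finset T.V}
    (hW : ∑ w ∈ W, L w < ∑ P ∈ T.facesMeeting W,
      Real.pi * min (T.numIn P W : ℝ) ((T.sides P : ℝ) - 2)) {K : ℝ} (hK : 0 ≤ K) :
    ∃ B, ∀ k ∈ T.subsolutions L, (∀ v ∉ W, k v ≤ K) → ∃ v ∈ W, k v < B := by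
  set R := ∑ P ∈ T.facesMeeting W, Real.pi * min (T.numIn P W : ℝ) ((T.sides P : ℝ) - 2)
  have hπ := Real.pi_pos
  obtain ⟨A, hA⟩ : ∃ A : ℝ, A = ∑ P ∈ T.facesMeeting W, (T.sides P : ℝ) * (2 * K + 2 + Real.pi) :=
    ⟨_, rfl⟩
  have hA0 : 0 ≤ A := by rw [hA]; positivity
  obtain ⟨b, hb⟩ : ∃ b, b = 1 + A / (R - ∑ w ∈ W, L w) := ⟨_, rfl⟩
  have hgap := sub_pos.2 hW
  have hb1 : 1 ≤ b := by rw [hb]; exact le_add_of_nonneg_right (by positivity)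
  refine ⟨b ^ 2, fun k hk hkK => ?_⟩
  by_contra hne
  push Not at hne
  have h1 : R - A / b ≤ ∑ w ∈ W, T.vertexCurvature k w := by
    rw [sum_vertexCurvature]
    have := Finset.sum_le_sum fun P (_ : P ∈ T.facesMeeting W) =>
      le_sum_arcTurn hk.1 P hK hb1 hne hkK
    rw [Finset.sum_sub_distrib] at this
    refine le_trans (le_of_eq ?_) this
    congr 1
    rw [hA, Finset.sum_div]
    exact Finset.sum_congr rfl fun P _ => by ring
  have h2 : ∑ w ∈ W, T.vertexCurvature k w ≤ ∑ w ∈ W, L w :=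
    Finset.sum_le_sum fun w _ => hk.2 w
  have h3 : A / b < R - ∑ w ∈ W, L w := by
    rw [div_lt_iff₀ (by linarith), hb, mul_add, mul_div_cancel₀ _ hgap.ne']
    linarith
  linarith

lemma subsolutions_bounded
    (hcond : ∀ W : Finset T.V, W.Nonempty → ∑ w ∈ W, L w <
      ∑ P ∈ T.facesMeeting W, Real.pi * min (T.numIn P W : ℝ) ((T.sides P : ℝ) - 2)) (v : T.V) :
    BddAbove ((fun k : T.V → ℝ => k v) '' T.subsolutions L) := by
  classical
  -- `W` is the set of vertices at which the geodesic curvatures are not bounded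
  let W : Finset T.V := {v | ¬ BddAbove ((fun k : T.V → ℝ => k v) '' T.subsolutions L)}
  have hWmem : ∀ v, v ∈ W ↔ ¬ BddAbove ((fun k : T.V → ℝ => k v) '' T.subsolutions L) := fun v => by
    simp [W]
  by_contra hv
  have hne : W.Nonempty := ⟨v, (hWmem v).2 hv⟩
  have hK : ∀ v, ∃ K, 0 ≤ K ∧ (v ∉ W → ∀ k ∈ T.subsolutions L, k v ≤ K) := by
    intro v
    by_cases h : v ∈ W
    · exact ⟨0, le_rfl, fun h' => absurd h h'⟩
    · rw [hWmem, not_not] at h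
      obtain ⟨K, hK⟩ := h
      exact ⟨max K 0, le_max_right _ _, fun _ k hk =>
        (hK (Set.mem_image_of_mem _ hk)).trans (le_max_left _ _)⟩
  choose K hK0 hK using hK
  have hKs : ∀ v, K v ≤ ∑ v, K v := fun v =>
    Finset.single_le_sum (f := K) (fun w _ => hK0 w) (Finset.mem_univ v)
  obtain ⟨B, hB⟩ := exists_bound_of_large (hcond W hne)
    (K := ∑ v, K v) (Finset.sum_nonneg fun v _ => hK0 v)
  have hbig : ∀ w ∈ W, ∃ k ∈ T.subsolutions L, B ≤ k w := by
    intro w hw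
    rw [hWmem, not_bddAbove_iff] at hw
    obtain ⟨_, ⟨k, hk, rfl⟩, hlt⟩ := hw B
    exact ⟨k, hk, hlt.le⟩
  choose! κ hκ hκB using hbig
  have hsup : W.sup' hne κ ∈ T.subsolutions L :=
    Finset.sup'_induction hne κ (fun _ h _ h' => sup_mem_subsolutions h h') hκ
  obtain ⟨w, hw, hlt⟩ := hB _ hsup fun v hv => (hK v hv _ hsup).trans (hKs v)
  have := Finset.le_sup' κ hw w
  linarith [hκB w hw]

/-- Perron's method: the largest geodesic curvatures whose total geodesic curvatures are at
most `L` have total geodesic curvatures `L`. -/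
theorem exists_vertexCurvature_eq (hL : ∀ v, 0 < L v)
    (hcond : ∀ W : Finset T.V, W.Nonempty → ∑ w ∈ W, L w <
      ∑ P ∈ T.facesMeeting W, Real.pi * min (T.numIn P W : ℝ) ((T.sides P : ℝ) - 2)) :
    ∃ k : T.V → ℝ, (∀ v, 0 < k v) ∧ ∀ v, T.vertexCurvature k v = L v := by
  classical
  have hbdd := subsolutions_bounded hcond
  obtain ⟨k₀, hk₀⟩ := exists_mem_subsolutions (T := T) hL
  obtain ⟨κ, hκ⟩ : ∃ κ : T.V → ℝ, κ = fun v => sSup ((fun k : T.V → ℝ => k v) ''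
    T.subsolutions L) := ⟨_, rfl⟩
  have hle : ∀ k ∈ T.subsolutions L, ∀ v, k v ≤ κ v := fun k hk v => by
    rw [hκ]; exact le_csSup (hbdd v) (Set.mem_image_of_mem _ hk)
  have hpos : ∀ v, 0 < κ v := fun v => (hk₀.1 v).trans_le (hle _ hk₀ v)
  have happrox : ∀ c, 1 < c → ∃ k ∈ T.subsolutions L, ∀ v, κ v ≤ c * k v := by
    intro c hc
    have h1 : ∀ v, ∃ k ∈ T.subsolutions L, κ v ≤ c * k v := by
      intro v
      have hlt : κ v / c < sSup ((fun k : T.V → ℝ => k v) '' T.subsolutions L) := by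
        have : κ v / c < κ v := div_lt_self (hpos v) hc
        rwa [hκ] at this ⊢
      obtain ⟨_, ⟨k, hk, rfl⟩, h⟩ := exists_lt_of_lt_csSup ⟨_, Set.mem_image_of_mem _ hk₀⟩ hlt
      refine ⟨k, hk, ?_⟩
      rw [div_lt_iff₀ (by linarith)] at h
      linarith
    choose f hf hfc using h1
    rcases isEmpty_or_nonempty T.V with h | h
    · exact ⟨k₀, hk₀, fun v => h.elim v⟩
    · refine ⟨Finset.univ.sup' Finset.univ_nonempty f, Finset.sup'_induction _ f
        (fun _ h _ h' => sup_mem_subsolutions h h') fun v _ => hf v, fun v => (hfc v).trans ?_⟩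
      exact mul_le_mul_of_nonneg_left (Finset.le_sup' f (Finset.mem_univ v) v) (by linarith)
  have hlim : ∀ A : ℝ, Filter.Tendsto (fun c : ℝ => c ^ 2 * A) (nhdsWithin 1 (Set.Ioi 1))
      (nhds A) := by
    intro A
    have : Filter.Tendsto (fun c : ℝ => c ^ 2 * A) (nhds 1) (nhds (1 ^ 2 * A)) :=
      Continuous.tendsto (by fun_prop) 1
    rw [one_pow, one_mul] at this
    exact this.mono_left nhdsWithin_le_nhds
  have hsub : κ ∈ T.subsolutions L := by
    refine ⟨hpos, fun v => ge_of_tendsto (hlim (L v)) ?_⟩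
    filter_upwards [self_mem_nhdsWithin] with c hc
    obtain ⟨k, hk, hkc⟩ := happrox c hc
    exact (vertexCurvature_le_mul hk.1 hpos (hle k hk) (le_of_lt hc) (hkc v)).trans
      (mul_le_mul_of_nonneg_left (hk.2 v) (by positivity))
  refine ⟨κ, hpos, fun v => le_antisymm (hsub.2 v) ?_⟩
  by_contra hlt
  have hlt := not_le.1 hlt
  obtain ⟨c, hcL, hc⟩ := (((hlim (T.vertexCurvature κ v)).eventually_lt_const hlt).and
    self_mem_nhdsWithin).exists
  have hc : 1 < c := hc
  have hle' : ∀ w, κ w ≤ Function.update κ v (c * κ v) w := by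
    intro w
    by_cases hw : w = v
    · subst hw
      rw [Function.update_self]
      exact le_mul_of_one_le_left (hpos w).le hc.le
    · rw [Function.update_of_ne hw]
  have hpos' : ∀ w, 0 < Function.update κ v (c * κ v) w := fun w => (hpos w).trans_le (hle' w)
  have hmem : Function.update κ v (c * κ v) ∈ T.subsolutions L := by
    refine ⟨hpos', fun w => ?_⟩
    by_cases hw : w = v
    · subst hw
      exact (vertexCurvature_le_mul hpos hpos' hle' hc.le (by rw [Function.update_self])).trans
        hcL.le
    · exact (vertexCurvature_anti hpos hpos' hle' (Function.update_of_ne hw _ _)).trans (hsub.2 w)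
  have := hle _ hmem v
  rw [Function.update_self] at this
  have := lt_mul_of_one_lt_left (hpos v) hc
  linarith

end PolygonalDecomposition

/-! ### Circle packings with prescribed total geodesic curvatures -/

namespace CirclePackingMetric

variable {S : Type*} [TopologicalSpace S] [ChartedSpace (EuclideanHalfSpace 2) S]
  {T : PolygonalDecomposition S}

lemma totalCurvature_eq (M : CirclePackingMetric T) (v : T.V) :
    M.totalCurvature v = T.vertexCurvature M.k v := by
  classical
  refine Finset.sum_congr rfl fun P _ => Finset.sum_congr rfl fun i hi => ?_
  obtain ⟨s, hs, hsum, harc⟩ := (M.packing P).exists_radius_arcCurvature (T.three_le_sides P)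
  simp only [M.curvature_eq] at hsum harc
  rw [harc, (Finset.mem_filter.1 hi).2, radius_unique hs
    (PolygonalDecomposition.faceRadius_pos M.k_pos P) (fun i => M.k_pos (T.corner P i)) hsum
    (PolygonalDecomposition.sum_halfAngle_faceRadius M.k_pos P)]

lemma exists_k_eq {k : T.V → ℝ} (hk : ∀ v, 0 < k v) : ∃ M : CirclePackingMetric T, M.k = k := by
  choose Q hQ using fun P => exists_polygonPacking_curvature (T.three_le_sides P)
    fun i => hk (T.corner P i)
  exact ⟨⟨k, hk, Q, hQ⟩, rfl⟩

end CirclePackingMetric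

theorem theorem1p1 {S : Type*} [TopologicalSpace S] [T2Space S] [CompactSpace S]
    [ConnectedSpace S] [ChartedSpace (EuclideanHalfSpace 2) S]
    (T : PolygonalDecomposition S) (L : T.V → ℝ) (hL : ∀ v, 0 < L v) :
    ((∃ M : CirclePackingMetric T, ∀ v, M.totalCurvature v = L v) ↔
      ∀ W : Finset T.V, W.Nonempty →
        ∑ w ∈ W, L w <
          ∑ P ∈ T.facesMeeting W, Real.pi * min (T.numIn P W : ℝ) ((T.sides P : ℝ) - 2)) ∧
    ∀ M M' : CirclePackingMetric T, (∀ v, M.totalCurvature v = L v) →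
      (∀ v, M'.totalCurvature v = L v) → M.Same M' := by
  refine ⟨⟨?_, ?_⟩, ?_⟩
  · rintro ⟨M, hM⟩ W ⟨w, hw⟩
    simp only [M.totalCurvature_eq] at hM
    -- as `L` is positive, every vertex belongs to some face
    obtain ⟨P, i, hi⟩ := PolygonalDecomposition.exists_corner_of_vertexCurvature_pos
      (k := M.k) (v := w) (by rw [hM]; exact hL w)
    have hP : P ∈ T.facesMeeting W := by
      rw [PolygonalDecomposition.mem_facesMeeting_iff]
      exact ⟨i, by simpa [PolygonalDecomposition.cornersIn, hi] using hw⟩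
    rw [← Finset.sum_congr rfl fun v _ => hM v, PolygonalDecomposition.sum_vertexCurvature]
    exact Finset.sum_lt_sum_of_nonempty ⟨P, hP⟩ fun P hP =>
      PolygonalDecomposition.sum_arcTurn_lt M.k_pos hP
  · intro hcond
    obtain ⟨k, hk, hkL⟩ := PolygonalDecomposition.exists_vertexCurvature_eq hL hcond
    obtain ⟨M, rfl⟩ := CirclePackingMetric.exists_k_eq hk
    exact ⟨M, fun v => (M.totalCurvature_eq v).trans (hkL v)⟩
  · intro M M' hM hM'
    simp only [CirclePackingMetric.totalCurvature_eq] at hM hM'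
    have heq : ∀ v, T.vertexCurvature M'.k v = T.vertexCurvature M.k v := fun v => by
      rw [hM, hM']
    refine CirclePackingMetric.same_of_k_eq (funext fun v => le_antisymm ?_ ?_)
    · exact PolygonalDecomposition.le_of_vertexCurvature_eq M'.k_pos M.k_pos
        (fun v => hM' v ▸ hL v) (fun v => (heq v).symm) v
    · exact PolygonalDecomposition.le_of_vertexCurvature_eq M.k_pos M'.k_pos
        (fun v => hM v ▸ hL v) heq v
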